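/- Let $(N,g)$ be a smooth (Hausdorff, boundaryless) Riemannian surface and $M\subset N$ a compact set. Let $H\subset N$ be a smooth regular curve with coordinate $y$ and smooth unit normal $\nu$, let $\eta$ be the dual variable to $y$, and let $BH$ be the set of $(y,\eta)$ with $|\eta|_g<1$. For $(y,\eta)\in BH$ let $t\mapsto\gamma(y,\eta,t)$ be the unit speed geodesic issued at $t=0$ from the point $y\in H$ in the unit direction $\theta$ with $\langle\theta,\nu\rangle>0$ and $\langle\theta,\partial_y\rangle=\eta$. Let $\mathcal M_0$ be an open set of directed geodesics, parametrized by $(y,\eta)$ in an open set $\mathcal U\subset BH$; its elements are the segments $\gamma(y,\eta,t)$, $t\in[t_{\min}(y,\eta),t_{\max}(y,\eta)]\ni 0$, and their end points lie outside $M$. Assume that every unit vector is the velocity of at most one geodesic in $\mathcal M_0$, at no more than one time, and that no unit vector is the velocity of one geodesic in $\mathcal M_0$ and the negative of the velocity of another one or of the same one. Let $V$ be the set of $(x,\xi)\in T^*N$ with $\xi\neq0$, $x$ in the interior of $M$, and $\xi$ conormal at $x$ to some geodesic in $\mathcal M_0$. For $(x,\xi)\in V$ there is a unique $(y,\eta,t)$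 with $(y,\eta)\in\mathcal U$, $t\in[t_{\min}(y,\eta),t_{\max}(y,\eta)]$, $x=\gamma(y,\eta,t)$ and $\xi(\partial_t\gamma(y,\eta,t))=0$. Put $$\mathcal C(x,\xi)=\bigl(y,\eta,\ \xi(\partial_y\gamma(y,\eta,t)),\ \xi(\partial_\eta\gamma(y,\eta,t))\bigr)\in T^*\mathcal M_0 ,$$ the canonical map of the geodesic X-ray transform: $\mathcal C=\pi_{\mathcal M}\circ\pi_M^{-1}$, where $\pi_{\mathcal M}$ and $\pi_M$ are the projections to $T^*\mathcal M_0$ and $T^*N$ of the twisted conormal bundle of the relation $\{(\gamma,x): x\in\gamma\}$. Let $(p_1,\xi^1),(p_2,\xi^2)\in V$ with $(p_1,\xi^1)\neq(p_2,\xi^2)$. Then $\mathcal C(p_1,\xi^1)=\mathcal C(p_2,\xi^2)$ if and only if there is a geodesic $c:[0,1]\to N$ from $p_1$ to $p_2$, which is an affinely parametrized nondegenerate segment (in either direction) of a geodesic in $\mathcal M_0$, such that (a) $p_1$ and $p_2$ are conjugate along $c$, i.e. the differential of $\exp_{p_1}$ at $c'(0)$ is not an isomorphism; (b) there is a nontrivial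 Jacobi field $J$ along $c$ with $J(0)=J(1)=0$, it is unique up to multiplication by a constant, and for some $\lambda\neq0$ the covectors $\xi^1$ and $\xi^2$ are the metric duals of $\lambda J'(0)$ and $\lambda J'(1)$, where $J'$ is the covariant derivative of $J$ along $c$. -/

import Mathlib

open Set Bundle Manifold
open scoped ContDiff

noncomputable section

namespace XRay

/-- The Euclidean plane, the model space of a surface. -/
abbrev E2 : Type := EuclideanSpace ℝ (Fin 2)

/-- The cotangent bundle of a surface: a point `x` with a linear form on `T_x N`. -/
abbrev Cotangent (N : Type*) [TopologicalSpace N] [ChartedSpace E2 N] : Type _ :=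
  TotalSpace (E2 →L[ℝ] ℝ) (fun x : N => TangentSpace (𝓡 2) x →L[ℝ] ℝ)

/-- A smooth Riemannian metric on a surface. -/
abbrev Metric (N : Type*) [TopologicalSpace N] [ChartedSpace E2 N] [IsManifold (𝓡 2) ∞ N] :
    Type _ :=
  ContMDiffRiemannianMetric (𝓡 2) ∞ E2 (fun x : N => TangentSpace (𝓡 2) x)

variable {N : Type*} [TopologicalSpace N] [ChartedSpace E2 N] [IsManifold (𝓡 2) ∞ N]

/-! ### Christoffel symbols and curvature in coordinates -/

section Coordinates

variable {E : Type*} [NormedAddCommGroup E] [NormedSpace ℝ E]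

/-- The Christoffel symbols, as a bilinear map, of the Levi-Civita connection of the metric `G` on
an open subset of a vector space: `Γ_u(X, Y)` is the vector with
`G_u(Γ_u(X, Y), Z) = (D_X G(Y, Z) + D_Y G(X, Z) - D_Z G(X, Y)) / 2` for all `Z`. -/
def christoffel (G : E → E →L[ℝ] E →L[ℝ] ℝ) (u X Y : E) : E :=
  (G u).inverse ((1 / 2 : ℝ) •
    (fderiv ℝ G u X Y + fderiv ℝ G u Y X - ((fderiv ℝ G u).flip X).flip Y))

/-- The curvature `R(X, Y) Z` of the metric `G` on an open subset of a vector space, with the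
convention `R(X, Y) Z = ∇_X ∇_Y Z - ∇_Y ∇_X Z - ∇_{[X, Y]} Z`. -/
def curvatureCoord (G : E → E →L[ℝ] E →L[ℝ] ℝ) (u X Y Z : E) : E :=
  fderiv ℝ (fun w => christoffel G w Y Z) u X - fderiv ℝ (fun w => christoffel G w X Z) u Y
    + christoffel G u X (christoffel G u Y Z) - christoffel G u Y (christoffel G u X Z)

end Coordinates

/-- The metric in the chart around `c`: the bilinear form `(X, Y) ↦ g(dφ⁻¹ X, dφ⁻¹ Y)` at the
coordinate point `u`, where `φ` is the chart. -/
def metricInChart (g : Metric N) (c : N) (u : E2) : E2 →L[ℝ] E2 →L[ℝ] ℝ :=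
  let A : E2 →L[ℝ] E2 := mfderiv 𝓘(ℝ, E2) (𝓡 2) (extChartAt (𝓡 2) c).symm u
  let B : E2 →L[ℝ] E2 →L[ℝ] ℝ := g.inner ((extChartAt (𝓡 2) c).symm u)
  B.bilinearComp A A

/-- The curvature tensor `R(X, Y) Z` at the point `x`, computed in the chart around `x`. -/
def curvature (g : Metric N) (x : N) (X Y Z : TangentSpace (𝓡 2) x) : TangentSpace (𝓡 2) x :=
  let φ := extChartAt (𝓡 2) x
  let d : TangentSpace (𝓡 2) x →L[ℝ] E2 := mfderiv (𝓡 2) 𝓘(ℝ, E2) φ x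
  d.inverse (curvatureCoord (metricInChart g x) (φ x) (d X) (d Y) (d Z))

/-! ### Geodesics, Jacobi fields, the exponential map -/

/-- The velocity of a curve defined on the set `s` (one-sided at the end points of an interval). -/
def velocity (γ : ℝ → N) (s : Set ℝ) (t : ℝ) : TangentSpace (𝓡 2) (γ t) :=
  mfderivWithin 𝓘(ℝ, ℝ) (𝓡 2) γ s t (1 : ℝ)

/-- The covariant derivative `D_t X` along the curve `γ` (defined on `s`) of a vector field `X`
along `γ`. At time `t` it is computed in the chart around `γ t`, as `X' + Γ(γ', X)`. -/
def covDeriv (g : Metric N) (γ : ℝ → N) (s : Set ℝ) (X : ∀ t, TangentSpace (𝓡 2) (γ t)) (t : ℝ) :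
    TangentSpace (𝓡 2) (γ t) :=
  let φ := extChartAt (𝓡 2) (γ t)
  let d : ∀ τ, TangentSpace (𝓡 2) (γ τ) →L[ℝ] E2 := fun τ => mfderiv (𝓡 2) 𝓘(ℝ, E2) φ (γ τ)
  let u : ℝ → E2 := fun τ => φ (γ τ)
  let x : ℝ → E2 := fun τ => d τ (X τ)
  (d t).inverse
    (derivWithin x s t + christoffel (metricInChart g (γ t)) (u t) (derivWithin u s t) (x t))

/-- `γ` is a geodesic on `s`: it is `C²` there and its velocity is parallel. -/
def IsGeodesicOn (g : Metric N) (γ : ℝ → N) (s : Set ℝ) : Prop :=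
  ContMDiffOn 𝓘(ℝ, ℝ) (𝓡 2) 2 γ s ∧ ∀ t ∈ s, covDeriv g γ s (velocity γ s) t = 0

/-- `J` is a Jacobi field along the curve `γ` on `s`: `D_t D_t J + R(J, γ') γ' = 0`. -/
def IsJacobiFieldOn (g : Metric N) (γ : ℝ → N) (s : Set ℝ) (J : ∀ t, TangentSpace (𝓡 2) (γ t)) :
    Prop :=
  ContMDiffOn 𝓘(ℝ, ℝ) (𝓡 2).tangent 2 (fun t => (⟨γ t, J t⟩ : TangentBundle (𝓡 2) N)) s ∧
  ∀ t ∈ s, covDeriv g γ s (covDeriv g γ s J) t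
    + curvature g (γ t) (J t) (velocity γ s t) (velocity γ s t) = 0

/-- `c` restricted to `[0, 1]` is a geodesic with initial point `x` and initial velocity `v`. -/
def IsGeodesicFrom (g : Metric N) (x : N) (v : TangentSpace (𝓡 2) x) (c : ℝ → N) : Prop :=
  IsGeodesicOn g c (Icc 0 1) ∧
  (⟨c 0, velocity c (Icc 0 1) 0⟩ : TangentBundle (𝓡 2) N) = ⟨x, v⟩

/-- The set of `v ∈ T_x N` at which the exponential map is defined. -/
def expDomain (g : Metric N) (x : N) : Set (TangentSpace (𝓡 2) x) :=
  {v | ∃ c, IsGeodesicFrom g x v c}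

open Classical in
/-- The exponential map: `exp_x v = c(1)`, where `c : [0, 1] → N` is the geodesic with `c(0) = x`
and `c'(0) = v` (and the value `x` where there is no such geodesic). -/
def expMap (g : Metric N) (x : N) (v : TangentSpace (𝓡 2) x) : N :=
  if h : ∃ c, IsGeodesicFrom g x v c then h.choose 1 else x

/-- The end points of the geodesic `c : [0, 1] → N` are conjugate along `c`: the initial velocity
of `c` is a conjugate vector at `c 0`, i.e. the differential of `exp_{c 0}` there is not an
isomorphism. -/
def ConjugateAlong (g : Metric N) (c : ℝ → N) : Prop :=
  ¬ Function.Bijective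
    (mfderiv 𝓘(ℝ, E2) (𝓡 2) (fun v : E2 => expMap g (c 0) v) (velocity c (Icc 0 1) 0))

/-! ### The manifold of geodesics near a transversal curve -/

/-- A regular parametrized curve `H` in the surface with a smooth unit normal field `ν`. -/
structure OrientedCurve (g : Metric N) where
  /-- the set of values of the coordinate `y` on `H` -/
  dom : Set ℝ
  isOpen_dom : IsOpen dom
  /-- the point of `H` with coordinate `y` -/
  pt : ℝ → N
  /-- the unit normal -/
  ν : ∀ y, TangentSpace (𝓡 2) (pt y)
  smooth_pt : ContMDiffOn 𝓘(ℝ, ℝ) (𝓡 2) ∞ pt dom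
  regular : ∀ y ∈ dom, velocity pt dom y ≠ 0
  smooth_ν : ContMDiffOn 𝓘(ℝ, ℝ) (𝓡 2).tangent ∞
    (fun y => (⟨pt y, ν y⟩ : TangentBundle (𝓡 2) N)) dom
  unit_ν : ∀ y ∈ dom, g.inner (pt y) (ν y) (ν y) = 1
  normal_ν : ∀ y ∈ dom, g.inner (pt y) (ν y) (velocity pt dom y) = 0

namespace OrientedCurve

variable {g : Metric N} (H : OrientedCurve g)

/-- The squared length of the coordinate vector `∂/∂y` of `H`. -/
def speedSq (y : ℝ) : ℝ :=
  g.inner (H.pt y) (velocity H.pt H.dom y) (velocity H.pt H.dom y)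

/-- The open unit ball bundle `BH ≅ B*H`, in the coordinates `(y, η)`, `η` dual to `y`. -/
def ballBundle : Set (ℝ × ℝ) := {q | q.1 ∈ H.dom ∧ q.2 ^ 2 < H.speedSq q.1}

/-- The unit vector at the point `y` of `H` on the side of `ν` whose orthogonal projection to `H`
is `η`, that is, whose inner product with `∂/∂y` is `η`. -/
def direction (q : ℝ × ℝ) : TangentSpace (𝓡 2) (H.pt q.1) :=
  (q.2 / H.speedSq q.1) • velocity H.pt H.dom q.1
    + Real.sqrt (1 - q.2 ^ 2 / H.speedSq q.1) • H.ν q.1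

/-- `γ(y, η, t)`, for `w = (y, η, t)`: the point at time `t` of the unit speed geodesic issued at
time `0` from the point `y` of `H` in the direction given by `η`. -/
def geodesic (w : ℝ × ℝ × ℝ) : N :=
  expMap g (H.pt w.1) (w.2.2 • H.direction (w.1, w.2.1))

/-- The velocity `∂γ/∂t (y, η, t)`, with its base point. -/
def geodesicVelocity (q : ℝ × ℝ) (t : ℝ) : TangentBundle (𝓡 2) N :=
  ⟨H.geodesic (q.1, q.2, t), velocity (fun τ => H.geodesic (q.1, q.2, τ)) univ t⟩

end OrientedCurve

/-- A compact set `M` in the surface and an open set `𝓜₀` of directed geodesics, with end points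
outside `M`, that cross an oriented curve `H` transversally. The geodesics in `𝓜₀` are the curves
`t ↦ γ(y, η, t)`, `tmin (y, η) ≤ t ≤ tmax (y, η)`, for `(y, η)` in the open subset `params` of
`BH`, so that `(y, η)` are coordinates on `𝓜₀`. -/
structure GeodesicManifold (g : Metric N) where
  M : Set N
  isCompact_M : IsCompact M
  H : OrientedCurve g
  params : Set (ℝ × ℝ)
  isOpen_params : IsOpen params
  params_subset : params ⊆ H.ballBundle
  tmin : ℝ × ℝ → ℝ
  tmax : ℝ × ℝ → ℝ
  tmin_le : ∀ q ∈ params, tmin q ≤ 0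
  le_tmax : ∀ q ∈ params, 0 ≤ tmax q
  /-- the geodesic exists on the whole interval `[tmin, tmax]` -/
  defined : ∀ q ∈ params, ∀ t ∈ Icc (tmin q) (tmax q), t • H.direction q ∈ expDomain g (H.pt q.1)
  start_notMem : ∀ q ∈ params, H.geodesic (q.1, q.2, tmin q) ∉ M
  end_notMem : ∀ q ∈ params, H.geodesic (q.1, q.2, tmax q) ∉ M
  /-- a unit vector is tangent to at most one geodesic in `𝓜₀`, at at most one time: different
  coordinates give different geodesics, and the geodesics are not closed -/
  simple : ∀ q ∈ params, ∀ t ∈ Icc (tmin q) (tmax q),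
    ∀ q' ∈ params, ∀ t' ∈ Icc (tmin q') (tmax q'),
      H.geodesicVelocity q t = H.geodesicVelocity q' t' → q = q' ∧ t = t'
  /-- no geodesic in `𝓜₀` is run through in the opposite direction by a geodesic in `𝓜₀` -/
  odd : ∀ q ∈ params, ∀ t ∈ Icc (tmin q) (tmax q),
    ∀ q' ∈ params, ∀ t' ∈ Icc (tmin q') (tmax q'),
      H.geodesicVelocity q t ≠ ⟨(H.geodesicVelocity q' t').1, -(H.geodesicVelocity q' t').2⟩

namespace GeodesicManifold

variable {g : Metric N} (𝓜 : GeodesicManifold g)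

/-- The times at which the geodesic with coordinates `q` is considered. -/
def times (q : ℝ × ℝ) : Set ℝ := Icc (𝓜.tmin q) (𝓜.tmax q)

/-- The canonical relation `C`, the twisted conormal bundle of the point-geodesic relation
`Z₀ = {(γ, x) | x ∈ γ}`, which is parametrized by `(y, η, t) ↦ (y, η, γ(y, η, t))`.
Elements are `(((y, η), (ŷ, η̂)), (x, ξ))`: an element of `T*𝓜₀` in the coordinates `(y, η)` and
their dual coordinates, and a nonzero covector `(x, ξ)` at an interior point of `M` such that
`ξ(dγ(dy, dη, dt)) - ŷ dy - η̂ dη = 0` for all `(dy, dη, dt)`. -/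
def canonicalRelation : Set (((ℝ × ℝ) × (ℝ × ℝ)) × Cotangent N) :=
  {z | z.2.2 ≠ 0 ∧ z.2.1 ∈ interior 𝓜.M ∧ z.1.1 ∈ 𝓜.params ∧
    ∃ t ∈ 𝓜.times z.1.1,
      ∃ ξ : TangentSpace (𝓡 2) (𝓜.H.geodesic (z.1.1.1, z.1.1.2, t)) →L[ℝ] ℝ,
        z.2 = ⟨𝓜.H.geodesic (z.1.1.1, z.1.1.2, t), ξ⟩ ∧
        ∀ dy dη dt : ℝ,
          ξ (mfderiv 𝓘(ℝ, ℝ × ℝ × ℝ) (𝓡 2) 𝓜.H.geodesic (z.1.1.1, z.1.1.2, t)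
            ((dy, dη, dt) : ℝ × ℝ × ℝ)) = z.1.2.1 * dy + z.1.2.2 * dη}

/-- `V = ⋃ N*γ`: the nonzero covectors at interior points of `M` that are conormal to a geodesic
in `𝓜₀`. -/
def conormals : Set (Cotangent N) :=
  {p | p.2 ≠ 0 ∧ p.1 ∈ interior 𝓜.M ∧ ∃ q ∈ 𝓜.params, ∃ t ∈ 𝓜.times q,
    ∃ ξ : TangentSpace (𝓡 2) (𝓜.H.geodesicVelocity q t).1 →L[ℝ] ℝ,
      p = ⟨(𝓜.H.geodesicVelocity q t).1, ξ⟩ ∧ ξ (𝓜.H.geodesicVelocity q t).2 = 0}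

/-- The canonical map `𝒞 = π_𝓜 ∘ π_M⁻¹ : V → T*𝓜₀`, in coordinates: `𝒞(x, ξ)` is the
`((y, η), (ŷ, η̂))` that is related to `(x, ξ)` by the canonical relation. -/
def canonicalMap (p : Cotangent N) : (ℝ × ℝ) × (ℝ × ℝ) :=
  Classical.epsilon fun Γ => (Γ, p) ∈ 𝓜.canonicalRelation

/-- `c : [0, 1] → N` is a geodesic that is a nondegenerate segment of a geodesic in `𝓜₀`,
parametrized affinely (in one or the other direction). -/
def IsSegment (c : ℝ → N) : Prop :=
  IsGeodesicOn g c (Icc 0 1) ∧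
  ∃ q ∈ 𝓜.params, ∃ t₁ ∈ 𝓜.times q, ∃ t₂ ∈ 𝓜.times q, t₁ ≠ t₂ ∧
    ∀ s ∈ Icc (0 : ℝ) 1, c s = 𝓜.H.geodesic (q.1, q.2, t₁ + s * (t₂ - t₁))

end GeodesicManifold

end XRay

end

/-!
The canonical map determines, for a conormal covector `(x, ξ)`, the geodesic `γ = γ(y, η, ·)` to which
it is conormal, and the values `ξ(∂_y γ)`, `ξ(∂_η γ)` at the time `t` with `γ(t) = x`. The geodesic
and the time are unique since a nonzero covector in the plane has just two unit vectors in its kernel,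
which are opposite to each other (`IsConormalAt.eq`). So two covectors with the same image are
conormal to the same geodesic, at times `t₁` and `t₂`, and the question is when a covector at `t₁` and
a covector at `t₂`, both vanishing on `γ'`, agree on the variation fields `J_y = ∂_y γ` and
`J_η = ∂_η γ`.

These are Jacobi fields. For Jacobi fields `X`, `Y` along a geodesic the symplectic product
`ω(X, Y) = ⟨X, Y'⟩ - ⟨X', Y⟩` is constant in time (`IsJac.sympl_eq`), and `ω(J_y, J_η) = 1`, since `η`
is dual to `y` (`gform_initial_coord`); moreover `J_y'` and `J_η'` are normal to the geodesic, since
all geodesics have unit speed. If `J` is the Jacobi field with `J(t₁) = 0` whose derivative there is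
dual to `ξ¹`, then `ω(J, J_y)` is `-ξ¹(J_y)` at `t₁`. If `ξ¹` and `ξ²` agree on `J_y` and `J_η`, the
pair `(J(t₂), J'(t₂) - ξ²)` is therefore `ω`-orthogonal to `J_y` and `J_η`. Both of its components are
normal to the geodesic, and the pairs of normal vectors form a symplectic plane to which `J_y` and
`J_η` project as a basis, so that `J(t₂) = 0` and `J'(t₂)` is dual to `ξ²` (`eq_zero_of_sympl_eq_zero`,
`exists_isJac_of_covectors`). Conversely, if `J` vanishes at both ends, then its derivatives there are
normal to the geodesic and the constancy of `ω(J, J_y)` and `ω(J, J_η)` gives equal images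
(`covectors_of_isJac`). At equal times `t₁ = t₂` the covectors agree, because `γ'`, `J_y` and `J_η`
span the tangent plane (`eq_zero_of_apply_eq_zero`). The Jacobi fields that vanish at both ends are
determined by a normal vector, `J'(t₁)`, up to a factor (`IsJac.exists_smul_eq`).

This relies on the geodesic flow and its derivative. Geodesics and Jacobi fields are described as
integral curves of the geodesic spray and of its linearization, in the coordinates of every chart
(`IsGeo`, `IsJac`); the linearized equation is invariant under changes of coordinates, as the
derivative of the statement that the spray is. The derivative of the flow of a smooth vector field
with respect to the initial value is the flow of the linearized equation (`exists_local_flow`), and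
local flows are composed along a geodesic (`exists_flow`). Thus the differential of the exponential
map is given by Jacobi fields (`IsGeo.hasMFDerivAt_expMap`), and so are conjugate points and the
derivatives of `γ(y, η, t)`. That these Jacobi fields and geodesics are those defined by the covariant
derivative and the curvature is the content of `IsJacobiFieldOn.isJac`, `IsJac.isJacobiFieldOn`,
`IsGeodesicOn.isGeo` and `IsGeo.isGeodesicOn`.
-/

set_option linter.unusedSectionVars false

noncomputable section

namespace XRay

open Filter Metric Topology NNReal

/-! ### Ordinary differential equations -/

/-- A property of the points of a compact interval that propagates locally to the right holds at the
right end point as soon as it holds at the left one. -/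
theorem propagate_Icc {P : ℝ → Prop} {a b : ℝ} (hab : a ≤ b) (ha : P a)
    (hloc : ∀ τ ∈ Icc a b, ∃ δ > 0, ∀ s ∈ Icc a b, ∀ s' ∈ Icc a b, |s - τ| < δ → |s' - τ| < δ →
      s ≤ s' → P s → P s') : P b := by
  set S : Set ℝ := {x | x ∈ Icc a b ∧ P x} with hS
  have haS : a ∈ S := ⟨⟨le_rfl, hab⟩, ha⟩
  have hbd : BddAbove S := ⟨b, fun x hx => hx.1.2⟩
  have hσ : sSup S ∈ Icc a b := ⟨le_csSup hbd haS, csSup_le ⟨a, haS⟩ fun x hx => hx.1.2⟩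
  obtain ⟨δ, hδ, H⟩ := hloc _ hσ
  obtain ⟨s, hs, hs'⟩ := exists_lt_of_lt_csSup ⟨a, haS⟩ (sub_lt_self (sSup S) hδ)
  have hsle : s ≤ sSup S := le_csSup hbd hs
  have key : P (min b (sSup S + δ / 2)) := by
    refine H s hs.1 _ ⟨le_min hab (by linarith [hσ.1]), min_le_left _ _⟩ ?_ ?_ ?_ hs.2
    · rw [abs_lt]; constructor <;> linarith
    · rw [abs_lt]
      constructor
      · have : sSup S ≤ min b (sSup S + δ / 2) := le_min hσ.2 (by linarith)
        linarith
      · have := min_le_right b (sSup S + δ / 2)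
        linarith
    · exact le_min hs.1.2 (by linarith)
  rcases le_total b (sSup S + δ / 2) with h | h
  · rwa [min_eq_left h] at key
  · rw [min_eq_right h] at key
    have : sSup S + δ / 2 ≤ sSup S := le_csSup hbd ⟨⟨by linarith [hσ.1], h⟩, key⟩
    linarith

section ODE

variable {F : Type*} [NormedAddCommGroup F] [NormedSpace ℝ F]

theorem hasDerivWithinAt_Ici_of_Icc {f : ℝ → F} {f' : F} {a b t : ℝ} (ht : t ∈ Ico a b)
    (h : HasDerivWithinAt f f' (Icc a b) t) : HasDerivWithinAt f f' (Ici t) t :=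
  h.mono_of_mem_nhdsWithin (Icc_mem_nhdsGE_of_mem ht)

/-- Solutions of an ordinary differential equation with the same initial value agree. -/
theorem ode_unique_Icc {v : ℝ → F → F} {U : ℝ → Set F} {K : ℝ≥0} {f g : ℝ → F} {a b : ℝ}
    (hv : ∀ t ∈ Icc a b, LipschitzOnWith K (v t) (U t))
    (hf : ∀ t ∈ Icc a b, HasDerivWithinAt f (v t (f t)) (Icc a b) t)
    (hfU : ∀ t ∈ Icc a b, f t ∈ U t)
    (hg : ∀ t ∈ Icc a b, HasDerivWithinAt g (v t (g t)) (Icc a b) t)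
    (hgU : ∀ t ∈ Icc a b, g t ∈ U t) (h : f a = g a) : EqOn f g (Icc a b) :=
  ODE_solution_unique_of_mem_Icc_right (fun t ht => hv t (Ico_subset_Icc_self ht))
    (fun t ht => (hf t ht).continuousWithinAt)
    (fun t ht => hasDerivWithinAt_Ici_of_Icc ht (hf t (Ico_subset_Icc_self ht)))
    (fun t ht => hfU t (Ico_subset_Icc_self ht)) (fun t ht => (hg t ht).continuousWithinAt)
    (fun t ht => hasDerivWithinAt_Ici_of_Icc ht (hg t (Ico_subset_Icc_self ht)))
    (fun t ht => hgU t (Ico_subset_Icc_self ht)) h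

/-- The second order Taylor estimate for a map whose derivative is Lipschitz on a convex set. -/
theorem norm_sub_sub_fderiv_le {S : F → F} {U : Set F} (hU : Convex ℝ U) {K : ℝ≥0}
    (hd : ∀ z ∈ U, DifferentiableAt ℝ S z) (hL : LipschitzOnWith K (fderiv ℝ S) U)
    {z w : F} (hz : z ∈ U) (hw : w ∈ U) :
    ‖S w - S z - fderiv ℝ S z (w - z)‖ ≤ K * ‖w - z‖ ^ 2 := by
  have hseg : segment ℝ z w ⊆ U := hU.segment_subset hz hw
  have := (convex_segment z w).norm_image_sub_le_of_norm_hasFDerivWithin_le' (f := S)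
    (f' := fun x => fderiv ℝ S x) (φ := fderiv ℝ S z) (C := K * ‖w - z‖)
    (fun x hx => (hd x (hseg hx)).hasFDerivAt.hasFDerivWithinAt)
    (fun x hx => by
      refine (hL.norm_sub_le (hseg hx) hz).trans ?_
      gcongr
      exact norm_sub_le_of_mem_segment hx)
    (left_mem_segment ℝ z w) (right_mem_segment ℝ z w)
  simpa [pow_two, mul_assoc] using this

variable [CompleteSpace F]

/-- Differentiable dependence on the initial value: the local flow `Φ` of a `C²` vector field `S` is
differentiable in the initial value, and its derivative `L` solves the linearized equation. -/
theorem exists_local_flow {S : F → F} {z₀ : F} (hS : ContDiffAt ℝ 2 S z₀) {Ω : Set F}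
    (hΩ : Ω ∈ 𝓝 z₀) :
    ∃ r > 0, ∃ ε > 0, ∃ (Φ : F → ℝ → F) (L : F → ℝ → F →L[ℝ] F), ∀ z ∈ ball z₀ r,
      Φ z 0 = z ∧ L z 0 = ContinuousLinearMap.id ℝ F ∧ ∀ t ∈ Icc 0 ε, Φ z t ∈ Ω ∧
        HasDerivWithinAt (Φ z) (S (Φ z t)) (Icc 0 ε) t ∧
        HasDerivWithinAt (L z) ((fderiv ℝ S (Φ z t)).comp (L z t)) (Icc 0 ε) t ∧
        HasFDerivAt (fun z => Φ z t) (L z t) z := by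
  have hdS : ContDiffAt ℝ 1 (fderiv ℝ S) z₀ := hS.fderiv_right (m := 1) (by norm_num)
  obtain ⟨K₂, U₂, hU₂, hL₂⟩ := hdS.exists_lipschitzOnWith
  have hd : ∀ᶠ z in 𝓝 z₀, DifferentiableAt ℝ S z :=
    (hS.eventually (by simp)).mono fun z hz => hz.differentiableAt (by simp)
  have hbd : ∀ᶠ z in 𝓝 z₀, ‖fderiv ℝ S z‖ < ‖fderiv ℝ S z₀‖ + 1 :=
    hdS.continuousAt.norm.eventually_lt continuousAt_const (by simp)
  obtain ⟨ρ, hρ, hball⟩ := Metric.mem_nhds_iff.1 (inter_mem (inter_mem hΩ hU₂) (hd.and hbd))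
  set K₁ : ℝ := ‖fderiv ℝ S z₀‖ + 1 with hK₁
  have hK₁0 : 0 < K₁ := by positivity
  -- the flow together with its derivative is the flow of this field
  let X : F × (F →L[ℝ] F) → F × (F →L[ℝ] F) := fun p => (S p.1, (fderiv ℝ S p.1).comp p.2)
  have hX : ContDiffAt ℝ 1 X (z₀, ContinuousLinearMap.id ℝ F) := by
    refine ContDiffAt.prodMk ?_ ?_
    · exact ContDiffAt.comp (f := Prod.fst) (z₀, ContinuousLinearMap.id ℝ F)
        (hS.of_le (by norm_num)) contDiffAt_fst
    · exact (ContDiffAt.comp (f := Prod.fst) (z₀, ContinuousLinearMap.id ℝ F)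
        hdS contDiffAt_fst).clm_comp contDiffAt_snd
  obtain ⟨ε, hε, a, r, B, K, hr, hPL⟩ := IsPicardLindelof.of_contDiffAt_one hX
  obtain ⟨α, hα, L', hL'⟩ :=
    (hPL 0).exists_forall_mem_closedBall_eq_hasDerivWithinAt_lipschitzOnWith
  let ι : F → F × (F →L[ℝ] F) := fun z => (z, ContinuousLinearMap.id ℝ F)
  have hdist : ∀ z w, dist (ι z) (ι w) = dist z w := fun z w => by simp [ι, Prod.dist_eq]
  have hι : ∀ z ∈ ball z₀ (r : ℝ), ι z ∈ closedBall (z₀, ContinuousLinearMap.id ℝ F) (r : ℝ) := by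
    intro z hz
    rw [mem_closedBall]
    exact (hdist z z₀).trans_le (mem_ball.1 hz).le
  have hr0 : (0 : ℝ) < r := by exact_mod_cast hr
  have hz₀ : ι z₀ ∈ closedBall (z₀, ContinuousLinearMap.id ℝ F) (r : ℝ) :=
    mem_closedBall_self hr0.le
  have h0ε : (0 : ℝ) ∈ Icc (0 - ε) (0 + ε) := ⟨by linarith, by linarith⟩
  -- for small times the central solution stays close to `z₀`
  have hcont : ContinuousAt (fun t => (α (ι z₀) t).1) 0 := by
    have := ((hα _ hz₀).2 0 h0ε).continuousWithinAt.continuousAt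
      (Icc_mem_nhds (by linarith) (by linarith))
    exact continuous_fst.continuousAt.comp this
  have hstart : (α (ι z₀) 0).1 = z₀ := by
    have := (hα _ hz₀).1
    simp only at this
    rw [this]
  have hev : ∀ᶠ t in 𝓝 (0 : ℝ), dist (α (ι z₀) t).1 z₀ < ρ / 2 := by
    have := Metric.continuousAt_iff'.1 hcont (ρ / 2) (by linarith)
    rwa [hstart] at this
  obtain ⟨ε', hε', hεball⟩ := Metric.eventually_nhds_iff.1 hev
  set η : ℝ := min ε (ε' / 2) with hη
  have hη0 : 0 < η := lt_min hε (by linarith)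
  set R : ℝ := min r (ρ / 2 / (L' + 1)) with hR
  have hR0 : 0 < R := lt_min hr0 (by positivity)
  have hsub : Icc 0 η ⊆ Icc (0 - ε) (0 + ε) :=
    Icc_subset_Icc (by linarith) (by linarith [min_le_left ε (ε' / 2)])
  have hRr : ball z₀ R ⊆ ball z₀ (r : ℝ) := ball_subset_ball (min_le_left _ _)
  have hLip : ∀ t ∈ Icc 0 η, ∀ z ∈ ball z₀ R, ∀ w ∈ ball z₀ R,
      ‖(α (ι z) t).1 - (α (ι w) t).1‖ ≤ L' * ‖z - w‖ := by
    intro t ht z hz w hw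
    have := (hL' t (hsub ht)).dist_le_mul _ (hι z (hRr hz)) _ (hι w (hRr hw))
    rw [hdist] at this
    rw [← dist_eq_norm, ← dist_eq_norm]
    exact (le_max_left _ _).trans this
  have hmem : ∀ t ∈ Icc 0 η, ∀ z ∈ ball z₀ R, (α (ι z) t).1 ∈ ball z₀ ρ := by
    intro t ht z hz
    have h1 := hLip t ht z hz z₀ (mem_ball_self hR0)
    have h2 : dist (α (ι z₀) t).1 z₀ < ρ / 2 := by
      apply hεball
      rw [Real.dist_eq, sub_zero, abs_of_nonneg ht.1]
      have := ht.2.trans (min_le_right ε (ε' / 2))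
      linarith
    have h3 : (L' : ℝ) * ‖z - z₀‖ ≤ ρ / 2 := by
      have hz' : ‖z - z₀‖ ≤ ρ / 2 / (L' + 1) := by
        rw [← dist_eq_norm]; exact (mem_ball.1 hz).le.trans (min_le_right _ _)
      calc (L' : ℝ) * ‖z - z₀‖ ≤ (L' + 1) * (ρ / 2 / (L' + 1)) := by gcongr; linarith
        _ = ρ / 2 := by field_simp
    rw [mem_ball]
    calc dist (α (ι z) t).1 z₀ ≤ dist (α (ι z) t).1 (α (ι z₀) t).1 + dist (α (ι z₀) t).1 z₀ :=
          dist_triangle _ _ _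
      _ < ρ := by rw [dist_eq_norm (α (ι z) t).1]; linarith
  have hder : ∀ z ∈ ball z₀ R, ∀ t ∈ Icc 0 η,
      HasDerivWithinAt (fun t => (α (ι z) t).1) (S (α (ι z) t).1) (Icc 0 η) t ∧
      HasDerivWithinAt (fun t => (α (ι z) t).2) ((fderiv ℝ S (α (ι z) t).1).comp (α (ι z) t).2)
        (Icc 0 η) t := by
    intro z hz t ht
    have := ((hα _ (hι z (hRr hz))).2 t (hsub ht)).mono hsub
    exact ⟨(hasFDerivAt_fst (𝕜 := ℝ) (p := α (ι z) t)).comp_hasDerivWithinAt t this,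
      (hasFDerivAt_snd (𝕜 := ℝ) (p := α (ι z) t)).comp_hasDerivWithinAt t this⟩
  refine ⟨R, hR0, η, hη0, fun z t => (α (ι z) t).1, fun z t => (α (ι z) t).2, fun z hz => ?_⟩
  have hinit := (hα _ (hι z (hRr hz))).1
  simp only at hinit
  refine ⟨by simp [hinit, ι], by simp [hinit, ι], fun t ht => ⟨(hball (hmem t ht z hz)).1.1,
    (hder z hz t ht).1, (hder z hz t ht).2, ?_⟩⟩
  -- the remainder of the first order expansion is quadratic, by Grönwall's inequality
  set C : ℝ := K₂ * L' ^ 2 with hC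
  set M : ℝ := C / K₁ * (Real.exp (K₁ * t) - 1) with hM
  have hrem : ∀ w ∈ ball z₀ R,
      ‖(α (ι w) t).1 - (α (ι z) t).1 - (α (ι z) t).2 (w - z)‖ ≤ M * ‖w - z‖ ^ 2 := by
    intro w hw
    have hinit' := (hα _ (hι w (hRr hw))).1
    simp only at hinit'
    have hder' : ∀ s ∈ Icc 0 η, HasDerivWithinAt
        (fun s => (α (ι w) s).1 - (α (ι z) s).1 - (α (ι z) s).2 (w - z))
        (S (α (ι w) s).1 - S (α (ι z) s).1
          - fderiv ℝ S (α (ι z) s).1 ((α (ι z) s).2 (w - z))) (Icc 0 η) s := by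
      intro s hs
      refine ((hder w hw s hs).1.sub (hder z hz s hs).1).sub ?_
      have := (hder z hz s hs).2.clm_apply (hasDerivWithinAt_const s (Icc 0 η) (w - z))
      simpa using this
    have hG := norm_le_gronwallBound_of_norm_deriv_right_le (a := 0) (b := η)
      (δ := 0) (K := K₁) (ε := C * ‖w - z‖ ^ 2)
      (fun s hs => (hder' s hs).continuousWithinAt)
      (fun s hs => hasDerivWithinAt_Ici_of_Icc hs (hder' s (Ico_subset_Icc_self hs)))
      (by simp [hinit, hinit', ι]) ?_ t ht
    · rw [gronwallBound_of_K_ne_0 hK₁0.ne'] at hG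
      calc _ ≤ _ := hG
        _ = M * ‖w - z‖ ^ 2 := by simp only [hM, sub_zero]; ring
    · intro s hs
      have hs' := Ico_subset_Icc_self hs
      have hbz := hball (hmem s hs' z hz)
      have h1 := norm_sub_sub_fderiv_le (convex_ball z₀ ρ) (S := S) (K := K₂)
        (fun x hx => (hball hx).2.1) (hL₂.mono fun x hx => (hball hx).1.2)
        (hmem s hs' z hz) (hmem s hs' w hw)
      have h2 := hLip s hs' w hw z hz
      set A := (α (ι w) s).1
      set A' := (α (ι z) s).1
      set y := (α (ι z) s).2 (w - z)
      have h3 : S A - S A' - fderiv ℝ S A' y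
          = (S A - S A' - fderiv ℝ S A' (A - A')) + fderiv ℝ S A' (A - A' - y) := by
        rw [map_sub (fderiv ℝ S A') (A - A') y]; abel
      have h4 : ‖A - A'‖ ^ 2 ≤ (L' * ‖w - z‖) ^ 2 := by gcongr
      have h5 : ‖fderiv ℝ S A' (A - A' - y)‖ ≤ K₁ * ‖A - A' - y‖ :=
        ((fderiv ℝ S A').le_opNorm _).trans (by gcongr; exact hbz.2.2.le)
      rw [h3]
      calc _ ≤ ‖S A - S A' - fderiv ℝ S A' (A - A')‖ + ‖fderiv ℝ S A' (A - A' - y)‖ :=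
            norm_add_le _ _
        _ ≤ K₂ * ‖A - A'‖ ^ 2 + K₁ * ‖A - A' - y‖ := add_le_add h1 h5
        _ ≤ K₂ * (L' * ‖w - z‖) ^ 2 + K₁ * ‖A - A' - y‖ := by gcongr
        _ = _ := by rw [hC]; ring
  rw [hasFDerivAt_iff_isLittleO]
  refine Asymptotics.IsBigO.trans_isLittleO (g := fun w => ‖w - z‖ ^ 2) ?_ ?_
  · refine Asymptotics.IsBigO.of_bound M ?_
    filter_upwards [isOpen_ball.mem_nhds hz] with w hw
    simpa using hrem w hw
  · have : (fun w => ‖w - z‖ ^ 2) =o[𝓝 z] fun w => ‖w - z‖ := by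
      have h0 : Tendsto (fun w => ‖w - z‖) (𝓝 z) (𝓝 0) := by
        have : ContinuousAt (fun w => ‖w - z‖) z := by fun_prop
        simpa [ContinuousAt] using this
      have := (Asymptotics.isLittleO_pow_id (𝕜 := ℝ) (n := 2) (by norm_num)).comp_tendsto h0
      simpa [Function.comp_def] using this
    exact this.of_norm_right

end ODE

/-! ### Norms on spaces of multilinear maps -/

section Instances

-- These shortcuts spare instance search the iterated spaces of continuous linear maps.

variable {E : Type*} [NormedAddCommGroup E] [NormedSpace ℝ E]

instance : NormedAddCommGroup (E →L[ℝ] ℝ) := ContinuousLinearMap.toNormedAddCommGroup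
instance : NormedSpace ℝ (E →L[ℝ] ℝ) := ContinuousLinearMap.toNormedSpace
instance : NormedAddCommGroup (E →L[ℝ] E →L[ℝ] ℝ) := ContinuousLinearMap.toNormedAddCommGroup
instance : NormedSpace ℝ (E →L[ℝ] E →L[ℝ] ℝ) := ContinuousLinearMap.toNormedSpace
instance : NormedAddCommGroup (E →L[ℝ] E →L[ℝ] E →L[ℝ] ℝ) :=
  ContinuousLinearMap.toNormedAddCommGroup
instance : NormedSpace ℝ (E →L[ℝ] E →L[ℝ] E →L[ℝ] ℝ) := ContinuousLinearMap.toNormedSpace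
instance : NormedAddCommGroup (E →L[ℝ] E) := ContinuousLinearMap.toNormedAddCommGroup
instance : NormedSpace ℝ (E →L[ℝ] E) := ContinuousLinearMap.toNormedSpace
instance : NormedAddCommGroup (E →L[ℝ] E →L[ℝ] E) := ContinuousLinearMap.toNormedAddCommGroup
instance : NormedSpace ℝ (E →L[ℝ] E →L[ℝ] E) := ContinuousLinearMap.toNormedSpace

end Instances

/-! ### Riemannian geometry in coordinates -/

section CoordinateGeometry

variable {E : Type*} [NormedAddCommGroup E] [NormedSpace ℝ E]

/-- `G` is a smooth field of symmetric nondegenerate bilinear forms on the open set `U`. -/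
structure IsCoordMetric (G : E → E →L[ℝ] E →L[ℝ] ℝ) (U : Set E) : Prop where
  isOpen : IsOpen U
  contDiffOn : ContDiffOn ℝ ∞ G U
  symm : ∀ u ∈ U, ∀ X Y, G u X Y = G u Y X
  inv : ∀ u ∈ U, (G u).IsInvertible

/-- The Christoffel symbols as a continuous bilinear map. -/
def christoffelL (G : E → E →L[ℝ] E →L[ℝ] ℝ) (u : E) : E →L[ℝ] E →L[ℝ] E :=
  (ContinuousLinearMap.compL ℝ E (E →L[ℝ] ℝ) E (G u).inverse).comp
    ((1 / 2 : ℝ) • (fderiv ℝ G u + (fderiv ℝ G u).flip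
      - ((ContinuousLinearMap.flipₗᵢ ℝ E E ℝ).toContinuousLinearEquiv :
          (E →L[ℝ] E →L[ℝ] ℝ) →L[ℝ] (E →L[ℝ] E →L[ℝ] ℝ)).comp (fderiv ℝ G u).flip))

theorem christoffelL_apply (G : E → E →L[ℝ] E →L[ℝ] ℝ) (u X Y : E) :
    christoffelL G u X Y = christoffel G u X Y := by
  rfl

/-- The geodesic spray: the vector field `(u, v) ↦ (v, -Γ_u(v, v))`. -/
def spray (G : E → E →L[ℝ] E →L[ℝ] ℝ) (z : E × E) : E × E :=
  (z.2, -christoffelL G z.1 z.2 z.2)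

/-- The covariant derivative `y + Γ_u(v, x)` of a vector field `x` with derivative `y` along a curve
through `u` with velocity `v`. -/
def covPart (G : E → E →L[ℝ] E →L[ℝ] ℝ) (z ζ : E × E) : E :=
  ζ.2 + christoffelL G z.1 z.2 ζ.1

namespace IsCoordMetric

variable {G : E → E →L[ℝ] E →L[ℝ] ℝ} {U : Set E} (hG : IsCoordMetric G U) {u : E}
include hG

theorem contDiffAt (hu : u ∈ U) : ContDiffAt ℝ ∞ G u :=
  hG.contDiffOn.contDiffAt (hG.isOpen.mem_nhds hu)

theorem differentiableAt (hu : u ∈ U) : DifferentiableAt ℝ G u :=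
  (hG.contDiffAt hu).differentiableAt (by simp)

theorem contDiffAt_fderiv (hu : u ∈ U) : ContDiffAt ℝ ∞ (fderiv ℝ G) u :=
  (hG.contDiffAt hu).fderiv_right (m := ∞) (by simp)

/-- The Koszul formula. -/
theorem apply_christoffelL (hu : u ∈ U) (X Y Z : E) :
    G u (christoffelL G u X Y) Z
      = (fderiv ℝ G u X Y Z + fderiv ℝ G u Y X Z - fderiv ℝ G u Z X Y) / 2 := by
  rw [christoffelL_apply, christoffel]
  obtain ⟨e, he⟩ := hG.inv u hu
  rw [← he, ContinuousLinearMap.inverse_equiv]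
  simp only [ContinuousLinearEquiv.coe_coe, ContinuousLinearEquiv.apply_symm_apply]
  simp
  ring

theorem eq_of_apply_eq (hu : u ∈ U) {X Y : E} (h : ∀ Z, G u X Z = G u Y Z) : X = Y := by
  obtain ⟨e, he⟩ := hG.inv u hu
  apply e.injective
  have : ∀ X, e X = G u X := fun X => by rw [← he]; rfl
  rw [this, this]
  exact ContinuousLinearMap.ext h

theorem fderiv_symm (hu : u ∈ U) (X Y Z : E) : fderiv ℝ G u X Y Z = fderiv ℝ G u X Z Y := by
  have h1 : ∀ Y Z, HasFDerivAt (fun w => G w Y Z)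
      ((ContinuousLinearMap.apply ℝ ℝ Z).comp
        ((ContinuousLinearMap.apply ℝ (E →L[ℝ] ℝ) Y).comp (fderiv ℝ G u))) u := fun Y Z =>
    (ContinuousLinearMap.apply ℝ ℝ Z).hasFDerivAt.comp u
      ((ContinuousLinearMap.apply ℝ (E →L[ℝ] ℝ) Y).hasFDerivAt.comp u
        (hG.differentiableAt hu).hasFDerivAt)
  have h2 : (fun w => G w Y Z) =ᶠ[𝓝 u] fun w => G w Z Y :=
    eventually_of_mem (hG.isOpen.mem_nhds hu) fun w hw => hG.symm w hw Y Z
  have := (h1 Y Z).unique ((h1 Z Y).congr_of_eventuallyEq h2)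
  exact congrArg (fun A : E →L[ℝ] ℝ => A X) this

theorem christoffelL_symm (hu : u ∈ U) (X Y : E) : christoffelL G u X Y = christoffelL G u Y X := by
  refine hG.eq_of_apply_eq hu fun Z => ?_
  rw [hG.apply_christoffelL hu, hG.apply_christoffelL hu, hG.fderiv_symm hu Z X Y]
  ring

variable [CompleteSpace E]

theorem contDiffAt_christoffelL (hu : u ∈ U) : ContDiffAt ℝ ∞ (christoffelL G) u := by
  have hinv : ContDiffAt ℝ ∞ (fun w => (G w).inverse) u := by
    obtain ⟨e, he⟩ := hG.inv u hu
    have := contDiffAt_map_inverse (n := ∞) (𝕜 := ℝ) e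
    rw [he] at this
    exact this.comp u (hG.contDiffAt hu)
  have hd := hG.contDiffAt_fderiv hu
  have hflip : ContDiffAt ℝ ∞ (fun w => (fderiv ℝ G w).flip) u :=
    ((ContinuousLinearMap.flipₗᵢ ℝ E E (E →L[ℝ] ℝ)).contDiff.contDiffAt).comp u hd
  unfold christoffelL
  refine ContDiffAt.clm_comp ?_ ?_
  · exact (ContinuousLinearMap.contDiff _).contDiffAt.comp u hinv
  · exact ((hd.add hflip).sub (contDiffAt_const.clm_comp hflip)).const_smul (1 / 2 : ℝ)

theorem contDiffAt_spray {z : E × E} (hz : z.1 ∈ U) : ContDiffAt ℝ ∞ (spray G) z := by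
  have h1 : ContDiffAt ℝ ∞ (fun z : E × E => christoffelL G z.1) z :=
    (hG.contDiffAt_christoffelL hz).comp z contDiffAt_fst
  exact contDiffAt_snd.prodMk ((h1.clm_apply contDiffAt_snd).clm_apply contDiffAt_snd).neg

/-- The linearized geodesic equation. -/
theorem fderiv_spray {z : E × E} (hz : z.1 ∈ U) (ζ : E × E) :
    fderiv ℝ (spray G) z ζ = (ζ.2, -(fderiv ℝ (christoffelL G) z.1 ζ.1 z.2 z.2)
      - (2 : ℝ) • christoffelL G z.1 z.2 ζ.2) := by
  have h1 : HasFDerivAt (fun z : E × E => christoffelL G z.1)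
      ((fderiv ℝ (christoffelL G) z.1).comp (ContinuousLinearMap.fst ℝ E E)) z :=
    ((hG.contDiffAt_christoffelL hz).differentiableAt (by simp)).hasFDerivAt.comp z hasFDerivAt_fst
  have h2 := (hasFDerivAt_snd (𝕜 := ℝ) (p := z)).prodMk
    ((h1.clm_apply hasFDerivAt_snd).clm_apply hasFDerivAt_snd).neg
  have h3 : HasFDerivAt (spray G) _ z := h2
  rw [h3.fderiv]
  ext
  · simp
  · simp [two_smul, hG.christoffelL_symm hz ζ.2 z.2]
    abel

/-- The linearized spray in the direction of the spray itself and of the fibre. -/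
theorem fderiv_spray_fibre {z : E × E} (hz : z.1 ∈ U) :
    fderiv ℝ (spray G) z (0, z.2) = (z.2, (2 : ℝ) • (spray G z).2) := by
  rw [hG.fderiv_spray hz]
  simp [spray]

/-- The Jacobi operator in covariant and in coordinate form. -/
theorem covPart_deriv_add_curvature {z : E × E} (hz : z.1 ∈ U) (x y y' : E) :
    (y' + fderiv ℝ (christoffelL G) z.1 z.2 z.2 x + christoffelL G z.1 (spray G z).2 x
        + christoffelL G z.1 z.2 y) + christoffelL G z.1 z.2 (covPart G z (x, y))
      + curvatureCoord G z.1 x z.2 z.2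
      = y' - (fderiv ℝ (spray G) z (x, y)).2 := by
  have hd : ∀ Y Z, fderiv ℝ (fun w => christoffel G w Y Z) z.1
      = (ContinuousLinearMap.apply ℝ E Z).comp ((ContinuousLinearMap.apply ℝ (E →L[ℝ] E) Y).comp
        (fderiv ℝ (christoffelL G) z.1)) := by
    intro Y Z
    have : HasFDerivAt (fun w => christoffelL G w Y Z) _ z.1 :=
      (ContinuousLinearMap.hasFDerivAt (ContinuousLinearMap.apply ℝ E Z)).comp z.1
        ((ContinuousLinearMap.hasFDerivAt (ContinuousLinearMap.apply ℝ (E →L[ℝ] E) Y)).comp z.1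
          ((hG.contDiffAt_christoffelL hz).differentiableAt (by simp)).hasFDerivAt)
    simp only [← christoffelL_apply]
    exact this.fderiv
  have hΓ : ∀ X, fderiv ℝ (christoffelL G) z.1 X z.2 x = fderiv ℝ (christoffelL G) z.1 X x z.2 := by
    intro X
    have h1 : ∀ Y Z, HasFDerivAt (fun w => christoffelL G w Y Z) _ z.1 := fun Y Z =>
      (ContinuousLinearMap.hasFDerivAt (ContinuousLinearMap.apply ℝ E Z)).comp z.1
        ((ContinuousLinearMap.hasFDerivAt (ContinuousLinearMap.apply ℝ (E →L[ℝ] E) Y)).comp z.1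
          ((hG.contDiffAt_christoffelL hz).differentiableAt (by simp)).hasFDerivAt)
    have h2 : (fun w => christoffelL G w z.2 x) =ᶠ[𝓝 z.1] fun w => christoffelL G w x z.2 :=
      eventually_of_mem (hG.isOpen.mem_nhds hz) fun w hw => hG.christoffelL_symm hw _ _
    have := (h1 z.2 x).unique ((h1 x z.2).congr_of_eventuallyEq h2)
    exact congrArg (fun A : E →L[ℝ] E => A X) this
  rw [hG.fderiv_spray hz, curvatureCoord, hd, hd]
  simp only [spray, covPart, ← christoffelL_apply, ContinuousLinearMap.comp_apply,
    ContinuousLinearMap.apply_apply, map_neg, neg_apply, map_add, hΓ,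
    hG.christoffelL_symm hz x]
  rw [two_smul]
  abel

/-- Along a geodesic the symplectic product of two solutions of the linearized geodesic equation is
constant. The derivative is computed from `G_u(Γ_u(v, v), ·) = D_v G_u(v, ·) - D G_u(v, v) / 2`, the
Euler-Lagrange form of the geodesic equation, linearized in the direction of a solution; what
remains is symmetric in the two solutions. -/
theorem hasDerivWithinAt_symplectic {s : Set ℝ} {t : ℝ} {z ζ₁ ζ₂ : ℝ → E × E} (hz : (z t).1 ∈ U)
    (h : HasDerivWithinAt z (spray G (z t)) s t)
    (h₁ : HasDerivWithinAt ζ₁ (fderiv ℝ (spray G) (z t) (ζ₁ t)) s t)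
    (h₂ : HasDerivWithinAt ζ₂ (fderiv ℝ (spray G) (z t) (ζ₂ t)) s t) :
    HasDerivWithinAt (fun τ => G (z τ).1 (ζ₁ τ).1 (covPart G (z τ) (ζ₂ τ))
      - G (z τ).1 (covPart G (z τ) (ζ₁ τ)) (ζ₂ τ).1) 0 s t := by
  have hform : ∀ z ζ₁ ζ₂ : E × E, z.1 ∈ U →
      G z.1 ζ₁.1 (covPart G z ζ₂) - G z.1 (covPart G z ζ₁) ζ₂.1
      = (G z.1 ζ₂.2 ζ₁.1 + fderiv ℝ G z.1 ζ₂.1 z.2 ζ₁.1)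
        - (G z.1 ζ₁.2 ζ₂.1 + fderiv ℝ G z.1 ζ₁.1 z.2 ζ₂.1) := by
    intro z ζ₁ ζ₂ hz
    rw [hG.symm _ hz ζ₁.1, covPart, covPart]
    simp only [map_add, add_apply, hG.apply_christoffelL hz,
      hG.fderiv_symm hz z.2 ζ₁.1 ζ₂.1]
    ring
  set u := (z t).1 with hu
  set v := (z t).2 with hv
  -- the components of the curves and their derivatives
  have hfst : ∀ {ζ : ℝ → E × E} {ζ' : E × E}, HasDerivWithinAt ζ ζ' s t →
      HasDerivWithinAt (fun τ => (ζ τ).1) ζ'.1 s t := fun {ζ _} h =>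
    (hasFDerivAt_fst (𝕜 := ℝ) (p := ζ t)).comp_hasDerivWithinAt t h
  have hsnd : ∀ {ζ : ℝ → E × E} {ζ' : E × E}, HasDerivWithinAt ζ ζ' s t →
      HasDerivWithinAt (fun τ => (ζ τ).2) ζ'.2 s t := fun {ζ _} h =>
    (hasFDerivAt_snd (𝕜 := ℝ) (p := ζ t)).comp_hasDerivWithinAt t h
  have hG1 : HasDerivWithinAt (fun τ => G (z τ).1) (fderiv ℝ G u v) s t :=
    (hG.differentiableAt hz).hasFDerivAt.comp_hasDerivWithinAt t (hfst h)
  have hDG : HasFDerivAt (fderiv ℝ G) (fderiv ℝ (fderiv ℝ G) u) u :=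
    ((hG.contDiffAt_fderiv hz).differentiableAt (by simp)).hasFDerivAt
  have hG2 : HasDerivWithinAt (fun τ => fderiv ℝ G (z τ).1) (fderiv ℝ (fderiv ℝ G) u v) s t :=
    hDG.comp_hasDerivWithinAt t (hfst h)
  -- the momentum form and its derivative
  have hmom : ∀ {ζ₁ ζ₂ : ℝ → E × E},
      HasDerivWithinAt ζ₁ (fderiv ℝ (spray G) (z t) (ζ₁ t)) s t →
      HasDerivWithinAt ζ₂ (fderiv ℝ (spray G) (z t) (ζ₂ t)) s t →
      HasDerivWithinAt
        (fun τ => G (z τ).1 (ζ₂ τ).2 (ζ₁ τ).1 + fderiv ℝ G (z τ).1 (ζ₂ τ).1 (z τ).2 (ζ₁ τ).1)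
        ((fderiv ℝ G u v (ζ₂ t).2 (ζ₁ t).1 + G u (fderiv ℝ (spray G) (z t) (ζ₂ t)).2 (ζ₁ t).1
          + G u (ζ₂ t).2 (ζ₁ t).2)
        + (fderiv ℝ (fderiv ℝ G) u v (ζ₂ t).1 v (ζ₁ t).1 + fderiv ℝ G u (ζ₂ t).2 v (ζ₁ t).1
          + fderiv ℝ G u (ζ₂ t).1 (spray G (z t)).2 (ζ₁ t).1
          + fderiv ℝ G u (ζ₂ t).1 v (ζ₁ t).2)) s t := by
    intro ζ₁ ζ₂ h₁ h₂
    have a := (hG1.clm_apply (hsnd h₂)).clm_apply (hfst h₁)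
    have b := ((hG2.clm_apply (hfst h₂)).clm_apply (hsnd h)).clm_apply (hfst h₁)
    refine (a.add b).congr_deriv ?_
    simp only [hG.fderiv_spray hz, add_apply]
    simp only [hu, hv]
  -- the geodesic equation in Euler-Lagrange form, linearized
  have hEL : ∀ x Z, G u (fderiv ℝ (christoffelL G) u x v v) Z
      = fderiv ℝ (fderiv ℝ G) u x v v Z - fderiv ℝ (fderiv ℝ G) u x Z v v / 2
        - fderiv ℝ G u x (christoffelL G u v v) Z := by
    intro x Z
    have hΓ := ((hG.contDiffAt_christoffelL hz).differentiableAt (by simp)).hasFDerivAt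
    have hc : ∀ X : E, HasFDerivAt (fun _ : E => X) (0 : E →L[ℝ] E) u := fun X =>
      hasFDerivAt_const X u
    have l := ((hG.differentiableAt hz).hasFDerivAt.clm_apply
      ((hΓ.clm_apply (hc v)).clm_apply (hc v))).clm_apply (hc Z)
    have r := (((hDG.clm_apply (hc v)).clm_apply (hc v)).clm_apply (hc Z)).sub
      ((((hDG.clm_apply (hc Z)).clm_apply (hc v)).clm_apply (hc v)).mul_const (1 / 2 : ℝ))
    have e : (fun w => G w (christoffelL G w v v) Z) =ᶠ[𝓝 u]
        fun w => fderiv ℝ G w v v Z - fderiv ℝ G w Z v v * (1 / 2) :=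
      eventually_of_mem (hG.isOpen.mem_nhds hz) fun w hw => by
        simp only [hG.apply_christoffelL hw]; ring
    have := congrArg (fun A : E →L[ℝ] ℝ => A x) (l.unique (r.congr_of_eventuallyEq e))
    simp at this
    linarith
  have hsymm2 : ∀ X Y, fderiv ℝ (fderiv ℝ G) u X Y = fderiv ℝ (fderiv ℝ G) u Y X := fun X Y =>
    ((hG.contDiffAt hz).isSymmSndFDerivAt (by simpa using ENat.LEInfty.out)).eq X Y
  have hmain := (hmom h₁ h₂).sub (hmom h₂ h₁)
  have hev : ∀ᶠ τ in 𝓝[s] t, (z τ).1 ∈ U :=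
    (hfst h).continuousWithinAt.eventually (hG.isOpen.mem_nhds hz)
  refine (hmain.congr_deriv ?_).congr_of_eventuallyEq
    (hev.mono fun τ hτ => hform _ _ _ hτ) (hform _ _ _ hz)
  simp only [hG.fderiv_spray hz, spray, map_sub, map_neg, map_smul, sub_apply,
    neg_apply, smul_apply, smul_eq_mul, ← hu, ← hv, hEL,
    hG.apply_christoffelL hz, hsymm2 v (ζ₁ t).1, hsymm2 v (ζ₂ t).1, hsymm2 (ζ₂ t).1 (ζ₁ t).1]
  rw [hG.symm u hz (ζ₂ t).2 (ζ₁ t).2, hG.fderiv_symm hz (ζ₁ t).1 v (ζ₂ t).2,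
    hG.fderiv_symm hz (ζ₂ t).1 v (ζ₁ t).2]
  ring

end IsCoordMetric

end CoordinateGeometry

/-! ### Changes of coordinates -/

section CoordinateChange

variable {E : Type*} [NormedAddCommGroup E] [NormedSpace ℝ E]

/-- The tangent map `(u, v) ↦ (ψ u, Dψ_u v)`. -/
def tangentChange (ψ : E → E) (z : E × E) : E × E := (ψ z.1, fderiv ℝ ψ z.1 z.2)

/-- `ψ` is a local isometry on the open set `W`, for the metrics `G` on `U` and `G'` on `U'`. -/
structure IsCoordChange (G G' : E → E →L[ℝ] E →L[ℝ] ℝ) (ψ : E → E) (U U' W : Set E) : Prop where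
  metric : IsCoordMetric G U
  metric' : IsCoordMetric G' U'
  isOpen : IsOpen W
  subset : W ⊆ U
  mapsTo : MapsTo ψ W U'
  contDiffOn : ContDiffOn ℝ ∞ ψ W
  isometry : ∀ u ∈ W, ∀ X Y, G u X Y = G' (ψ u) (fderiv ℝ ψ u X) (fderiv ℝ ψ u Y)
  surj : ∀ u ∈ W, Function.Surjective (fderiv ℝ ψ u)

namespace IsCoordChange

variable {G G' : E → E →L[ℝ] E →L[ℝ] ℝ} {ψ : E → E} {U U' W : Set E}
  (h : IsCoordChange G G' ψ U U' W) {u : E}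
include h

theorem contDiffAt (hu : u ∈ W) : ContDiffAt ℝ ∞ ψ u :=
  h.contDiffOn.contDiffAt (h.isOpen.mem_nhds hu)

theorem contDiffAt_fderiv (hu : u ∈ W) : ContDiffAt ℝ ∞ (fderiv ℝ ψ) u :=
  (h.contDiffAt hu).fderiv_right (m := ∞) (by simp)

theorem hasFDerivAt (hu : u ∈ W) : HasFDerivAt ψ (fderiv ℝ ψ u) u :=
  ((h.contDiffAt hu).differentiableAt (by simp)).hasFDerivAt

theorem hasFDerivAt_fderiv (hu : u ∈ W) :
    HasFDerivAt (fderiv ℝ ψ) (fderiv ℝ (fderiv ℝ ψ) u) u :=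
  ((h.contDiffAt_fderiv hu).differentiableAt (by simp)).hasFDerivAt

theorem second_symm (hu : u ∈ W) (X Y : E) :
    fderiv ℝ (fderiv ℝ ψ) u X Y = fderiv ℝ (fderiv ℝ ψ) u Y X :=
  ((h.contDiffAt hu).isSymmSndFDerivAt (by simpa using ENat.LEInfty.out)).eq X Y

theorem fderiv_metric (hu : u ∈ W) (X Y Z : E) :
    fderiv ℝ G u X Y Z
      = fderiv ℝ G' (ψ u) (fderiv ℝ ψ u X) (fderiv ℝ ψ u Y) (fderiv ℝ ψ u Z)
        + G' (ψ u) (fderiv ℝ (fderiv ℝ ψ) u X Y) (fderiv ℝ ψ u Z)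
        + G' (ψ u) (fderiv ℝ ψ u Y) (fderiv ℝ (fderiv ℝ ψ) u X Z) := by
  have hc : ∀ X : E, HasFDerivAt (fun _ : E => X) (0 : E →L[ℝ] E) u := fun X =>
    hasFDerivAt_const X u
  have l := ((h.metric.differentiableAt (h.subset hu)).hasFDerivAt.clm_apply (hc Y)).clm_apply
    (hc Z)
  have hG' := (h.metric'.differentiableAt (h.mapsTo hu)).hasFDerivAt.comp u (h.hasFDerivAt hu)
  have r := (hG'.clm_apply ((h.hasFDerivAt_fderiv hu).clm_apply (hc Y))).clm_apply
    ((h.hasFDerivAt_fderiv hu).clm_apply (hc Z))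
  have e : (fun w => G w Y Z) =ᶠ[𝓝 u]
      fun w => (G' ∘ ψ) w (fderiv ℝ ψ w Y) (fderiv ℝ ψ w Z) :=
    eventually_of_mem (h.isOpen.mem_nhds hu) fun w hw => h.isometry w hw Y Z
  have := congrArg (fun A : E →L[ℝ] ℝ => A X) (l.unique (r.congr_of_eventuallyEq e))
  simp at this
  rw [this]
  ring

/-- The transformation law of the Christoffel symbols. -/
theorem fderiv_christoffelL (hu : u ∈ W) (X Y : E) :
    fderiv ℝ ψ u (christoffelL G u X Y)
      = fderiv ℝ (fderiv ℝ ψ) u X Y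
        + christoffelL G' (ψ u) (fderiv ℝ ψ u X) (fderiv ℝ ψ u Y) := by
  refine h.metric'.eq_of_apply_eq (h.mapsTo hu) fun Z' => ?_
  obtain ⟨Z, rfl⟩ := h.surj u hu Z'
  rw [← h.isometry u hu, h.metric.apply_christoffelL (h.subset hu), map_add, add_apply,
    h.metric'.apply_christoffelL (h.mapsTo hu), h.fderiv_metric hu, h.fderiv_metric hu,
    h.fderiv_metric hu, h.second_symm hu Y X, h.second_symm hu Z X, h.second_symm hu Z Y,
    h.metric'.symm _ (h.mapsTo hu) (fderiv ℝ ψ u Y) (fderiv ℝ (fderiv ℝ ψ) u X Z)]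
  ring

variable {z : E × E}

theorem contDiffAt_tangentChange (hz : z.1 ∈ W) : ContDiffAt ℝ ∞ (tangentChange ψ) z :=
  ((h.contDiffAt hz).comp z contDiffAt_fst).prodMk
    (((h.contDiffAt_fderiv hz).comp z contDiffAt_fst).clm_apply contDiffAt_snd)

theorem hasFDerivAt_tangentChange (hz : z.1 ∈ W) :
    HasFDerivAt (tangentChange ψ) (fderiv ℝ (tangentChange ψ) z) z :=
  ((h.contDiffAt_tangentChange hz).differentiableAt (by simp)).hasFDerivAt

theorem fderiv_tangentChange (hz : z.1 ∈ W) (ζ : E × E) :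
    fderiv ℝ (tangentChange ψ) z ζ = (fderiv ℝ ψ z.1 ζ.1,
      fderiv ℝ (fderiv ℝ ψ) z.1 ζ.1 z.2 + fderiv ℝ ψ z.1 ζ.2) := by
  have h1 := (h.hasFDerivAt hz).comp z hasFDerivAt_fst
  have h2 := ((h.hasFDerivAt_fderiv hz).comp z hasFDerivAt_fst).clm_apply hasFDerivAt_snd
  have h3 : HasFDerivAt (tangentChange ψ) _ z := h1.prodMk h2
  rw [h3.fderiv]
  ext
  · simp
  · simp [add_comm]

/-- The geodesic sprays of isometric metrics correspond to each other. -/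
theorem fderiv_tangentChange_spray (hz : z.1 ∈ W) :
    fderiv ℝ (tangentChange ψ) z (spray G z) = spray G' (tangentChange ψ z) := by
  rw [h.fderiv_tangentChange hz]
  ext
  · rfl
  · simp [spray, tangentChange, h.fderiv_christoffelL hz]

theorem covPart_tangentChange (hz : z.1 ∈ W) (ζ : E × E) :
    covPart G' (tangentChange ψ z) (fderiv ℝ (tangentChange ψ) z ζ)
      = fderiv ℝ ψ z.1 (covPart G z ζ) := by
  rw [h.fderiv_tangentChange hz, covPart, covPart, map_add, h.fderiv_christoffelL hz,
    h.second_symm hz z.2 ζ.1]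
  simp only [tangentChange]
  abel

theorem hasDerivWithinAt_tangentChange {s : Set ℝ} {t : ℝ} {Z : ℝ → E × E} (hz : (Z t).1 ∈ W)
    (hZ : HasDerivWithinAt Z (spray G (Z t)) s t) :
    HasDerivWithinAt (fun τ => tangentChange ψ (Z τ)) (spray G' (tangentChange ψ (Z t))) s t := by
  rw [← h.fderiv_tangentChange_spray hz]
  exact (h.hasFDerivAt_tangentChange hz).comp_hasDerivWithinAt t hZ

variable [CompleteSpace E]

/-- The linearized sprays of isometric metrics correspond to each other: this is the derivative of
the same statement about the sprays. -/
theorem hasDerivWithinAt_fderiv_tangentChange {s : Set ℝ} {t : ℝ} {Z ζ : ℝ → E × E}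
    (hz : (Z t).1 ∈ W) (hZ : HasDerivWithinAt Z (spray G (Z t)) s t)
    (hζ : HasDerivWithinAt ζ (fderiv ℝ (spray G) (Z t) (ζ t)) s t) :
    HasDerivWithinAt (fun τ => fderiv ℝ (tangentChange ψ) (Z τ) (ζ τ))
      (fderiv ℝ (spray G') (tangentChange ψ (Z t))
        (fderiv ℝ (tangentChange ψ) (Z t) (ζ t))) s t := by
  have hT := h.contDiffAt_tangentChange hz
  have hdT : HasFDerivAt (fderiv ℝ (tangentChange ψ))
      (fderiv ℝ (fderiv ℝ (tangentChange ψ)) (Z t)) (Z t) :=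
    ((hT.fderiv_right (m := ∞) (by simp)).differentiableAt (by simp)).hasFDerivAt
  have hS := ((h.metric.contDiffAt_spray (h.subset hz)).differentiableAt (by simp)).hasFDerivAt
  have hS' : HasFDerivAt (spray G') _ (tangentChange ψ (Z t)) :=
    ((h.metric'.contDiffAt_spray (h.mapsTo hz)).differentiableAt (by simp)).hasFDerivAt
  have e : (fun z => fderiv ℝ (tangentChange ψ) z (spray G z)) =ᶠ[𝓝 (Z t)]
      fun z => spray G' (tangentChange ψ z) :=
    eventually_of_mem ((h.isOpen.preimage continuous_fst).mem_nhds hz)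
      fun w hw => h.fderiv_tangentChange_spray hw
  have l := hdT.clm_apply hS
  have r := hS'.comp (Z t) (h.hasFDerivAt_tangentChange hz)
  have key := congrArg (fun A : E × E →L[ℝ] E × E => A (ζ t))
    (l.unique (r.congr_of_eventuallyEq e))
  simp at key
  rw [← key]
  have hsymm := (hT.isSymmSndFDerivAt (by simpa using ENat.LEInfty.out)).eq (spray G (Z t)) (ζ t)
  refine ((hdT.comp_hasDerivWithinAt t hZ).clm_apply hζ).congr_deriv ?_
  rw [hsymm]
  exact add_comm _ _

end IsCoordChange

end CoordinateChange

variable {N : Type*} [TopologicalSpace N] [ChartedSpace E2 N] [IsManifold (𝓡 2) ∞ N]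

/-! ### Charts of the surface and of its tangent bundle -/

section Charts

/-- The derivative at `x` of the chart around `p`, as a map of the model space; the tangent space at
`x` is the model space. -/
def dchart (p x : N) : E2 →L[ℝ] E2 := mfderiv (𝓡 2) 𝓘(ℝ, E2) (extChartAt (𝓡 2) p) x

/-- The metric at `x` as a bilinear form on the model space. -/
def gform (g : Metric N) (x : N) : E2 →L[ℝ] E2 →L[ℝ] ℝ := g.inner x

/-- The change of coordinates from the chart around `p` to the chart around `q`. -/
def chartChange (p q : N) (u : E2) : E2 := extChartAt (𝓡 2) q ((extChartAt (𝓡 2) p).symm u)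

/-- The domain of the change of coordinates from the chart around `p` to the chart around `q`. -/
def chartOverlap (p q : N) : Set E2 :=
  (extChartAt (𝓡 2) p).target ∩ (extChartAt (𝓡 2) p).symm ⁻¹' (extChartAt (𝓡 2) q).source

theorem isOpen_chartOverlap (p q : N) : IsOpen (chartOverlap p q) :=
  (continuousOn_extChartAt_symm p).isOpen_inter_preimage (isOpen_extChartAt_target p)
    (isOpen_extChartAt_source q)

theorem chart_mem_overlap {p q x : N} (hp : x ∈ (extChartAt (𝓡 2) p).source)
    (hq : x ∈ (extChartAt (𝓡 2) q).source) : extChartAt (𝓡 2) p x ∈ chartOverlap p q :=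
  ⟨(extChartAt (𝓡 2) p).map_source hp, by
    rw [mem_preimage, (extChartAt (𝓡 2) p).left_inv hp]; exact hq⟩

theorem chartChange_chart {p q x : N} (hp : x ∈ (extChartAt (𝓡 2) p).source) :
    chartChange p q (extChartAt (𝓡 2) p x) = extChartAt (𝓡 2) q x := by
  rw [chartChange, (extChartAt (𝓡 2) p).left_inv hp]

theorem contDiffOn_chartChange (p q : N) : ContDiffOn ℝ ∞ (chartChange p q) (chartOverlap p q) := by
  have h := contDiffOn_ext_coord_change (I := 𝓡 2) (n := ∞) q p
  rwa [PartialEquiv.trans_source, PartialEquiv.symm_source] at h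

theorem hasMFDerivAt_chart {p x : N} (hp : x ∈ (extChartAt (𝓡 2) p).source) :
    HasMFDerivAt (𝓡 2) 𝓘(ℝ, E2) (extChartAt (𝓡 2) p) x (dchart p x) :=
  (mdifferentiableAt_extChartAt (by rwa [← extChartAt_source (I := 𝓡 2)])).hasMFDerivAt

theorem dchart_isInvertible {p x : N} (hp : x ∈ (extChartAt (𝓡 2) p).source) :
    (dchart p x).IsInvertible :=
  isInvertible_mfderiv_extChartAt (I := 𝓡 2) hp

theorem dchart_injective {p x : N} (hp : x ∈ (extChartAt (𝓡 2) p).source) :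
    Function.Injective (dchart p x) := by
  obtain ⟨e, he⟩ := dchart_isInvertible hp
  rw [← he]
  exact e.injective

theorem dchart_surjective {p x : N} (hp : x ∈ (extChartAt (𝓡 2) p).source) :
    Function.Surjective (dchart p x) := by
  obtain ⟨e, he⟩ := dchart_isInvertible hp
  rw [← he]
  exact e.surjective

theorem dchart_inverse_apply {p x : N} (hp : x ∈ (extChartAt (𝓡 2) p).source) (v : E2) :
    dchart p x ((dchart p x).inverse v) = v := by
  obtain ⟨e, he⟩ := dchart_isInvertible hp
  rw [← he, ContinuousLinearMap.inverse_equiv]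
  exact e.apply_symm_apply v

theorem dchart_self (p : N) : dchart p p = ContinuousLinearMap.id ℝ E2 :=
  mfderiv_extChartAt_self (I := 𝓡 2)

theorem mem_chart_self (p : N) : p ∈ (extChartAt (𝓡 2) p).source := mem_extChartAt_source p

theorem dchart_change {p q x : N} (hp : x ∈ (extChartAt (𝓡 2) p).source)
    (hq : x ∈ (extChartAt (𝓡 2) q).source) (v : E2) :
    dchart q x v = fderiv ℝ (chartChange p q) (extChartAt (𝓡 2) p x) (dchart p x v) := by
  have h1 : DifferentiableAt ℝ (chartChange p q) (extChartAt (𝓡 2) p x) :=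
    ((contDiffOn_chartChange p q).contDiffAt
      ((isOpen_chartOverlap p q).mem_nhds (chart_mem_overlap hp hq))).differentiableAt (by simp)
  have h2 := (h1.hasFDerivAt.hasMFDerivAt).comp x (hasMFDerivAt_chart hp)
  have h3 : chartChange p q ∘ extChartAt (𝓡 2) p =ᶠ[𝓝 x] extChartAt (𝓡 2) q :=
    eventually_of_mem ((isOpen_extChartAt_source p).mem_nhds hp) fun y hy => chartChange_chart hy
  have h4 := h2.congr_of_eventuallyEq h3.symm
  exact congrArg (fun A : E2 →L[ℝ] E2 => A v) (hasMFDerivAt_unique (hasMFDerivAt_chart hq) h4)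

/-- The derivative of the inverse of the chart around `p`. -/
def dchartSymm (p : N) (u : E2) : E2 →L[ℝ] E2 :=
  mfderiv 𝓘(ℝ, E2) (𝓡 2) (extChartAt (𝓡 2) p).symm u

theorem dchartSymm_dchart {p x : N} (hp : x ∈ (extChartAt (𝓡 2) p).source) (v : E2) :
    dchartSymm p (extChartAt (𝓡 2) p x) (dchart p x v) = v := by
  have := mfderivWithin_extChartAt_symm_comp_mfderiv_extChartAt' (I := 𝓡 2) hp
  simp only [modelWithCornersSelf_coe, range_id, mfderivWithin_univ] at this
  exact congrArg (fun A : E2 →L[ℝ] E2 => A v) this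

theorem dchart_dchartSymm {p x : N} (hp : x ∈ (extChartAt (𝓡 2) p).source) (v : E2) :
    dchart p x (dchartSymm p (extChartAt (𝓡 2) p x) v) = v := by
  obtain ⟨w, rfl⟩ := dchart_surjective hp v
  rw [dchartSymm_dchart hp]

theorem metricInChart_eq (g : Metric N) (p : N) (u X Y : E2) :
    metricInChart g p u X Y
      = gform g ((extChartAt (𝓡 2) p).symm u) (dchartSymm p u X) (dchartSymm p u Y) := rfl

theorem metricInChart_apply (g : Metric N) {p x : N} (hp : x ∈ (extChartAt (𝓡 2) p).source)
    (v w : E2) :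
    metricInChart g p (extChartAt (𝓡 2) p x) (dchart p x v) (dchart p x w) = gform g x v w := by
  rw [metricInChart_eq, (extChartAt (𝓡 2) p).left_inv hp, dchartSymm_dchart hp,
    dchartSymm_dchart hp]

theorem trivialization_snd {p x : N} (hp : x ∈ (chartAt E2 p).source) (v : TangentSpace (𝓡 2) x) :
    (trivializationAt E2 (TangentSpace (𝓡 2)) p (⟨x, v⟩ : TangentBundle (𝓡 2) N)).2
      = dchart p x v := by
  have h := TangentBundle.continuousLinearMapAt_trivializationAt (I := 𝓡 2) hp
  have h2 : (trivializationAt E2 (TangentSpace (𝓡 2)) p).continuousLinearMapAt ℝ x v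
      = dchart p x v := congrArg (fun A : TangentSpace (𝓡 2) x →L[ℝ] E2 => A v) h
  rw [← h2, Trivialization.continuousLinearMapAt_apply, Trivialization.coe_linearMapAt_of_mem]
  exact hp

/-- Smoothness of a vector field along a map, read in the chart around `p`. -/
theorem contMDiffWithinAt_tangent_iff {EX HX X : Type*} [NormedAddCommGroup EX] [NormedSpace ℝ EX]
    [TopologicalSpace HX] {IX : ModelWithCorners ℝ EX HX} [TopologicalSpace X] [ChartedSpace HX X]
    {n : WithTop ℕ∞} (hn : n + 1 ≤ ∞)
    {f : X → N} {V : ∀ a, TangentSpace (𝓡 2) (f a)} {s : Set X} {a : X}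
    {p : N} (hp : f a ∈ (extChartAt (𝓡 2) p).source) :
    ContMDiffWithinAt IX (𝓡 2).tangent n (fun a => (⟨f a, V a⟩ : TangentBundle (𝓡 2) N)) s a ↔
      ContMDiffWithinAt IX (𝓡 2) n f s a ∧
      ContMDiffWithinAt IX 𝓘(ℝ, E2) n (fun a => dchart p (f a) (V a)) s a := by
  have hp' : f a ∈ (chartAt E2 p).source := by rwa [extChartAt_source] at hp
  have : IsManifold (𝓡 2) (n + 1) N := IsManifold.of_le hn
  have : ContMDiffVectorBundle n E2 (TangentSpace (𝓡 2) : N → Type _) (𝓡 2) :=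
    TangentBundle.contMDiffVectorBundle
  have key := (trivializationAt E2 (TangentSpace (𝓡 2)) p).contMDiffWithinAt_iff (IB := 𝓡 2)
    (IM := IX) (n := n) (f := fun a => (⟨f a, V a⟩ : TangentBundle (𝓡 2) N)) (s := s) (x₀ := a)
    (by rw [Trivialization.mem_source]; exact hp')
  refine key.trans (and_congr_right fun hf => ?_)
  have hev : ∀ᶠ b in 𝓝[s] a, f b ∈ (chartAt E2 p).source :=
    hf.continuousWithinAt.eventually ((chartAt E2 p).open_source.mem_nhds hp')
  refine EventuallyEq.contMDiffWithinAt_iff ?_ (trivialization_snd hp' (V a))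
  exact hev.mono fun b hb => trivialization_snd hb (V b)

theorem contMDiffAt_chart_symm {p : N} {u : E2} (hu : u ∈ (extChartAt (𝓡 2) p).target) :
    ContMDiffAt 𝓘(ℝ, E2) (𝓡 2) ∞ (extChartAt (𝓡 2) p).symm u :=
  (contMDiffOn_extChartAt_symm p u hu).contMDiffAt ((isOpen_extChartAt_target p).mem_nhds hu)

theorem contDiffOn_metricInChart (g : Metric N) (p : N) :
    ContDiffOn ℝ ∞ (metricInChart g p) (extChartAt (𝓡 2) p).target := by
  have hsec : ∀ u ∈ (extChartAt (𝓡 2) p).target, ∀ X : E2, ContMDiffAt 𝓘(ℝ, E2) (𝓡 2).tangent ∞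
      (fun w => (⟨(extChartAt (𝓡 2) p).symm w, dchartSymm p w X⟩ : TangentBundle (𝓡 2) N)) u := by
    intro u hu X
    rw [← contMDiffWithinAt_univ]
    refine (contMDiffWithinAt_tangent_iff (p := p) (by simp)
      ((extChartAt (𝓡 2) p).map_target hu)).2 ⟨(contMDiffAt_chart_symm hu).contMDiffWithinAt, ?_⟩
    have hc : ContMDiffAt 𝓘(ℝ, E2) 𝓘(ℝ, E2) ∞ (fun _ : E2 => X) u := contMDiffAt_const
    refine (hc.congr_of_eventuallyEq ?_).contMDiffWithinAt
    filter_upwards [(isOpen_extChartAt_target p).mem_nhds hu] with w hw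
    have h1 := (extChartAt (𝓡 2) p).map_target hw
    have h2 := dchart_dchartSymm h1 X
    rwa [(extChartAt (𝓡 2) p).right_inv hw] at h2
  rw [contDiffOn_clm_apply]
  intro X
  rw [contDiffOn_clm_apply]
  intro Y u hu
  refine ContDiffAt.contDiffWithinAt ?_
  rw [← contMDiffAt_iff_contDiffAt]
  have hg := (g.contMDiff ((extChartAt (𝓡 2) p).symm u)).comp u (contMDiffAt_chart_symm hu)
  have := ContMDiffAt.clm_bundle_apply₂ (F₁ := E2) (F₂ := E2) (F₃ := ℝ) (IB := 𝓡 2)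
    (E₁ := (TangentSpace (𝓡 2) : N → Type _)) (E₂ := (TangentSpace (𝓡 2) : N → Type _))
    (E₃ := Bundle.Trivial N ℝ) hg (hsec u hu X) (hsec u hu Y)
  rw [contMDiffAt_totalSpace] at this
  exact this.2

theorem gform_symm (g : Metric N) (x : N) (v w : E2) : gform g x v w = gform g x w v :=
  g.symm x v w

theorem gform_pos (g : Metric N) (x : N) {v : E2} (hv : v ≠ 0) : 0 < gform g x v v :=
  g.pos x v hv

theorem isCoordMetric_metricInChart (g : Metric N) (p : N) :
    IsCoordMetric (metricInChart g p) (extChartAt (𝓡 2) p).target where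
  isOpen := isOpen_extChartAt_target p
  contDiffOn := contDiffOn_metricInChart g p
  symm u hu X Y := by rw [metricInChart_eq, metricInChart_eq, gform_symm]
  inv u hu := by
    have hinj : Function.Injective (metricInChart g p u) := by
      rw [injective_iff_map_eq_zero]
      intro X hX
      by_contra h0
      have h1 := (extChartAt (𝓡 2) p).map_target hu
      have h2 : dchartSymm p u X ≠ 0 := by
        intro h
        apply h0
        have h3 := dchart_dchartSymm h1 X
        rw [(extChartAt (𝓡 2) p).right_inv hu, h, map_zero] at h3
        exact h3.symm
      have h3 := gform_pos g ((extChartAt (𝓡 2) p).symm u) h2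
      rw [← metricInChart_eq, hX] at h3
      simp at h3
    have hdim : Module.finrank ℝ E2 = Module.finrank ℝ (E2 →L[ℝ] ℝ) :=
      (InnerProductSpace.toDual ℝ E2).toLinearEquiv.finrank_eq
    have : FiniteDimensional ℝ (E2 →L[ℝ] ℝ) :=
      Module.Finite.equiv (InnerProductSpace.toDual ℝ E2).toLinearEquiv
    exact ⟨(LinearEquiv.ofInjectiveOfFinrankEq (metricInChart g p u : E2 →ₗ[ℝ] (E2 →L[ℝ] ℝ)) hinj
      hdim).toContinuousLinearEquiv, rfl⟩

theorem isCoordChange_chartChange (g : Metric N) (p q : N) :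
    IsCoordChange (metricInChart g p) (metricInChart g q) (chartChange p q)
      (extChartAt (𝓡 2) p).target (extChartAt (𝓡 2) q).target (chartOverlap p q) where
  metric := isCoordMetric_metricInChart g p
  metric' := isCoordMetric_metricInChart g q
  isOpen := isOpen_chartOverlap p q
  subset := inter_subset_left
  mapsTo u hu := (extChartAt (𝓡 2) q).map_source hu.2
  contDiffOn := contDiffOn_chartChange p q
  isometry u hu X Y := by
    have hp := (extChartAt (𝓡 2) p).map_target hu.1
    obtain ⟨v, rfl⟩ := dchart_surjective hp X
    obtain ⟨w, rfl⟩ := dchart_surjective hp Y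
    have h := (extChartAt (𝓡 2) p).right_inv hu.1
    have e1 := metricInChart_apply g hp v w
    have e2 := metricInChart_apply g (p := q) hu.2 v w
    rw [dchart_change hp hu.2, dchart_change hp hu.2] at e2
    rw [h] at e1 e2
    rw [e1, ← e2]
    rfl
  surj u hu := by
    intro X
    have hp := (extChartAt (𝓡 2) p).map_target hu.1
    obtain ⟨v, rfl⟩ := dchart_surjective (p := q) hu.2 X
    refine ⟨dchart p ((extChartAt (𝓡 2) p).symm u) v, ?_⟩
    rw [dchart_change hp hu.2, (extChartAt (𝓡 2) p).right_inv hu.1]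

end Charts

/-! ### Geodesics and Jacobi fields as integral curves -/

theorem exists_delta_of_eventually_nhdsWithin {Q : ℝ → Prop} {s : Set ℝ} {τ : ℝ}
    (h : ∀ᶠ t in 𝓝[s] τ, Q t) : ∃ δ > 0, ∀ t ∈ s, |t - τ| < δ → Q t := by
  rw [eventually_nhdsWithin_iff, Metric.eventually_nhds_iff] at h
  obtain ⟨δ, hδ, H⟩ := h
  exact ⟨δ, hδ, fun t ht hd => H (by rwa [Real.dist_eq]) ht⟩

section LiftedCurves

/-- The coordinates, in the chart around `p`, of a point with a tangent vector. -/
def st (p : N) (Z : N × E2) : E2 × E2 := (extChartAt (𝓡 2) p Z.1, dchart p Z.1 Z.2)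

/-- The point with a tangent vector that has given coordinates in the chart around `p`. -/
def stInv (p : N) (z : E2 × E2) : N × E2 := ((extChartAt (𝓡 2) p).symm z.1, dchartSymm p z.1 z.2)

/-- The coordinates of a pair `X = (J, K)` of tangent vectors, thought of as a vector field along a
curve with velocity `Z` and as its covariant derivative: those of `J` and its ordinary derivative,
in the chart around `p`. -/
def jst (g : Metric N) (p : N) (Z : N × E2) (X : E2 × E2) : E2 × E2 :=
  (dchart p Z.1 X.1, dchart p Z.1 X.2
    - christoffelL (metricInChart g p) (extChartAt (𝓡 2) p Z.1) (dchart p Z.1 Z.2)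
      (dchart p Z.1 X.1))

/-- The pair of tangent vectors that has given coordinates `jst`. -/
def jstInv (g : Metric N) (p : N) (z ζ : E2 × E2) : E2 × E2 :=
  (dchartSymm p z.1 ζ.1, dchartSymm p z.1 (covPart (metricInChart g p) z ζ))

theorem st_stInv {p : N} {z : E2 × E2} (hz : z.1 ∈ (extChartAt (𝓡 2) p).target) :
    st p (stInv p z) = z := by
  have h1 := (extChartAt (𝓡 2) p).map_target hz
  have h2 := (extChartAt (𝓡 2) p).right_inv hz
  have h3 := dchart_dchartSymm h1 z.2
  rw [h2] at h3
  exact Prod.ext h2 h3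

theorem stInv_st {p : N} {Z : N × E2} (hZ : Z.1 ∈ (extChartAt (𝓡 2) p).source) :
    stInv p (st p Z) = Z :=
  Prod.ext ((extChartAt (𝓡 2) p).left_inv hZ) (dchartSymm_dchart hZ Z.2)

theorem stInv_mem {p : N} {z : E2 × E2} (hz : z.1 ∈ (extChartAt (𝓡 2) p).target) :
    (stInv p z).1 ∈ (extChartAt (𝓡 2) p).source := (extChartAt (𝓡 2) p).map_target hz

theorem st_mem {p : N} {Z : N × E2} (hZ : Z.1 ∈ (extChartAt (𝓡 2) p).source) :
    (st p Z).1 ∈ (extChartAt (𝓡 2) p).target := (extChartAt (𝓡 2) p).map_source hZ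

theorem covPart_jst (g : Metric N) (p : N) (Z : N × E2) (X : E2 × E2) :
    covPart (metricInChart g p) (st p Z) (jst g p Z X) = dchart p Z.1 X.2 := by
  simp [covPart, st, jst]

theorem jst_jstInv (g : Metric N) {p : N} {z : E2 × E2} (ζ : E2 × E2)
    (hz : z.1 ∈ (extChartAt (𝓡 2) p).target) : jst g p (stInv p z) (jstInv g p z ζ) = ζ := by
  have h1 := stInv_mem hz
  have h2 : extChartAt (𝓡 2) p (stInv p z).1 = z.1 := (extChartAt (𝓡 2) p).right_inv hz
  have h3 : ∀ v, dchart p (stInv p z).1 (dchartSymm p z.1 v) = v := by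
    intro v
    have := dchart_dchartSymm h1 v
    rwa [h2] at this
  have h4 : dchart p (stInv p z).1 (stInv p z).2 = z.2 := h3 _
  refine Prod.ext (h3 _) ?_
  simp only [jst, jstInv, h2, h3, h4, covPart, add_sub_cancel_right]

theorem jst_injective (g : Metric N) {p : N} {Z : N × E2}
    (hZ : Z.1 ∈ (extChartAt (𝓡 2) p).source) {X Y : E2 × E2} (h : jst g p Z X = jst g p Z Y) :
    X = Y := by
  have h1 : X.1 = Y.1 := dchart_injective hZ (congrArg Prod.fst h)
  have h2 := congrArg (covPart (metricInChart g p) (st p Z)) h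
  rw [covPart_jst, covPart_jst] at h2
  exact Prod.ext h1 (dchart_injective hZ h2)

theorem jst_add (g : Metric N) (p : N) (Z : N × E2) (X Y : E2 × E2) :
    jst g p Z (X + Y) = jst g p Z X + jst g p Z Y := by
  ext1
  · simp [jst]
  · simp only [jst, Prod.fst_add, Prod.snd_add, map_add]
    abel

theorem jst_smul (g : Metric N) (p : N) (Z : N × E2) (a : ℝ) (X : E2 × E2) :
    jst g p Z (a • X) = a • jst g p Z X := by
  ext1
  · simp [jst]
  · simp only [jst, Prod.smul_fst, Prod.smul_snd, map_smul, smul_sub]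

theorem st_change {p q : N} {Z : N × E2} (hp : Z.1 ∈ (extChartAt (𝓡 2) p).source)
    (hq : Z.1 ∈ (extChartAt (𝓡 2) q).source) :
    st q Z = tangentChange (chartChange p q) (st p Z) :=
  Prod.ext (chartChange_chart hp).symm (dchart_change hp hq Z.2)

theorem jst_change (g : Metric N) {p q : N} {Z : N × E2} (hp : Z.1 ∈ (extChartAt (𝓡 2) p).source)
    (hq : Z.1 ∈ (extChartAt (𝓡 2) q).source) (X : E2 × E2) :
    jst g q Z X = fderiv ℝ (tangentChange (chartChange p q)) (st p Z) (jst g p Z X) := by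
  have h := isCoordChange_chartChange g p q
  have hm : (st p Z).1 ∈ chartOverlap p q := chart_mem_overlap hp hq
  have h1 : (jst g q Z X).1
      = (fderiv ℝ (tangentChange (chartChange p q)) (st p Z) (jst g p Z X)).1 := by
    rw [h.fderiv_tangentChange hm]
    exact dchart_change hp hq X.1
  have h2 := h.covPart_tangentChange hm (jst g p Z X)
  rw [covPart_jst, ← st_change hp hq] at h2
  have h3 : (fderiv ℝ (chartChange p q) (st p Z).1) (dchart p Z.1 X.2) = dchart q Z.1 X.2 :=
    (dchart_change hp hq X.2).symm
  rw [h3, ← covPart_jst g q Z X, covPart, covPart, h1] at h2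
  exact Prod.ext h1 (add_right_cancel h2).symm

/-- A curve with a tangent vector at each of its points is a geodesic with its velocity on `s`: in
the coordinates of every chart it is an integral curve of the geodesic spray. -/
structure IsGeo (g : Metric N) (Z : ℝ → N × E2) (s : Set ℝ) : Prop where
  cont : ∀ t ∈ s, ContinuousWithinAt (fun τ => (Z τ).1) s t
  deriv : ∀ t ∈ s, ∀ p, (Z t).1 ∈ (extChartAt (𝓡 2) p).source →
    HasDerivWithinAt (fun τ => st p (Z τ)) (spray (metricInChart g p) (st p (Z t))) s t

/-- The pair `X = (J, K)` consists of a Jacobi field along the geodesic `Z` and of its covariant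
derivative: in the coordinates of every chart it solves the linearized geodesic equation. -/
def IsJac (g : Metric N) (Z : ℝ → N × E2) (X : ℝ → E2 × E2) (s : Set ℝ) : Prop :=
  ∀ t ∈ s, ∀ p, (Z t).1 ∈ (extChartAt (𝓡 2) p).source →
    HasDerivWithinAt (fun τ => jst g p (Z τ) (X τ))
      (fderiv ℝ (spray (metricInChart g p)) (st p (Z t)) (jst g p (Z t) (X t))) s t

variable {g : Metric N} {Z Z' : ℝ → N × E2} {X X' : ℝ → E2 × E2} {s s' : Set ℝ} {t : ℝ}

theorem eventually_mem_source {p : N} (hc : ContinuousWithinAt (fun τ => (Z τ).1) s t)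
    (hp : (Z t).1 ∈ (extChartAt (𝓡 2) p).source) :
    ∀ᶠ τ in 𝓝[s] t, (Z τ).1 ∈ (extChartAt (𝓡 2) p).source :=
  hc.eventually ((isOpen_extChartAt_source p).mem_nhds hp)

theorem IsGeo.of_chart (hc : ∀ t ∈ s, ContinuousWithinAt (fun τ => (Z τ).1) s t)
    (h : ∀ t ∈ s, ∃ p, (Z t).1 ∈ (extChartAt (𝓡 2) p).source ∧
      HasDerivWithinAt (fun τ => st p (Z τ)) (spray (metricInChart g p) (st p (Z t))) s t) :
    IsGeo g Z s := by
  refine ⟨hc, fun t ht q hq => ?_⟩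
  obtain ⟨p, hp, hd⟩ := h t ht
  have key := (isCoordChange_chartChange g p q).hasDerivWithinAt_tangentChange
    (chart_mem_overlap hp hq) hd
  rw [← st_change hp hq] at key
  refine key.congr_of_eventuallyEq ?_ (st_change hp hq)
  filter_upwards [eventually_mem_source (hc t ht) hp, eventually_mem_source (hc t ht) hq]
    with τ h1 h2 using st_change h1 h2

theorem IsJac.of_chart (hZ : IsGeo g Z s)
    (h : ∀ t ∈ s, ∃ p, (Z t).1 ∈ (extChartAt (𝓡 2) p).source ∧
      HasDerivWithinAt (fun τ => jst g p (Z τ) (X τ))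
      (fderiv ℝ (spray (metricInChart g p)) (st p (Z t)) (jst g p (Z t) (X t))) s t) :
    IsJac g Z X s := by
  intro t ht q hq
  obtain ⟨p, hp, hd⟩ := h t ht
  have key := (isCoordChange_chartChange g p q).hasDerivWithinAt_fderiv_tangentChange
    (chart_mem_overlap hp hq) (hZ.deriv t ht p hp) hd
  rw [← st_change hp hq, ← jst_change g hp hq] at key
  refine key.congr_of_eventuallyEq ?_ (jst_change g hp hq _)
  filter_upwards [eventually_mem_source (hZ.cont t ht) hp, eventually_mem_source (hZ.cont t ht) hq]
    with τ h1 h2 using jst_change g h1 h2 _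

theorem IsGeo.mono (h : IsGeo g Z s) (hs : s' ⊆ s) : IsGeo g Z s' :=
  ⟨fun t ht => (h.cont t (hs ht)).mono hs, fun t ht p hp => (h.deriv t (hs ht) p hp).mono hs⟩

theorem IsJac.mono (h : IsJac g Z X s) (hs : s' ⊆ s) : IsJac g Z X s' :=
  fun t ht p hp => (h t (hs ht) p hp).mono hs

theorem IsGeo.congr (h : IsGeo g Z s) (he : EqOn Z' Z s) : IsGeo g Z' s := by
  refine ⟨fun t ht => (h.cont t ht).congr (fun τ hτ => by rw [he hτ]) (by rw [he ht]),
    fun t ht p hp => ?_⟩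
  rw [he ht] at hp ⊢
  exact (h.deriv t ht p hp).congr (fun τ hτ => by rw [he hτ]) (by rw [he ht])

theorem IsJac.congr (h : IsJac g Z X s) (he : EqOn Z' Z s) (he' : EqOn X' X s) :
    IsJac g Z' X' s := by
  intro t ht p hp
  rw [he ht] at hp ⊢
  rw [he' ht]
  exact (h t ht p hp).congr (fun τ hτ => by rw [he hτ, he' hτ]) (by rw [he ht, he' ht])

theorem IsGeo.union (h : IsGeo g Z s) (h' : IsGeo g Z s') (hs : IsClosed s) (hs' : IsClosed s') :
    IsGeo g Z (s ∪ s') := by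
  have hc : ∀ {s : Set ℝ}, IsGeo g Z s → IsClosed s → ∀ t,
      ContinuousWithinAt (fun τ => (Z τ).1) s t := by
    intro s h hs t
    by_cases ht : t ∈ s
    · exact h.cont t ht
    · exact continuousWithinAt_of_notMem_closure (by rwa [hs.closure_eq])
  have hd : ∀ {s : Set ℝ}, IsGeo g Z s → IsClosed s → ∀ t p,
      (Z t).1 ∈ (extChartAt (𝓡 2) p).source →
      HasDerivWithinAt (fun τ => st p (Z τ)) (spray (metricInChart g p) (st p (Z t))) s t := by
    intro s h hs t p hp
    by_cases ht : t ∈ s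
    · exact h.deriv t ht p hp
    · exact HasFDerivWithinAt.of_notMem_closure (by rwa [hs.closure_eq])
  exact ⟨fun t _ => (hc h hs t).union (hc h' hs' t),
    fun t _ p hp => (hd h hs t p hp).union (hd h' hs' t p hp)⟩

theorem IsJac.union (h : IsJac g Z X s) (h' : IsJac g Z X s') (hs : IsClosed s)
    (hs' : IsClosed s') : IsJac g Z X (s ∪ s') := by
  have hd : ∀ {s : Set ℝ}, IsJac g Z X s → IsClosed s → ∀ t p,
      (Z t).1 ∈ (extChartAt (𝓡 2) p).source →
      HasDerivWithinAt (fun τ => jst g p (Z τ) (X τ))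
        (fderiv ℝ (spray (metricInChart g p)) (st p (Z t)) (jst g p (Z t) (X t))) s t := by
    intro s h hs t p hp
    by_cases ht : t ∈ s
    · exact h t ht p hp
    · exact HasFDerivWithinAt.of_notMem_closure (by rwa [hs.closure_eq])
  exact fun t _ p hp => (hd h hs t p hp).union (hd h' hs' t p hp)

/-- An affine change of parameter. -/
theorem IsGeo.comp_affine (h : IsGeo g Z s) (α β : ℝ) (hs : MapsTo (fun t => β + t * α) s' s) :
    IsGeo g (fun t => ((Z (β + t * α)).1, α • (Z (β + t * α)).2)) s' := by
  have haff : ∀ t, HasDerivWithinAt (fun t : ℝ => β + t * α) α s' t := fun t => by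
    simpa using (((hasDerivAt_id t).mul_const α).const_add β).hasDerivWithinAt
  refine ⟨fun t ht => ContinuousWithinAt.comp (f := fun t => β + t * α) (h.cont _ (hs ht))
    (haff t).continuousWithinAt hs, fun t ht p hp => ?_⟩
  have hd := (h.deriv _ (hs ht) p hp).scomp t (haff t) hs
  have h1 := (hasFDerivAt_fst (𝕜 := ℝ)
    (p := (fun t => st p (Z (β + t * α))) t)).comp_hasDerivWithinAt t hd
  have h2 := (hasFDerivAt_snd (𝕜 := ℝ)
    (p := (fun t => st p (Z (β + t * α))) t)).comp_hasDerivWithinAt t hd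
  refine (h1.prodMk (h2.const_smul α)).congr_deriv ?_ |>.congr_of_eventuallyEq ?_ ?_
  · ext1
    · simp [spray, st]
    · simp [spray, st]
  · exact Eventually.of_forall fun τ => by simp [st]
  · simp [st]

theorem IsJac.comp_affine (h : IsJac g Z X s) (α β : ℝ)
    (hs : MapsTo (fun t => β + t * α) s' s) :
    IsJac g (fun t => ((Z (β + t * α)).1, α • (Z (β + t * α)).2))
      (fun t => ((X (β + t * α)).1, α • (X (β + t * α)).2)) s' := by
  have haff : ∀ t, HasDerivWithinAt (fun t : ℝ => β + t * α) α s' t := fun t => by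
    simpa using (((hasDerivAt_id t).mul_const α).const_add β).hasDerivWithinAt
  intro t ht p hp
  have hG := isCoordMetric_metricInChart g p
  have hd := (h _ (hs ht) p hp).scomp t (haff t) hs
  have h1 := (hasFDerivAt_fst (𝕜 := ℝ) (p := (fun t =>
    jst g p (Z (β + t * α)) (X (β + t * α))) t)).comp_hasDerivWithinAt t hd
  have h2 := (hasFDerivAt_snd (𝕜 := ℝ) (p := (fun t =>
    jst g p (Z (β + t * α)) (X (β + t * α))) t)).comp_hasDerivWithinAt t hd
  refine (h1.prodMk (h2.const_smul α)).congr_deriv ?_ |>.congr_of_eventuallyEq ?_ ?_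
  · rw [hG.fderiv_spray (st_mem hp), hG.fderiv_spray (st_mem (Z := Z (β + t * α)) hp)]
    ext1
    · simp [jst, smul_sub]
    · simp [jst, st, smul_sub, smul_smul]
      module
  · exact Eventually.of_forall fun τ => by simp [jst, smul_sub]
  · simp [jst, smul_sub]

end LiftedCurves

/-! ### Conserved quantities and uniqueness -/

section Jacobi

variable {g : Metric N} {Z Z' : ℝ → N × E2} {X X' : ℝ → E2 × E2} {s s' : Set ℝ} {a b t : ℝ}

theorem IsJac.smul (h : IsJac g Z X s) (a : ℝ) : IsJac g Z (fun t => a • X t) s := by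
  intro t ht p hp
  simp only [jst_smul, map_smul]
  exact (h t ht p hp).const_smul a

theorem jst_velocity (g : Metric N) (p : N) (Z : N × E2) :
    jst g p Z (Z.2, 0) = spray (metricInChart g p) (st p Z) := by
  simp [jst, spray, st]

/-- The velocity of a geodesic is a Jacobi field. -/
theorem IsGeo.isJac_velocity (h : IsGeo g Z s) : IsJac g Z (fun t => ((Z t).2, 0)) s := by
  intro t ht p hp
  simp only [jst_velocity]
  have hS := (((isCoordMetric_metricInChart g p).contDiffAt_spray
    (st_mem hp)).differentiableAt (by simp)).hasFDerivAt
  exact hS.comp_hasDerivWithinAt t (h.deriv t ht p hp)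

/-- The velocity of a geodesic, multiplied by the time, is a Jacobi field. -/
theorem IsGeo.isJac_time_velocity (h : IsGeo g Z s) :
    IsJac g Z (fun t => (t • (Z t).2, (Z t).2)) s := by
  intro t ht p hp
  have hG := isCoordMetric_metricInChart g p
  have e : ∀ τ, jst g p (Z τ) (τ • (Z τ).2, (Z τ).2)
      = τ • spray (metricInChart g p) (st p (Z τ)) + (0, (st p (Z τ)).2) := by
    intro τ
    have : ((τ • (Z τ).2, (Z τ).2) : E2 × E2) = τ • ((Z τ).2, 0) + (0, (Z τ).2) := by simp
    rw [this, jst_add, jst_smul, jst_velocity]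
    congr 1
    simp [jst, st]
  have h1 := h.isJac_velocity t ht p hp
  simp only [jst_velocity] at h1
  have h2 := (hasFDerivAt_snd (𝕜 := ℝ) (p := st p (Z t))).comp_hasDerivWithinAt t
    (h.deriv t ht p hp)
  have h3 := ((hasDerivWithinAt_id t s).smul h1).add
    ((hasDerivWithinAt_const t s (0 : E2)).prodMk h2)
  simp only [e]
  refine h3.congr_deriv ?_
  rw [map_add, map_smul]
  have h4 := hG.fderiv_spray_fibre (z := st p (Z t)) (st_mem hp)
  rw [h4]
  ext1
  · simp [spray]
  · simp [spray]
    module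

/-- The symplectic product `⟨J₁, K₂⟩ - ⟨K₁, J₂⟩` of pairs of tangent vectors at `x`. -/
def sympl (g : Metric N) (x : N) (X Y : E2 × E2) : ℝ := gform g x X.1 Y.2 - gform g x X.2 Y.1

theorem IsJac.sympl_eq (hZ : IsGeo g Z (Icc a b)) (h : IsJac g Z X (Icc a b))
    (h' : IsJac g Z X' (Icc a b)) (ht : t ∈ Icc a b) :
    sympl g (Z t).1 (X t) (X' t) = sympl g (Z a).1 (X a) (X' a) := by
  have hd : ∀ t ∈ Icc a b,
      HasDerivWithinAt (fun τ => sympl g (Z τ).1 (X τ) (X' τ)) 0 (Icc a b) t := by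
    intro t ht
    have hp := mem_chart_self (Z t).1
    have e : ∀ τ, (Z τ).1 ∈ (extChartAt (𝓡 2) (Z t).1).source → sympl g (Z τ).1 (X τ) (X' τ) =
        metricInChart g (Z t).1 (st (Z t).1 (Z τ)).1 (jst g (Z t).1 (Z τ) (X τ)).1
          (covPart (metricInChart g (Z t).1) (st (Z t).1 (Z τ)) (jst g (Z t).1 (Z τ) (X' τ)))
        - metricInChart g (Z t).1 (st (Z t).1 (Z τ)).1
          (covPart (metricInChart g (Z t).1) (st (Z t).1 (Z τ)) (jst g (Z t).1 (Z τ) (X τ)))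
          (jst g (Z t).1 (Z τ) (X' τ)).1 := by
      intro τ hτ
      rw [covPart_jst, covPart_jst]
      simp only [sympl, ← metricInChart_apply g hτ]
      rfl
    refine ((isCoordMetric_metricInChart g (Z t).1).hasDerivWithinAt_symplectic (st_mem hp)
      (hZ.deriv t ht _ hp) (h t ht _ hp) (h' t ht _ hp)).congr_of_eventuallyEq ?_ (e t hp)
    exact (eventually_mem_source (hZ.cont t ht) hp).mono e
  exact constant_of_has_deriv_right_zero (fun t ht => (hd t ht).continuousWithinAt)
    (fun t ht => hasDerivWithinAt_Ici_of_Icc ht (hd t (Ico_subset_Icc_self ht))) t ht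

/-- Geodesics have constant speed. -/
theorem IsGeo.speed_eq (hZ : IsGeo g Z (Icc a b)) (ht : t ∈ Icc a b) :
    gform g (Z t).1 (Z t).2 (Z t).2 = gform g (Z a).1 (Z a).2 (Z a).2 := by
  have := hZ.isJac_velocity.sympl_eq hZ hZ.isJac_time_velocity ht
  simpa [sympl] using this

/-- The component of the covariant derivative of a Jacobi field in the direction of the velocity is
constant. -/
theorem IsJac.deriv_velocity_eq (hZ : IsGeo g Z (Icc a b)) (h : IsJac g Z X (Icc a b))
    (ht : t ∈ Icc a b) :
    gform g (Z t).1 (X t).2 (Z t).2 = gform g (Z a).1 (X a).2 (Z a).2 := by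
  have := h.sympl_eq hZ hZ.isJac_velocity ht
  simpa [sympl] using this

theorem IsJac.velocity_eq (hZ : IsGeo g Z (Icc a b)) (h : IsJac g Z X (Icc a b))
    (ht : t ∈ Icc a b) :
    gform g (Z t).1 (X t).1 (Z t).2 = gform g (Z a).1 (X a).1 (Z a).2
      + (t - a) * gform g (Z a).1 (X a).2 (Z a).2 := by
  have h1 := h.sympl_eq hZ hZ.isJac_time_velocity ht
  have h2 := h.deriv_velocity_eq hZ ht
  simp only [sympl, map_smul, smul_eq_mul, h2] at h1
  linarith

theorem exists_lipschitz_spray (g : Metric N) {p : N} {z : E2 × E2}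
    (hz : z.1 ∈ (extChartAt (𝓡 2) p).target) :
    ∃ K : ℝ≥0, ∃ U ∈ 𝓝 z, LipschitzOnWith K (spray (metricInChart g p)) U := by
  have h := ((isCoordMetric_metricInChart g p).contDiffAt_spray hz).of_le
    (m := 1) (by simp)
  exact h.exists_lipschitzOnWith

/-- A geodesic is determined by its initial velocity. -/
theorem IsGeo.eq_of_eq [T2Space N] (h : IsGeo g Z (Icc a b)) (h' : IsGeo g Z' (Icc a b))
    (he : Z a = Z' a) (ht : t ∈ Icc a b) : Z t = Z' t := by
  have hsub : Icc a t ⊆ Icc a b := Icc_subset_Icc_right ht.2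
  replace h := h.mono hsub
  replace h' := h'.mono hsub
  refine propagate_Icc (P := fun t => Z t = Z' t) ht.1 he fun τ hτ => ?_
  by_cases hτe : Z τ = Z' τ
  · have hp := mem_chart_self (Z τ).1
    have hp' : (Z' τ).1 ∈ (extChartAt (𝓡 2) (Z τ).1).source := by rw [← hτe]; exact hp
    obtain ⟨K, U, hU, hK⟩ := exists_lipschitz_spray g (st_mem hp)
    have hU' : U ∈ 𝓝 (st (Z τ).1 (Z' τ)) := by rw [← hτe]; exact hU
    have hev := (eventually_mem_source (h.cont τ hτ) hp).and
      ((eventually_mem_source (h'.cont τ hτ) hp').and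
      (((h.deriv τ hτ _ hp).continuousWithinAt.eventually hU).and
      ((h'.deriv τ hτ _ hp').continuousWithinAt.eventually hU')))
    obtain ⟨δ, hδ, H⟩ := exists_delta_of_eventually_nhdsWithin hev
    refine ⟨δ, hδ, fun s hs s' hs' hsδ hs'δ hss' hP => ?_⟩
    have hmem : ∀ r ∈ Icc s s', r ∈ Icc a t ∧ |r - τ| < δ := fun r hr =>
      ⟨⟨hs.1.trans hr.1, hr.2.trans hs'.2⟩, by
        rw [abs_lt] at *; exact ⟨by linarith [hr.1], by linarith [hr.2]⟩⟩
    have hsub' : Icc s s' ⊆ Icc a t := fun r hr => (hmem r hr).1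
    have key := ode_unique_Icc (v := fun _ => spray (metricInChart g (Z τ).1)) (U := fun _ => U)
      (f := fun r => st (Z τ).1 (Z r)) (g := fun r => st (Z τ).1 (Z' r)) (a := s) (b := s')
      (fun _ _ => hK)
      (fun r hr => (h.deriv r (hsub' hr) _ (H r (hmem r hr).1 (hmem r hr).2).1).mono hsub')
      (fun r hr => (H r (hmem r hr).1 (hmem r hr).2).2.2.1)
      (fun r hr => (h'.deriv r (hsub' hr) _ (H r (hmem r hr).1 (hmem r hr).2).2.1).mono hsub')
      (fun r hr => (H r (hmem r hr).1 (hmem r hr).2).2.2.2)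
      (by simp only [hP]) (right_mem_Icc.2 hss')
    have hr := hmem s' (right_mem_Icc.2 hss')
    show Z s' = Z' s'
    rw [← stInv_st (H s' hr.1 hr.2).1, ← stInv_st (H s' hr.1 hr.2).2.1]
    exact congrArg _ key
  · have hev : ∀ᶠ r in 𝓝[Icc a t] τ, Z r ≠ Z' r := by
      by_cases h1 : (Z τ).1 = (Z' τ).1
      · have hp := mem_chart_self (Z τ).1
        have hp' : (Z' τ).1 ∈ (extChartAt (𝓡 2) (Z τ).1).source := by rw [← h1]; exact hp
        have hne : st (Z τ).1 (Z τ) ≠ st (Z τ).1 (Z' τ) := by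
          intro hc
          apply hτe
          rw [← stInv_st hp, hc, stInv_st hp']
        refine (((h.deriv τ hτ _ hp).continuousWithinAt.prodMk
          (h'.deriv τ hτ _ hp').continuousWithinAt).eventually
            (isOpen_ne_fun continuous_fst continuous_snd |>.mem_nhds hne)).mono fun r hr hc => ?_
        exact hr (by simp only [hc])
      · refine (((h.cont τ hτ).prodMk (h'.cont τ hτ)).eventually
          (isOpen_ne_fun continuous_fst continuous_snd |>.mem_nhds h1)).mono fun r hr hc => ?_
        exact hr (by simp only [hc])
    obtain ⟨δ, hδ, H⟩ := exists_delta_of_eventually_nhdsWithin hev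
    exact ⟨δ, hδ, fun s hs s' _ hsδ _ _ hP => absurd hP (H s hs hsδ)⟩

/-- A Jacobi field is determined by its initial value and the initial value of its derivative. -/
theorem IsJac.eq_of_eq (hZ : IsGeo g Z (Icc a b)) (h : IsJac g Z X (Icc a b))
    (h' : IsJac g Z X' (Icc a b)) (he : X a = X' a) (ht : t ∈ Icc a b) : X t = X' t := by
  have hsub : Icc a t ⊆ Icc a b := Icc_subset_Icc_right ht.2
  replace h := h.mono hsub
  replace h' := h'.mono hsub
  replace hZ := hZ.mono hsub
  refine propagate_Icc (P := fun t => X t = X' t) ht.1 he fun τ hτ => ?_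
  have hp := mem_chart_self (Z τ).1
  set S := spray (metricInChart g (Z τ).1) with hS
  have hcont : ContinuousAt (fderiv ℝ S) (st (Z τ).1 (Z τ)) :=
    (((isCoordMetric_metricInChart g (Z τ).1).contDiffAt_spray (st_mem hp)).fderiv_right
      (m := ∞) (by simp)).continuousAt
  have hbd : ∀ᶠ r in 𝓝[Icc a t] τ,
      ‖fderiv ℝ S (st (Z τ).1 (Z r))‖ < ‖fderiv ℝ S (st (Z τ).1 (Z τ))‖ + 1 := by
    have h2 := hcont.norm.comp_continuousWithinAt
      (f := fun r => st (Z τ).1 (Z r)) (x := τ) (hZ.deriv τ hτ _ hp).continuousWithinAt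
    exact h2.eventually_lt continuousWithinAt_const (by simp)
  obtain ⟨δ, hδ, H⟩ := exists_delta_of_eventually_nhdsWithin
    ((eventually_mem_source (hZ.cont τ hτ) hp).and hbd)
  refine ⟨δ, hδ, fun s hs s' hs' hsδ hs'δ hss' hP => ?_⟩
  have hmem : ∀ r ∈ Icc s s', r ∈ Icc a t ∧ |r - τ| < δ := fun r hr =>
    ⟨⟨hs.1.trans hr.1, hr.2.trans hs'.2⟩, by
      rw [abs_lt] at *; exact ⟨by linarith [hr.1], by linarith [hr.2]⟩⟩
  have hsub' : Icc s s' ⊆ Icc a t := fun r hr => (hmem r hr).1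
  have key := ode_unique_Icc (v := fun r => fderiv ℝ S (st (Z τ).1 (Z r)))
    (U := fun _ => univ) (K := Real.toNNReal (‖fderiv ℝ S (st (Z τ).1 (Z τ))‖ + 1))
    (f := fun r => jst g (Z τ).1 (Z r) (X r)) (g := fun r => jst g (Z τ).1 (Z r) (X' r))
    (a := s) (b := s')
    (fun r hr => by
      refine ((fderiv ℝ S (st (Z τ).1 (Z r))).lipschitz.weaken ?_).lipschitzOnWith
      rw [← NNReal.coe_le_coe, Real.coe_toNNReal _ (by positivity)]
      exact (H r (hmem r hr).1 (hmem r hr).2).2.le)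
    (fun r hr => (h r (hsub' hr) _ (H r (hmem r hr).1 (hmem r hr).2).1).mono hsub')
    (fun r hr => mem_univ _)
    (fun r hr => (h' r (hsub' hr) _ (H r (hmem r hr).1 (hmem r hr).2).1).mono hsub')
    (fun r hr => mem_univ _)
    (by simp only [hP]) (right_mem_Icc.2 hss')
  have hr := hmem s' (right_mem_Icc.2 hss')
  exact jst_injective g (H s' hr.1 hr.2).1 key

end Jacobi

/-! ### The geodesic flow and its derivative -/

section Flow

variable {g : Metric N} {Z : ℝ → N × E2} {p₀ : N}

/-- A solution of the geodesic equation in the chart around `p` is a geodesic. -/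
theorem isGeo_of_coordinates {s : Set ℝ} {p : N} {z : ℝ → E2 × E2}
    (hm : ∀ t ∈ s, (z t).1 ∈ (extChartAt (𝓡 2) p).target)
    (hz : ∀ t ∈ s, HasDerivWithinAt z (spray (metricInChart g p) (z t)) s t) :
    IsGeo g (fun t => stInv p (z t)) s := by
  refine IsGeo.of_chart (fun t ht => ?_) fun t ht => ⟨p, stInv_mem (hm t ht), ?_⟩
  · have h1 : ContinuousWithinAt (fun τ => (z τ).1) s t :=
      continuous_fst.continuousAt.comp_continuousWithinAt (hz t ht).continuousWithinAt
    exact ContinuousAt.comp_continuousWithinAt (f := fun τ => (z τ).1)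
      ((continuousOn_extChartAt_symm p).continuousAt
        ((isOpen_extChartAt_target p).mem_nhds (hm t ht))) h1
  · rw [st_stInv (hm t ht)]
    exact (hz t ht).congr (fun τ hτ => st_stInv (hm τ hτ)) (st_stInv (hm t ht))

/-- A solution of the linearized geodesic equation in the chart around `p` is a Jacobi field. -/
theorem isJac_of_coordinates {s : Set ℝ} {p : N} {ζ : ℝ → E2 × E2} (hZ : IsGeo g Z s)
    (hm : ∀ t ∈ s, (Z t).1 ∈ (extChartAt (𝓡 2) p).source)
    (hζ : ∀ t ∈ s, HasDerivWithinAt ζ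
      (fderiv ℝ (spray (metricInChart g p)) (st p (Z t)) (ζ t)) s t) :
    IsJac g Z (fun t => jstInv g p (st p (Z t)) (ζ t)) s := by
  have e : ∀ t ∈ s, jst g p (Z t) (jstInv g p (st p (Z t)) (ζ t)) = ζ t := by
    intro t ht
    have := jst_jstInv g (p := p) (z := st p (Z t)) (ζ t) (st_mem (hm t ht))
    rwa [stInv_st (hm t ht)] at this
  refine IsJac.of_chart hZ fun t ht => ⟨p, hm t ht, ?_⟩
  rw [e t ht]
  exact (hζ t ht).congr e (e t ht)

theorem exists_glue {α : Type*} {f h : ℝ → α} {a m b : ℝ} (he : f m = h m) :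
    ∃ k : ℝ → α, EqOn k f (Icc a m) ∧ EqOn k h (Icc m b) := by
  refine ⟨fun t => if t ≤ m then f t else h t, fun t ht => if_pos ht.2, fun t ht => ?_⟩
  rcases ht.1.eq_or_lt with rfl | hlt
  · simp [he]
  · exact if_neg (not_le.2 hlt)

/-- The geodesic flow up to the time `τ` near the geodesic `Z`, in the charts around `p₀` (for the
initial values) and `p` (for the values at the time `τ`): nearby initial values belong to geodesics
on `[0, τ]`, and the derivative of the flow at the initial value of `Z` is given by the Jacobi
fields along `Z`. -/
def FlowsTo (g : Metric N) (Z : ℝ → N × E2) (p₀ : N) (τ : ℝ) (p : N) : Prop :=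
  ∃ W ∈ 𝓝 (st p₀ (Z 0)), ∃ (Φ : E2 × E2 → ℝ → N × E2) (L : E2 × E2 →L[ℝ] E2 × E2),
    (∀ z ∈ W, z.1 ∈ (extChartAt (𝓡 2) p₀).target ∧ IsGeo g (Φ z) (Icc 0 τ) ∧ Φ z 0 = stInv p₀ z ∧
      (Φ z τ).1 ∈ (extChartAt (𝓡 2) p).source) ∧
    Φ (st p₀ (Z 0)) τ = Z τ ∧
    HasFDerivAt (fun z => st p (Φ z τ)) L (st p₀ (Z 0)) ∧
    ∀ ζ, ∃ X, IsJac g Z X (Icc 0 τ) ∧ jst g p₀ (Z 0) (X 0) = ζ ∧ jst g p (Z τ) (X τ) = L ζ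

theorem FlowsTo.change {τ : ℝ} {p q : N} (h : FlowsTo g Z p₀ τ p)
    (hq : (Z τ).1 ∈ (extChartAt (𝓡 2) q).source) : FlowsTo g Z p₀ τ q := by
  obtain ⟨W, hW, Φ, L, h1, h2, h3, h4⟩ := h
  have hp : (Z τ).1 ∈ (extChartAt (𝓡 2) p).source := by
    rw [← h2]; exact (h1 _ (mem_of_mem_nhds hW)).2.2.2
  have hov : ∀ᶠ z in 𝓝 (st p₀ (Z 0)), (st p (Φ z τ)).1 ∈ chartOverlap p q := by
    have hc : ContinuousAt (fun z => (st p (Φ z τ)).1) (st p₀ (Z 0)) :=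
      continuous_fst.continuousAt.comp h3.continuousAt
    refine hc.eventually ((isOpen_chartOverlap p q).mem_nhds ?_)
    show (st p (Φ (st p₀ (Z 0)) τ)).1 ∈ _
    rw [h2]
    exact chart_mem_overlap hp hq
  have hq' : ∀ z ∈ W ∩ {z | (st p (Φ z τ)).1 ∈ chartOverlap p q},
      (Φ z τ).1 ∈ (extChartAt (𝓡 2) q).source := by
    intro z hz
    have := hz.2.2
    rwa [mem_preimage, st, (extChartAt (𝓡 2) p).left_inv (h1 z hz.1).2.2.2] at this
  have hch := isCoordChange_chartChange g p q
  refine ⟨_, inter_mem hW hov, Φ, (fderiv ℝ (tangentChange (chartChange p q)) (st p (Z τ))).comp L,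
    fun z hz => ⟨(h1 z hz.1).1, (h1 z hz.1).2.1, (h1 z hz.1).2.2.1, hq' z hz⟩, h2, ?_,
    fun ζ => ?_⟩
  · have hT := hch.hasFDerivAt_tangentChange (z := st p (Z τ)) (chart_mem_overlap hp hq)
    have hT' : HasFDerivAt (tangentChange (chartChange p q))
        (fderiv ℝ (tangentChange (chartChange p q)) (st p (Z τ))) (st p (Φ (st p₀ (Z 0)) τ)) := by
      rw [h2]; exact hT
    refine (HasFDerivAt.comp (f := fun z => st p (Φ z τ)) (st p₀ (Z 0)) hT'
      h3).congr_of_eventuallyEq ?_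
    filter_upwards [inter_mem hW hov] with z hz
    exact st_change (h1 z hz.1).2.2.2 (hq' z hz)
  · obtain ⟨X, hX, hX0, hX1⟩ := h4 ζ
    exact ⟨X, hX, hX0, by rw [jst_change g hp hq, hX1]; rfl⟩

theorem FlowsTo.refl (h0 : (Z 0).1 ∈ (extChartAt (𝓡 2) p₀).source) : FlowsTo g Z p₀ 0 p₀ := by
  have hsing : ∀ {F : Type} [NormedAddCommGroup F] [NormedSpace ℝ F] (f : ℝ → F) (f' : F) (t : ℝ),
      t ∈ Icc (0 : ℝ) 0 → HasDerivWithinAt f f' (Icc 0 0) t := by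
    intro F _ _ f f' t ht
    rw [Icc_self]
    exact (HasFDerivWithinAt.singleton : HasFDerivWithinAt f (.toSpanSingleton ℝ f') {0} t)
  refine ⟨Prod.fst ⁻¹' (extChartAt (𝓡 2) p₀).target,
    ((isOpen_extChartAt_target p₀).preimage continuous_fst).mem_nhds (st_mem h0),
    fun z _ => stInv p₀ z, ContinuousLinearMap.id ℝ _, fun z hz => ⟨hz, ?_, rfl, stInv_mem hz⟩,
    stInv_st h0, ?_, fun ζ => ⟨fun _ => jstInv g p₀ (st p₀ (Z 0)) ζ, ?_, ?_, ?_⟩⟩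
  · exact ⟨fun t _ => continuousWithinAt_const, fun t ht p _ => hsing _ _ t ht⟩
  · refine (hasFDerivAt_id _).congr_of_eventuallyEq ?_
    filter_upwards [((isOpen_extChartAt_target p₀).preimage continuous_fst).mem_nhds (st_mem h0)]
      with z hz using st_stInv hz
  · exact fun t ht p _ => hsing _ _ t ht
  · have := jst_jstInv g (p := p₀) (z := st p₀ (Z 0)) ζ (st_mem h0)
    rwa [stInv_st h0] at this
  · have := jst_jstInv g (p := p₀) (z := st p₀ (Z 0)) ζ (st_mem h0)
    rwa [stInv_st h0] at this

/-- The geodesic flow exists and is differentiable near a given geodesic, and its derivative is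
given by the Jacobi fields. The flow is continued over the interval in steps that stay in one chart. -/
theorem exists_flow (hZ : IsGeo g Z (Icc 0 1)) (h0 : (Z 0).1 ∈ (extChartAt (𝓡 2) p₀).source)
    {p : N} (hp : (Z 1).1 ∈ (extChartAt (𝓡 2) p).source) : FlowsTo g Z p₀ 1 p := by
  suffices H : FlowsTo g Z p₀ 1 (Z 1).1 from H.change hp
  refine propagate_Icc (P := fun τ => FlowsTo g Z p₀ τ (Z τ).1) zero_le_one
    ((FlowsTo.refl h0).change (mem_chart_self _)) fun τ hτ => ?_
  set q := (Z τ).1 with hq_def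
  have hq : (Z τ).1 ∈ (extChartAt (𝓡 2) q).source := mem_chart_self _
  set S := spray (metricInChart g q) with hS
  obtain ⟨K, U, hU, hK⟩ := exists_lipschitz_spray g (st_mem hq)
  obtain ⟨r, hr, ε, hε, Φ', L', hΦ'⟩ := exists_local_flow
    (((isCoordMetric_metricInChart g q).contDiffAt_spray (st_mem hq)).of_le ENat.LEInfty.out)
    (Ω := U ∩ Prod.fst ⁻¹' (extChartAt (𝓡 2) q).target)
    (inter_mem hU (((isOpen_extChartAt_target q).preimage continuous_fst).mem_nhds (st_mem hq)))
  have hcont := (hZ.deriv τ hτ q hq).continuousWithinAt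
  obtain ⟨δ, hδ, H⟩ := exists_delta_of_eventually_nhdsWithin
    ((eventually_mem_source (hZ.cont τ hτ) hq).and ((hcont.eventually hU).and
      (hcont.eventually (ball_mem_nhds _ hr))))
  refine ⟨min δ (ε / 2), lt_min hδ (by linarith), fun s hs s' hs' hsδ hs'δ hss' hP => ?_⟩
  have hd1 : ∀ {x}, |x - τ| < min δ (ε / 2) → |x - τ| < δ := fun h => h.trans_le (min_le_left _ _)
  have hsε : s' - s ≤ ε := by
    have h1 := abs_lt.1 (hsδ.trans_le (min_le_right _ _))
    have h2 := abs_lt.1 (hs'δ.trans_le (min_le_right _ _))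
    linarith
  have hmem : ∀ x ∈ Icc s s', x ∈ Icc (0 : ℝ) 1 ∧ |x - τ| < δ := fun x hx =>
    ⟨⟨hs.1.trans hx.1, hx.2.trans hs'.2⟩, by
      have h1 := hd1 hsδ
      have h2 := hd1 hs'δ
      rw [abs_lt] at *; exact ⟨by linarith [hx.1], by linarith [hx.2]⟩⟩
  have hsub : Icc s s' ⊆ Icc (0 : ℝ) 1 := fun x hx => (hmem x hx).1
  have hshift : MapsTo (fun t => t - s) (Icc s s') (Icc 0 ε) := fun t ht =>
    ⟨by linarith [ht.1], by linarith [ht.2]⟩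
  have hsS := left_mem_Icc.2 hss'
  have hsS' := right_mem_Icc.2 hss'
  have hsrc : ∀ x ∈ Icc s s', (Z x).1 ∈ (extChartAt (𝓡 2) q).source := fun x hx =>
    (H x (hmem x hx).1 (hmem x hx).2).1
  have hball : st q (Z s) ∈ ball (st q (Z τ)) r := (H s hs (hd1 hsδ)).2.2
  -- on `[s, s']` the local flow is a flow in the coordinates of the chart around `q`
  have hder : ∀ z ∈ ball (st q (Z τ)) r, ∀ t ∈ Icc s s',
      HasDerivWithinAt (fun t => Φ' z (t - s)) (S (Φ' z (t - s))) (Icc s s') t ∧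
      HasDerivWithinAt (fun t => L' z (t - s))
        ((fderiv ℝ S (Φ' z (t - s))).comp (L' z (t - s))) (Icc s s') t := by
    intro z hz t ht
    have hsh : HasDerivWithinAt (fun t : ℝ => t - s) 1 (Icc s s') t :=
      ((hasDerivAt_id t).sub_const s).hasDerivWithinAt
    have hh := (hΦ' z hz).2.2 (t - s) (hshift ht)
    exact ⟨by simpa using! hh.2.1.scomp t hsh hshift, by simpa using! hh.2.2.1.scomp t hsh hshift⟩
  have hZflow : ∀ t ∈ Icc s s', st q (Z t) = Φ' (st q (Z s)) (t - s) := by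
    intro t ht
    exact ode_unique_Icc (v := fun _ => S) (U := fun _ => U) (f := fun t => st q (Z t))
      (g := fun t => Φ' (st q (Z s)) (t - s)) (fun _ _ => hK)
      (fun x hx => (hZ.deriv x (hsub hx) q (hsrc x hx)).mono hsub)
      (fun x hx => (H x (hmem x hx).1 (hmem x hx).2).2.1)
      (fun x hx => (hder _ hball x hx).1)
      (fun x hx => ((hΦ' _ hball).2.2 _ (hshift hx)).1.1)
      (by simp [(hΦ' _ hball).1]) ht
  obtain ⟨W, hW, Φ, L, h1, h2, h3, h4⟩ := hP.change (hsrc s hsS)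
  have hW' : ∀ᶠ z in 𝓝 (st p₀ (Z 0)), st q (Φ z s) ∈ ball (st q (Z τ)) r := by
    refine h3.continuousAt.eventually (isOpen_ball.mem_nhds ?_)
    show st q (Φ (st p₀ (Z 0)) s) ∈ _
    rw [h2]; exact hball
  have hunion : Icc 0 s ∪ Icc s s' = Icc (0 : ℝ) s' := Icc_union_Icc_eq_Icc hs.1 hss'
  -- the continued geodesics
  have hglue : ∀ z, ∃ k : ℝ → N × E2, z ∈ W → st q (Φ z s) ∈ ball (st q (Z τ)) r →
      EqOn k (Φ z) (Icc 0 s) ∧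
        EqOn k (fun t => stInv q (Φ' (st q (Φ z s)) (t - s))) (Icc s s') := by
    intro z
    by_cases hz : z ∈ W ∧ st q (Φ z s) ∈ ball (st q (Z τ)) r
    · obtain ⟨k, hk⟩ := exists_glue (f := Φ z)
        (h := fun t => stInv q (Φ' (st q (Φ z s)) (t - s))) (a := 0) (m := s) (b := s') (by
          simp only [sub_self]
          rw [(hΦ' _ hz.2).1, stInv_st (h1 z hz.1).2.2.2])
      exact ⟨k, fun _ _ => hk⟩
    · exact ⟨fun _ => stInv q z, fun h h' => absurd ⟨h, h'⟩ hz⟩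
  choose Ψ hΨ using hglue
  have hst : ∀ z ∈ W ∩ {z | st q (Φ z s) ∈ ball (st q (Z τ)) r},
      Ψ z s' = stInv q (Φ' (st q (Φ z s)) (s' - s)) ∧
        (Φ' (st q (Φ z s)) (s' - s)).1 ∈ (extChartAt (𝓡 2) q).target := fun z hz =>
    ⟨(hΨ z hz.1 hz.2).2 hsS', ((hΦ' _ hz.2).2.2 _ (hshift hsS')).1.2⟩
  have hs'src := hsrc s' hsS'
  refine FlowsTo.change (p := q) ?_ (mem_chart_self _)
  have hz₀ : st p₀ (Z 0) ∈ W ∩ {z | st q (Φ z s) ∈ ball (st q (Z τ)) r} :=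
    mem_of_mem_nhds (inter_mem hW hW')
  refine ⟨_, inter_mem hW hW', Ψ, (L' (st q (Z s)) (s' - s)).comp L, fun z hz =>
    ⟨(h1 z hz.1).1, ?_, ?_, ?_⟩, ?_, ?_, fun ζ => ?_⟩
  · rw [← hunion]
    refine IsGeo.union ((h1 z hz.1).2.1.congr (hΨ z hz.1 hz.2).1) (IsGeo.congr ?_
      (hΨ z hz.1 hz.2).2) isClosed_Icc isClosed_Icc
    exact isGeo_of_coordinates (fun t ht => ((hΦ' _ hz.2).2.2 _ (hshift ht)).1.2)
      (fun t ht => (hder _ hz.2 t ht).1)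
  · rw [(hΨ z hz.1 hz.2).1 ⟨le_rfl, hs.1⟩]
    exact (h1 z hz.1).2.2.1
  · rw [(hst z hz).1]
    exact stInv_mem (hst z hz).2
  · rw [(hst _ hz₀).1, h2, ← hZflow s' hsS', stInv_st hs'src]
  · have hL := ((hΦ' _ hball).2.2 _ (hshift hsS')).2.2.2
    have hL' : HasFDerivAt (fun z => Φ' z (s' - s)) (L' (st q (Z s)) (s' - s))
        (st q (Φ (st p₀ (Z 0)) s)) := by
      rw [h2]; exact hL
    refine (HasFDerivAt.comp (f := fun z => st q (Φ z s)) (st p₀ (Z 0)) hL'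
      h3).congr_of_eventuallyEq ?_
    filter_upwards [inter_mem hW hW'] with z hz
    rw [(hst z hz).1, st_stInv (hst z hz).2]
    rfl
  · obtain ⟨X, hX, hX0, hX1⟩ := h4 ζ
    have hjac : IsJac g Z (fun t => jstInv g q (st q (Z t)) (L' (st q (Z s)) (t - s) (L ζ)))
        (Icc s s') := by
      refine isJac_of_coordinates (hZ.mono hsub) hsrc fun t ht => ?_
      have := (hder _ hball t ht).2.clm_apply (hasDerivWithinAt_const t (Icc s s') (L ζ))
      rw [hZflow t ht]
      simpa using this
    have hval : ∀ t ∈ Icc s s', jst g q (Z t) (jstInv g q (st q (Z t))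
        (L' (st q (Z s)) (t - s) (L ζ))) = L' (st q (Z s)) (t - s) (L ζ) := by
      intro t ht
      have := jst_jstInv g (p := q) (z := st q (Z t)) (L' (st q (Z s)) (t - s) (L ζ))
        (st_mem (hsrc t ht))
      rwa [stInv_st (hsrc t ht)] at this
    obtain ⟨Y, hY1, hY2⟩ := exists_glue (f := X)
      (h := fun t => jstInv g q (st q (Z t)) (L' (st q (Z s)) (t - s) (L ζ)))
      (a := 0) (m := s) (b := s') (by
        refine jst_injective g (hsrc s hsS) ?_
        rw [hX1, hval s hsS, sub_self, (hΦ' _ hball).2.1]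
        rfl)
    refine ⟨Y, ?_, by rw [hY1 ⟨le_rfl, hs.1⟩, hX0], ?_⟩
    · rw [← hunion]
      exact (hX.congr (fun _ _ => rfl) hY1).union (hjac.congr (fun _ _ => rfl) hY2)
        isClosed_Icc isClosed_Icc
    · rw [hY2 hsS', hval s' hsS']
      rfl

end Flow

/-! ### Velocity and covariant derivative in a chart -/

section CurvesInCharts

variable {g : Metric N} {c : ℝ → N} {V J : ℝ → E2} {s : Set ℝ} {t : ℝ} {p : N}

theorem hasDerivWithinAt_chart_comp (hc : MDifferentiableWithinAt 𝓘(ℝ, ℝ) (𝓡 2) c s t)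
    (hp : c t ∈ (extChartAt (𝓡 2) p).source) :
    HasDerivWithinAt (fun τ => extChartAt (𝓡 2) p (c τ)) (dchart p (c t) (velocity c s t)) s t := by
  have h := (hasMFDerivAt_chart hp).comp_hasMFDerivWithinAt t hc.hasMFDerivWithinAt
  let A : ℝ →L[ℝ] E2 := mfderivWithin 𝓘(ℝ, ℝ) (𝓡 2) c s t
  have h' : HasFDerivWithinAt (fun τ => extChartAt (𝓡 2) p (c τ)) ((dchart p (c t)).comp A) s t :=
    hasMFDerivWithinAt_iff_hasFDerivWithinAt.1 h
  exact h'.hasDerivWithinAt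

theorem hasMFDerivWithinAt_of_chart {E : Type*} [NormedAddCommGroup E] [NormedSpace ℝ E]
    {f : E → N} {A : E →L[ℝ] E2} {s : Set E} {a : E}
    (hc : ContinuousWithinAt f s a) (hp : f a ∈ (extChartAt (𝓡 2) p).source)
    (h : HasFDerivWithinAt (fun b => extChartAt (𝓡 2) p (f b)) A s a) :
    HasMFDerivWithinAt 𝓘(ℝ, E) (𝓡 2) f s a
      ((dchartSymm p (extChartAt (𝓡 2) p (f a))).comp A) := by
  have h1 : HasMFDerivAt 𝓘(ℝ, E2) (𝓡 2) (extChartAt (𝓡 2) p).symm (extChartAt (𝓡 2) p (f a))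
      (dchartSymm p (extChartAt (𝓡 2) p (f a))) :=
    ((contMDiffAt_chart_symm ((extChartAt (𝓡 2) p).map_source hp)).mdifferentiableAt
      (by simp)).hasMFDerivAt
  have h2 := HasMFDerivAt.comp_hasMFDerivWithinAt (f := fun b => extChartAt (𝓡 2) p (f b)) a h1
    h.hasMFDerivWithinAt
  refine h2.congr_of_eventuallyEq ?_ ((extChartAt (𝓡 2) p).left_inv hp).symm
  filter_upwards [hc.eventually ((isOpen_extChartAt_source p).mem_nhds hp)] with b hb
    using ((extChartAt (𝓡 2) p).left_inv hb).symm

theorem velocity_of_chart {v : E2} (hc : ContinuousWithinAt c s t)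
    (hp : c t ∈ (extChartAt (𝓡 2) p).source) (hs : UniqueDiffWithinAt ℝ s t)
    (h : HasDerivWithinAt (fun τ => extChartAt (𝓡 2) p (c τ)) v s t) :
    velocity c s t = dchartSymm p (extChartAt (𝓡 2) p (c t)) v := by
  have h1 := (hasMFDerivWithinAt_of_chart hc hp h.hasFDerivWithinAt).mfderivWithin
    hs.uniqueMDiffWithinAt
  have h2 := congrArg (fun A : ℝ →L[ℝ] E2 => A 1) h1
  exact h2.trans (congrArg (dchartSymm p (extChartAt (𝓡 2) p (c t))) (one_smul ℝ v))

/-- The covariant derivative can be computed in any chart. -/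
theorem dchart_covDeriv {X : ℝ → E2} {v x' : E2} (hc : ContinuousWithinAt c s t)
    (hp : c t ∈ (extChartAt (𝓡 2) p).source) (hs : UniqueDiffWithinAt ℝ s t)
    (hu : HasDerivWithinAt (fun τ => extChartAt (𝓡 2) p (c τ)) v s t)
    (hx : HasDerivWithinAt (fun τ => dchart p (c τ) (X τ)) x' s t) :
    dchart p (c t) (covDeriv g c s X t)
      = x' + christoffelL (metricInChart g p) (extChartAt (𝓡 2) p (c t)) v
        (dchart p (c t) (X t)) := by
  set q := c t with hq_def
  have hq : c t ∈ (extChartAt (𝓡 2) q).source := mem_chart_self _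
  have hch := isCoordChange_chartChange g p q
  have hov := chart_mem_overlap hp hq
  obtain ⟨w, hw⟩ := dchart_surjective hp (x' + christoffelL (metricInChart g p)
    (extChartAt (𝓡 2) p (c t)) v (dchart p (c t) (X t)))
  have hT := (hch.hasFDerivAt_tangentChange (z := (extChartAt (𝓡 2) p (c t),
    dchart p (c t) (X t))) hov).comp_hasDerivWithinAt_of_eq t (hu.prodMk hx) rfl
  rw [hch.fderiv_tangentChange hov] at hT
  have hev : ∀ᶠ τ in 𝓝[s] t, (fun τ => st q (c τ, X τ)) τ = (tangentChange (chartChange p q) ∘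
      fun τ => (extChartAt (𝓡 2) p (c τ), dchart p (c τ) (X τ))) τ := by
    filter_upwards [hc.eventually ((isOpen_extChartAt_source p).mem_nhds hp),
      hc.eventually ((isOpen_extChartAt_source q).mem_nhds hq)] with τ h1 h2
    exact st_change (Z := (c τ, X τ)) h1 h2
  have hT' := hT.congr_of_eventuallyEq hev (st_change (Z := (c t, X t)) hp hq)
  have e1 := ((hasFDerivAt_fst (𝕜 := ℝ) (p := st q (c t, X t))).comp_hasDerivWithinAt t
    hT').derivWithin hs
  have e2 := ((hasFDerivAt_snd (𝕜 := ℝ) (p := st q (c t, X t))).comp_hasDerivWithinAt t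
    hT').derivWithin hs
  have hcov : covDeriv g c s X t = (dchart q (c t)).inverse
      (derivWithin (Prod.snd ∘ fun τ => st q (c τ, X τ)) s t
        + christoffelL (metricInChart g q) (extChartAt (𝓡 2) q (c t))
          (derivWithin (Prod.fst ∘ fun τ => st q (c τ, X τ)) s t) (dchart q (c t) (X t))) := rfl
  have hid : ∀ v : E2, dchart q (c t) v = v := fun v => by
    rw [hq_def, dchart_self]; rfl
  have hinv : ∀ v : E2, (dchart q (c t)).inverse v = v := fun v => by
    have := dchart_inverse_apply hq v
    rwa [hid] at this
  rw [hinv, e1, e2, dchart_change hp hq, ← chartChange_chart (q := q) hp] at hcov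
  simp only [ContinuousLinearMap.coe_fst', ContinuousLinearMap.coe_snd'] at hcov
  have hΓ := hch.fderiv_christoffelL hov v (dchart p (c t) (X t))
  have hw' := dchart_change hp hq w
  rw [hid, hw, map_add, hΓ] at hw'
  rw [← hw]
  congr 1
  rw [hcov, hw']
  abel

theorem IsGeo.velocity_eq (h : IsGeo g (fun τ => (c τ, V τ)) s) (ht : t ∈ s)
    (hs : UniqueDiffWithinAt ℝ s t) : velocity c s t = V t := by
  have hp := mem_chart_self (c t)
  have h1 := (hasFDerivAt_fst (𝕜 := ℝ) (p := st (c t) (c t, V t))).comp_hasDerivWithinAt t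
    (h.deriv t ht (c t) hp)
  rw [velocity_of_chart (h.cont t ht) hp hs h1]
  exact dchartSymm_dchart hp _

theorem IsJac.covDeriv_eq {X : ℝ → E2 × E2} (hZ : IsGeo g (fun τ => (c τ, V τ)) s)
    (h : IsJac g (fun τ => (c τ, V τ)) X s) (ht : t ∈ s) (hs : UniqueDiffWithinAt ℝ s t) :
    covDeriv g c s (fun τ => (X τ).1) t = (X t).2 := by
  have hp := mem_chart_self (c t)
  have hG := isCoordMetric_metricInChart g (c t)
  have h1 := (hasFDerivAt_fst (𝕜 := ℝ) (p := st (c t) (c t, V t))).comp_hasDerivWithinAt t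
    (hZ.deriv t ht (c t) hp)
  have h2 := (hasFDerivAt_fst (𝕜 := ℝ) (p := jst g (c t) (c t, V t) (X t))).comp_hasDerivWithinAt t
    (h t ht (c t) hp)
  rw [hG.fderiv_spray (st_mem hp)] at h2
  refine dchart_injective hp ?_
  refine (dchart_covDeriv (g := g) (X := fun τ => (X τ).1) (hZ.cont t ht) hp hs h1 h2).trans ?_
  simp [jst, spray, st]

end CurvesInCharts

/-! ### Geodesics and Jacobi fields in terms of the covariant derivative -/

section Regularity

theorem two_add_one_le : (2 : WithTop ℕ∞) + 1 ≤ ∞ := by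
  have : (3 : WithTop ℕ∞) ≤ ∞ := ENat.LEInfty.out
  norm_num
  exact this

/-- Solutions of an autonomous differential equation are as smooth as the vector field allows. -/
theorem contDiffOn_of_hasDerivWithinAt {F : Type*} [NormedAddCommGroup F] [NormedSpace ℝ F]
    {S : F → F} {z : ℝ → F} {s : Set ℝ} (hs : UniqueDiffOn ℝ s)
    (hS : ∀ t ∈ s, ContDiffAt ℝ ∞ S (z t)) (hz : ∀ t ∈ s, HasDerivWithinAt z (S (z t)) s t)
    (n : ℕ) : ContDiffOn ℝ n z s := by
  induction n with
  | zero =>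
    exact contDiffOn_zero.2 fun t ht => (hz t ht).continuousWithinAt
  | succ n ih =>
    push_cast
    rw [contDiffOn_succ_iff_derivWithin hs]
    refine ⟨fun t ht => (hz t ht).differentiableWithinAt, by simp, ?_⟩
    have h : ContDiffOn ℝ n (fun t => S (z t)) s := fun t ht =>
      ContDiffAt.comp_contDiffWithinAt t ((hS t ht).of_le (by exact_mod_cast le_top)) (ih t ht)
    exact h.congr fun t ht => (hz t ht).derivWithin (hs t ht)

variable {g : Metric N} {c : ℝ → N} {V J : ℝ → E2} {s : Set ℝ} {t : ℝ} {p : N}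

theorem contDiffWithinAt_chart_comp {n : WithTop ℕ∞} (hn : n ≤ ∞)
    (hc : ContMDiffWithinAt 𝓘(ℝ, ℝ) (𝓡 2) n c s t) (hp : c t ∈ (extChartAt (𝓡 2) p).source) :
    ContDiffWithinAt ℝ n (fun τ => extChartAt (𝓡 2) p (c τ)) s t := by
  rw [← contMDiffWithinAt_iff_contDiffWithinAt]
  exact ((contMDiffAt_extChartAt' (n := ∞) (by rwa [← extChartAt_source (I := 𝓡 2)])).of_le
    hn).comp_contMDiffWithinAt t hc

theorem contMDiffWithinAt_of_chart {n : WithTop ℕ∞} (hn : n ≤ ∞) (hc : ContinuousWithinAt c s t)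
    (hp : c t ∈ (extChartAt (𝓡 2) p).source)
    (h : ContDiffWithinAt ℝ n (fun τ => extChartAt (𝓡 2) p (c τ)) s t) :
    ContMDiffWithinAt 𝓘(ℝ, ℝ) (𝓡 2) n c s t := by
  have h1 := ((contMDiffAt_chart_symm ((extChartAt (𝓡 2) p).map_source hp)).of_le
    hn).comp_contMDiffWithinAt t h.contMDiffWithinAt
  refine h1.congr_of_eventuallyEq ?_ ((extChartAt (𝓡 2) p).left_inv hp).symm
  filter_upwards [hc.eventually ((isOpen_extChartAt_source p).mem_nhds hp)] with b hb
    using ((extChartAt (𝓡 2) p).left_inv hb).symm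

theorem hasDerivWithinAt_derivWithin_of_contDiffWithinAt {F : Type*} [NormedAddCommGroup F]
    [NormedSpace ℝ F] {f : ℝ → F} (hs : UniqueDiffOn ℝ s) (ht : t ∈ s)
    (h : ContDiffWithinAt ℝ 2 f s t) :
    HasDerivWithinAt (derivWithin f s) (derivWithin (derivWithin f s) s t) s t := by
  have h1 : ContDiffWithinAt ℝ 1 (fderivWithin ℝ f s) s t :=
    h.fderivWithin_right hs (by norm_num) ht
  have h2 := (h1.clm_apply (contDiffWithinAt_const (c := (1 : ℝ)))).differentiableWithinAt
    (by simp)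
  exact h2.hasDerivWithinAt

/-- A piece of `s` around `t` on which the curve stays in one chart. -/
theorem exists_isOpen_mapsTo_source (hc : ContinuousWithinAt c s t)
    (hp : c t ∈ (extChartAt (𝓡 2) p).source) :
    ∃ O, IsOpen O ∧ t ∈ O ∧ ∀ τ ∈ s ∩ O, c τ ∈ (extChartAt (𝓡 2) p).source := by
  have h := hc.eventually ((isOpen_extChartAt_source p).mem_nhds hp)
  obtain ⟨O, hO, htO, H⟩ := mem_nhdsWithin.1 h
  exact ⟨O, hO, htO, fun τ hτ => H ⟨hτ.2, hτ.1⟩⟩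

/-- Geodesics in the sense of the covariant derivative are the projections of integral curves of the
geodesic spray. -/
theorem IsGeodesicOn.isGeo (hs : UniqueDiffOn ℝ s) (h : IsGeodesicOn g c s) :
    IsGeo g (fun t => (c t, velocity c s t)) s := by
  refine IsGeo.of_chart (fun t ht => (h.1 t ht).continuousWithinAt) fun t ht =>
    ⟨c t, mem_chart_self _, ?_⟩
  have hp := mem_chart_self (c t)
  have hder : ∀ τ ∈ s, c τ ∈ (extChartAt (𝓡 2) (c t)).source →
      HasDerivWithinAt (fun τ => extChartAt (𝓡 2) (c t) (c τ))
        (dchart (c t) (c τ) (velocity c s τ)) s τ := fun τ hτ hpτ =>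
    hasDerivWithinAt_chart_comp ((h.1 τ hτ).mdifferentiableWithinAt (by simp)) hpτ
  have hev : ∀ᶠ τ in 𝓝[s] t, dchart (c t) (c τ) (velocity c s τ)
      = derivWithin (fun τ => extChartAt (𝓡 2) (c t) (c τ)) s τ := by
    filter_upwards [(h.1 t ht).continuousWithinAt.eventually
      ((isOpen_extChartAt_source (c t)).mem_nhds hp), self_mem_nhdsWithin] with τ h1 h2
    exact ((hder τ h2 h1).derivWithin (hs τ h2)).symm
  have hx := (hasDerivWithinAt_derivWithin_of_contDiffWithinAt hs ht
    (contDiffWithinAt_chart_comp ENat.LEInfty.out (h.1 t ht) hp)).congr_of_eventuallyEq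
      hev ((hder t ht hp).derivWithin (hs t ht)).symm
  have key := dchart_covDeriv (g := g) (h.1 t ht).continuousWithinAt hp (hs t ht) (hder t ht hp) hx
  rw [h.2 t ht] at key
  have key' : derivWithin (derivWithin (fun τ => extChartAt (𝓡 2) (c t) (c τ)) s) s t
      = -christoffelL (metricInChart g (c t)) (extChartAt (𝓡 2) (c t) (c t))
        (dchart (c t) (c t) (velocity c s t)) (dchart (c t) (c t) (velocity c s t)) := by
    rw [eq_neg_iff_add_eq_zero, ← key]
    exact map_zero (dchart (c t) (c t))
  rw [key'] at hx
  exact (hder t ht hp).prodMk hx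

theorem IsGeo.contDiffOn_st (hs : UniqueDiffOn ℝ s) (h : IsGeo g (fun t => (c t, V t)) s)
    (hp : ∀ t ∈ s, c t ∈ (extChartAt (𝓡 2) p).source) (n : ℕ) :
    ContDiffOn ℝ n (fun t => st p (c t, V t)) s :=
  contDiffOn_of_hasDerivWithinAt hs (fun t ht =>
    (isCoordMetric_metricInChart g p).contDiffAt_spray (st_mem (Z := (c t, V t)) (hp t ht)))
    (fun t ht => h.deriv t ht p (hp t ht)) n

theorem IsGeo.isGeodesicOn (hs : UniqueDiffOn ℝ s) (h : IsGeo g (fun t => (c t, V t)) s) :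
    IsGeodesicOn g c s := by
  refine ⟨fun t ht => ?_, fun t ht => ?_⟩
  · obtain ⟨O, hO, htO, hOs⟩ := exists_isOpen_mapsTo_source (h.cont t ht) (mem_chart_self (c t))
    have h1 := (h.mono inter_subset_left).contDiffOn_st (hs.inter hO) hOs 2 t ⟨ht, htO⟩
    have h2 := (contDiffWithinAt_inter (hO.mem_nhds htO)).1 h1
    exact contMDiffWithinAt_of_chart ENat.LEInfty.out (h.cont t ht) (mem_chart_self _)
      (contDiff_fst.comp_contDiffWithinAt h2)
  · have hp := mem_chart_self (c t)
    have h1 := (hasFDerivAt_fst (𝕜 := ℝ) (p := st (c t) (c t, V t))).comp_hasDerivWithinAt t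
      (h.deriv t ht (c t) hp)
    have h2 := (hasFDerivAt_snd (𝕜 := ℝ) (p := st (c t) (c t, V t))).comp_hasDerivWithinAt t
      (h.deriv t ht (c t) hp)
    have h3 : HasDerivWithinAt (fun τ => dchart (c t) (c τ) (velocity c s τ)) _ s t :=
      h2.congr (fun τ hτ => by rw [h.velocity_eq hτ (hs τ hτ)]; rfl)
        (by rw [h.velocity_eq ht (hs t ht)]; rfl)
    refine dchart_injective hp ?_
    refine (dchart_covDeriv (g := g) (h.cont t ht) hp (hs t ht) h1 h3).trans ?_
    rw [h.velocity_eq ht (hs t ht)]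
    simp [spray, st]
    exact (map_zero (dchart (c t) (c t))).symm

/-- The Jacobi operator in terms of the linearized geodesic equation. -/
theorem covDeriv_add_curvature {K : ℝ → E2} {ζ' : E2 × E2} (hs : UniqueDiffWithinAt ℝ s t)
    (ht : t ∈ s) (h : IsGeo g (fun t => (c t, V t)) s)
    (hζ : HasDerivWithinAt (fun τ => jst g (c t) (c τ, V τ) (J τ, K τ)) ζ' s t)
    (hζ' : ζ'.1 = (jst g (c t) (c t, V t) (J t, K t)).2) :
    covDeriv g c s K t + curvature g (c t) (J t) (V t) (V t)
      = ζ'.2 - (fderiv ℝ (spray (metricInChart g (c t))) (st (c t) (c t, V t))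
        (jst g (c t) (c t, V t) (J t, K t))).2 := by
  have hp := mem_chart_self (c t)
  set p := c t with hp_def
  have hG := isCoordMetric_metricInChart g p
  have hz := h.deriv t ht p hp
  have hm : (st p (c t, V t)).1 ∈ (extChartAt (𝓡 2) p).target := st_mem (Z := (c t, V t)) hp
  have hu := (hasFDerivAt_fst (𝕜 := ℝ) (p := st p (c t, V t))).comp_hasDerivWithinAt t hz
  have hv := (hasFDerivAt_snd (𝕜 := ℝ) (p := st p (c t, V t))).comp_hasDerivWithinAt t hz
  have hx := (hasFDerivAt_fst (𝕜 := ℝ)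
    (p := jst g p (c t, V t) (J t, K t))).comp_hasDerivWithinAt t hζ
  have hy := (hasFDerivAt_snd (𝕜 := ℝ)
    (p := jst g p (c t, V t) (J t, K t))).comp_hasDerivWithinAt t hζ
  have hΓ := ((hG.contDiffAt_christoffelL hm).differentiableAt
    (by simp)).hasFDerivAt.comp_hasDerivWithinAt t hu
  have hk := hy.add ((hΓ.clm_apply hv).clm_apply hx)
  have hk' : HasDerivWithinAt (fun τ => dchart p (c τ) (K τ)) _ s t :=
    hk.congr (fun τ _ => (covPart_jst g p (c τ, V τ) (J τ, K τ)).symm)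
      (covPart_jst g p (c t, V t) (J t, K t)).symm
  have key := dchart_covDeriv (g := g) (h.cont t ht) hp hs hu hk'
  have hid : ∀ v : E2, dchart p (c t) v = v := fun v => by rw [hp_def, dchart_self]; rfl
  have hinv : ∀ v : E2, (dchart p (c t)).inverse v = v := fun v => by
    have := dchart_inverse_apply hp v
    rwa [hid] at this
  have key' : covDeriv g c s K t = _ := (hid _).symm.trans key
  have hcurv : curvature g (c t) (J t) (V t) (V t) = (dchart p (c t)).inverse
      (curvatureCoord (metricInChart g p) (st p (c t, V t)).1 (dchart p (c t) (J t))
        (dchart p (c t) (V t)) (dchart p (c t) (V t))) := rfl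
  rw [hcurv, hinv]
  refine (congrArg₂ (· + ·) key' rfl).trans ?_
  rw [← hG.covPart_deriv_add_curvature hm]
  have e := covPart_jst g p (c t, V t) (J t, K t)
  simp only [ContinuousLinearMap.coe_fst', ContinuousLinearMap.coe_snd', hζ', add_apply,
    Function.comp_apply]
  rw [← e]
  simp only [spray, st, jst, covPart]
  abel

theorem IsJac.isJacobiFieldOn {X : ℝ → E2 × E2} (hs : UniqueDiffOn ℝ s)
    (hZ : IsGeo g (fun t => (c t, V t)) s) (h : IsJac g (fun t => (c t, V t)) X s) :
    IsJacobiFieldOn g c s (fun t => (X t).1) := by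
  refine ⟨fun t ht => ?_, fun t ht => ?_⟩
  · have hp := mem_chart_self (c t)
    refine (contMDiffWithinAt_tangent_iff (p := c t) two_add_one_le hp).2
      ⟨(hZ.isGeodesicOn hs).1 t ht, ?_⟩
    obtain ⟨O, hO, htO, hOs⟩ := exists_isOpen_mapsTo_source (hZ.cont t ht) hp
    have hG := isCoordMetric_metricInChart g (c t)
    have hsub : s ∩ O ⊆ s := inter_subset_left
    have h1 := contDiffOn_of_hasDerivWithinAt (hs.inter hO)
      (S := fun w : (E2 × E2) × (E2 × E2) => (spray (metricInChart g (c t)) w.1,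
        fderiv ℝ (spray (metricInChart g (c t))) w.1 w.2))
      (z := fun τ => (st (c t) (c τ, V τ), jst g (c t) (c τ, V τ) (X τ)))
      (fun τ hτ => by
        have hS := hG.contDiffAt_spray (st_mem (Z := (c τ, V τ)) (hOs τ hτ))
        have h1 : ContDiffAt ℝ ∞ (fun w : (E2 × E2) × (E2 × E2) =>
            spray (metricInChart g (c t)) w.1)
            (st (c t) (c τ, V τ), jst g (c t) (c τ, V τ) (X τ)) :=
          ContDiffAt.fst' hS
        have h2 : ContDiffAt ℝ ∞ (fun w : (E2 × E2) × (E2 × E2) =>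
            fderiv ℝ (spray (metricInChart g (c t))) w.1)
            (st (c t) (c τ, V τ), jst g (c t) (c τ, V τ) (X τ)) :=
          ContDiffAt.fst' (hS.fderiv_right (m := ∞) (by simp))
        exact h1.prodMk (h2.clm_apply contDiffAt_snd))
      (fun τ hτ => ((hZ.deriv τ hτ.1 (c t) (hOs τ hτ)).mono hsub).prodMk
        ((h τ hτ.1 (c t) (hOs τ hτ)).mono hsub)) 2 t ⟨ht, htO⟩
    have h2 := (contDiffWithinAt_inter (hO.mem_nhds htO)).1 h1
    exact (contDiff_fst.comp_contDiffWithinAt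
      (contDiff_snd.comp_contDiffWithinAt h2)).contMDiffWithinAt
  · have hcov : ∀ τ ∈ s, covDeriv g c s (fun t => (X t).1) τ = (X τ).2 := fun τ hτ =>
      h.covDeriv_eq hZ hτ (hs τ hτ)
    rw [hZ.velocity_eq ht (hs t ht)]
    have hd := h t ht (c t) (mem_chart_self _)
    have hG := isCoordMetric_metricInChart g (c t)
    have hd' : HasDerivWithinAt (fun τ => jst g (c t) (c τ, V τ) ((X τ).1,
        covDeriv g c s (fun t => (X t).1) τ)) _ s t :=
      hd.congr (fun τ hτ => by rw [hcov τ hτ]) (by rw [hcov t ht])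
    refine (covDeriv_add_curvature (K := fun τ => covDeriv g c s (fun t => (X t).1) τ)
      (hs t ht) ht hZ hd' ?_).trans ?_
    · rw [hG.fderiv_spray (st_mem (Z := (c t, V t)) (mem_chart_self _)), hcov t ht]
    · rw [hcov t ht]
      exact sub_self _

theorem IsJacobiFieldOn.isJac {J : ∀ t, TangentSpace (𝓡 2) (c t)} (hs : UniqueDiffOn ℝ s)
    (hZ : IsGeo g (fun t => (c t, V t)) s) (h : IsJacobiFieldOn g c s J) :
    IsJac g (fun t => (c t, V t)) (fun t => (J t, covDeriv g c s J t)) s := by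
  refine IsJac.of_chart hZ fun t ht => ⟨c t, mem_chart_self _, ?_⟩
  have hp := mem_chart_self (c t)
  set p := c t with hp_def
  have hG := isCoordMetric_metricInChart g p
  have hJ : ∀ τ ∈ s, c τ ∈ (extChartAt (𝓡 2) p).source →
      ContDiffWithinAt ℝ 2 (fun τ => dchart p (c τ) (J τ)) s τ := fun τ hτ hpτ =>
    ((contMDiffWithinAt_tangent_iff (p := p) two_add_one_le hpτ).1
      (h.1 τ hτ)).2.contDiffWithinAt
  set x := fun τ => dchart p (c τ) (J τ) with hx_def
  have hx : ∀ τ ∈ s, c τ ∈ (extChartAt (𝓡 2) p).source →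
      HasDerivWithinAt x (derivWithin x s τ) s τ := fun τ hτ hpτ =>
    ((hJ τ hτ hpτ).differentiableWithinAt (by simp)).hasDerivWithinAt
  have hjst : ∀ τ ∈ s, c τ ∈ (extChartAt (𝓡 2) p).source →
      jst g p (c τ, V τ) (J τ, covDeriv g c s J τ) = (x τ, derivWithin x s τ) := by
    intro τ hτ hpτ
    have hu := (hasFDerivAt_fst (𝕜 := ℝ) (p := st p (c τ, V τ))).comp_hasDerivWithinAt τ
      (hZ.deriv τ hτ p hpτ)
    have := dchart_covDeriv (g := g) (hZ.cont τ hτ) hpτ (hs τ hτ) hu (hx τ hτ hpτ)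
    refine Prod.ext rfl ?_
    refine (congrArg₂ (· - ·) this rfl).trans ?_
    simp [spray, st, hx_def]
  have hd : HasDerivWithinAt (fun τ => jst g p (c τ, V τ) (J τ, covDeriv g c s J τ))
      (derivWithin x s t, derivWithin (derivWithin x s) s t) s t := by
    refine ((hx t ht hp).prodMk (hasDerivWithinAt_derivWithin_of_contDiffWithinAt hs ht
      (hJ t ht hp))).congr_of_eventuallyEq ?_ (hjst t ht hp)
    filter_upwards [(hZ.cont t ht).eventually ((isOpen_extChartAt_source p).mem_nhds hp),
      self_mem_nhdsWithin] with τ h1 h2 using hjst τ h2 h1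
  have h1 : derivWithin x s t = (jst g p (c t, V t) (J t, covDeriv g c s J t)).2 := by
    rw [hjst t ht hp]
  have key := covDeriv_add_curvature (J := J) (K := covDeriv g c s J) (hs t ht) ht hZ hd h1
  have hJac := h.2 t ht
  rw [hZ.velocity_eq ht (hs t ht)] at hJac
  have key' := key.symm.trans hJac
  refine hd.congr_deriv (Prod.ext ?_ (sub_eq_zero.1 key'))
  rw [hG.fderiv_spray (st_mem (Z := (c t, V t)) hp)]
  exact h1

end Regularity

/-! ### The exponential map -/

section Exponential

variable {g : Metric N} {Z : ℝ → N × E2}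

theorem jst_zero_fst (g : Metric N) (x : N) (v w : E2) : jst g x (x, v) (0, w) = (0, w) := by
  simp [jst, dchart_self]

theorem st_self (x : N) (v : E2) : st x (x, v) = (extChartAt (𝓡 2) x x, v) := by
  simp [st, dchart_self]

/-- There is a Jacobi field with any given initial data. -/
theorem IsGeo.exists_isJac (hZ : IsGeo g Z (Icc 0 1)) (X₀ : E2 × E2) :
    ∃ X, IsJac g Z X (Icc 0 1) ∧ X 0 = X₀ := by
  have h0 := mem_chart_self (Z 0).1
  obtain ⟨W, hW, Φ, L, h1, h2, h3, h4⟩ := exists_flow hZ h0 (mem_chart_self (Z 1).1)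
  obtain ⟨X, hX, hX0, -⟩ := h4 (jst g (Z 0).1 (Z 0) X₀)
  exact ⟨X, hX, jst_injective g h0 hX0⟩

theorem IsGeo.isGeodesicFrom (hZ : IsGeo g Z (Icc 0 1)) :
    IsGeodesicFrom g (Z 0).1 (Z 0).2 (fun t => (Z t).1) := by
  have hs : UniqueDiffOn ℝ (Icc (0 : ℝ) 1) := uniqueDiffOn_Icc zero_lt_one
  refine ⟨IsGeo.isGeodesicOn (V := fun t => (Z t).2) hs hZ, ?_⟩
  rw [IsGeo.velocity_eq (V := fun t => (Z t).2) hZ (left_mem_Icc.2 zero_le_one)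
    (hs _ (left_mem_Icc.2 zero_le_one))]

theorem IsGeodesicFrom.isGeo {x : N} {v : TangentSpace (𝓡 2) x} {c : ℝ → N}
    (h : IsGeodesicFrom g x v c) :
    IsGeo g (fun t => (c t, velocity c (Icc 0 1) t)) (Icc 0 1) ∧
      ((c 0, velocity c (Icc 0 1) 0) : N × E2) = (x, v) := by
  refine ⟨h.1.isGeo (uniqueDiffOn_Icc zero_lt_one), ?_⟩
  exact congrArg (fun w : TangentBundle (𝓡 2) N => ((w.1, w.2) : N × E2)) h.2

theorem exists_isGeo_of_mem_expDomain {x : N} {v : TangentSpace (𝓡 2) x}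
    (h : v ∈ expDomain g x) : ∃ Z, IsGeo g Z (Icc 0 1) ∧ Z 0 = (x, v) := by
  obtain ⟨c, hc⟩ := h
  exact ⟨_, hc.isGeo.1, hc.isGeo.2⟩

theorem IsGeo.expMap_eq [T2Space N] (hZ : IsGeo g Z (Icc 0 1)) {x : N} {v : E2}
    (h0 : Z 0 = (x, v)) : expMap g x v = (Z 1).1 := by
  have hex : ∃ c, IsGeodesicFrom g x v c := by
    have := hZ.isGeodesicFrom
    rw [h0] at this
    exact ⟨_, this⟩
  have h1 := (hex.choose_spec).isGeo
  have h2 := h1.1.eq_of_eq hZ (h1.2.trans h0.symm) (right_mem_Icc.2 zero_le_one)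
  have h3 : expMap g x v = hex.choose 1 := dif_pos hex
  exact h3.trans (congrArg Prod.fst h2)

/-- The exponential map as a function of the coordinates of a tangent vector is differentiable, and
its derivative is given by the end values of Jacobi fields. -/
theorem IsGeo.hasMFDerivAt_expMap [T2Space N] (hZ : IsGeo g Z (Icc 0 1)) {p₀ : N}
    {Z₀ : N × E2} (hZ₀ : Z 0 = Z₀) (h0 : Z₀.1 ∈ (extChartAt (𝓡 2) p₀).source) :
    ∃ A : E2 × E2 →L[ℝ] E2, HasMFDerivAt 𝓘(ℝ, E2 × E2) (𝓡 2)
      (fun z => expMap g (stInv p₀ z).1 (stInv p₀ z).2) (st p₀ Z₀) A ∧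
    ∀ ζ, ∃ X, IsJac g Z X (Icc 0 1) ∧ jst g p₀ Z₀ (X 0) = ζ ∧ A ζ = (X 1).1 := by
  subst hZ₀
  have hp := mem_chart_self (Z 1).1
  obtain ⟨W, hW, Φ, L, h1, h2, h3, h4⟩ := exists_flow hZ h0 hp
  set p := (Z 1).1 with hp_def
  have hexp : ∀ z ∈ W, expMap g (stInv p₀ z).1 (stInv p₀ z).2 = (Φ z 1).1 := fun z hz =>
    (h1 z hz).2.1.expMap_eq (h1 z hz).2.2.1
  have hz₀ : (Φ (st p₀ (Z 0)) 1).1 = (Z 1).1 := by rw [h2]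
  have hf : HasFDerivAt (fun z => extChartAt (𝓡 2) p (Φ z 1).1)
      ((ContinuousLinearMap.fst ℝ E2 E2).comp L) (st p₀ (Z 0)) :=
    HasFDerivAt.comp (g := Prod.fst) (g' := ContinuousLinearMap.fst ℝ E2 E2)
      (f := fun z => st p (Φ z 1)) (st p₀ (Z 0)) hasFDerivAt_fst h3
  have hc : ContinuousAt (fun z => (Φ z 1).1) (st p₀ (Z 0)) := by
    have hc1 : ContinuousAt (extChartAt (𝓡 2) p).symm
        (extChartAt (𝓡 2) p (Φ (st p₀ (Z 0)) 1).1) := by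
      rw [hz₀]
      exact continuousAt_extChartAt_symm p
    refine (ContinuousAt.comp (f := fun z => extChartAt (𝓡 2) p (Φ z 1).1) hc1
      hf.continuousAt).congr ?_
    filter_upwards [hW] with z hz using (extChartAt (𝓡 2) p).left_inv (h1 z hz).2.2.2
  have hm := hasMFDerivWithinAt_of_chart (s := univ) hc.continuousWithinAt
    (p := p) (by rw [hz₀]; exact hp) hf.hasFDerivWithinAt
  refine ⟨_, (hm.hasMFDerivAt univ_mem).congr_of_eventuallyEq ?_, fun ζ => ?_⟩
  · filter_upwards [hW] with z hz using hexp z hz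
  · obtain ⟨X, hX, hX0, hX1⟩ := h4 ζ
    refine ⟨X, hX, hX0, ?_⟩
    show dchartSymm p (extChartAt (𝓡 2) p (Φ (st p₀ (Z 0)) 1).1) (L ζ).1 = _
    rw [hz₀, ← hX1]
    exact dchartSymm_dchart hp _

/-- The differential of the exponential map at a fixed point. -/
theorem IsGeo.mfderiv_expMap [T2Space N] (hZ : IsGeo g Z (Icc 0 1)) {x : N} {v : E2}
    (h0 : Z 0 = (x, v)) (w : E2) :
    ∃ X, IsJac g Z X (Icc 0 1) ∧ X 0 = (0, w) ∧
      mfderiv 𝓘(ℝ, E2) (𝓡 2) (fun v : E2 => expMap g x v) v w = (X 1).1 := by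
  have hsrc : (Z 0).1 ∈ (extChartAt (𝓡 2) x).source := by rw [h0]; exact mem_chart_self x
  obtain ⟨A, hA, hJ⟩ := hZ.hasMFDerivAt_expMap h0 (mem_chart_self x)
  rw [st_self] at hA
  have hinc : HasFDerivAt (fun v : E2 => (extChartAt (𝓡 2) x x, v))
      (ContinuousLinearMap.inr ℝ E2 E2) v := hasFDerivAt_prodMk_right _ v
  have hcomp := HasMFDerivAt.comp (f := fun v : E2 => (extChartAt (𝓡 2) x x, v)) v hA
    hinc.hasMFDerivAt
  have hfun : (fun z => expMap g (stInv x z).1 (stInv x z).2) ∘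
      (fun v : E2 => (extChartAt (𝓡 2) x x, v)) = fun v : E2 => expMap g x v := by
    funext v
    have := stInv_st (p := x) (Z := (x, v)) (mem_chart_self x)
    rw [st_self] at this
    exact congrArg (fun w : N × E2 => expMap g w.1 w.2) this
  rw [hfun] at hcomp
  obtain ⟨X, hX, hX0, hX1⟩ := hJ (0, w)
  refine ⟨X, hX, jst_injective g hsrc ?_, ?_⟩
  · rw [h0, hX0, jst_zero_fst]
  · rw [hcomp.mfderiv, ← hX1]
    rfl

end Exponential

/-! ### Geodesics and Jacobi fields with given initial data at an interior time -/

section Extension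

variable {g : Metric N} {Z : ℝ → N × E2} {X : ℝ → E2 × E2} {a b T : ℝ}

theorem IsGeo.of_subsingleton {s : Set ℝ} (hs : s.Subsingleton) : IsGeo g Z s where
  cont t ht := by
    rw [hs.eq_singleton_of_mem ht]
    exact continuousWithinAt_singleton
  deriv t _ p _ := (HasFDerivWithinAt.of_subsingleton hs :
    HasFDerivWithinAt _ (.toSpanSingleton ℝ (spray (metricInChart g p) (st p (Z t)))) s t)

theorem IsJac.of_subsingleton {s : Set ℝ} (hs : s.Subsingleton) : IsJac g Z X s :=
  fun t _ p _ => (HasFDerivWithinAt.of_subsingleton hs : HasFDerivWithinAt _ (.toSpanSingleton ℝ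
    (fderiv ℝ (spray (metricInChart g p)) (st p (Z t)) (jst g p (Z t) (X t)))) s t)

theorem mapsTo_uIcc_div (hT : T ≠ 0) : MapsTo (fun t => 0 + t * T⁻¹) (uIcc 0 T) (Icc 0 1) := by
  intro t ht
  simp only [zero_add]
  rcases hT.lt_or_gt with h | h
  · rw [uIcc_of_ge h.le] at ht
    have h' : T⁻¹ < 0 := inv_lt_zero.2 h
    refine ⟨mul_nonneg_of_nonpos_of_nonpos ht.2 h'.le, ?_⟩
    have := mul_le_mul_of_nonpos_right ht.1 h'.le
    rwa [mul_inv_cancel₀ hT] at this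
  · rw [uIcc_of_le h.le] at ht
    have h' : 0 < T⁻¹ := inv_pos.2 h
    refine ⟨mul_nonneg ht.1 h'.le, ?_⟩
    have := mul_le_mul_of_nonneg_right ht.2 h'.le
    rwa [mul_inv_cancel₀ hT] at this

theorem mapsTo_Icc_mul (T : ℝ) : MapsTo (fun t => 0 + t * T) (Icc 0 1) (uIcc 0 T) := by
  intro t ht
  simp only [zero_add]
  rcases le_total 0 T with h | h
  · rw [uIcc_of_le h]
    exact ⟨mul_nonneg ht.1 h, by nlinarith [ht.2]⟩
  · rw [uIcc_of_ge h]
    exact ⟨by nlinarith [ht.2], mul_nonpos_of_nonneg_of_nonpos ht.1 h⟩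

/-- If `T v` belongs to the domain of the exponential map, then the geodesic with initial velocity
`v` exists up to the time `T`. -/
theorem exists_isGeo_of_smul_mem_expDomain {x : N} {v : TangentSpace (𝓡 2) x}
    (h : T • v ∈ expDomain g x) : ∃ Z, IsGeo g Z (uIcc 0 T) ∧ Z 0 = ((x, v) : N × E2) := by
  by_cases hT : T = 0
  · exact ⟨fun _ => (x, v), IsGeo.of_subsingleton (by simp [hT]), rfl⟩
  · obtain ⟨Z, hZ, hZ0⟩ := exists_isGeo_of_mem_expDomain h
    refine ⟨_, hZ.comp_affine T⁻¹ 0 (mapsTo_uIcc_div hT), ?_⟩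
    simp only [zero_mul, add_zero, hZ0]
    exact Prod.ext rfl (inv_smul_smul₀ hT (v : E2))

theorem IsGeo.exists_isJac_uIcc (hZ : IsGeo g Z (uIcc 0 T)) (X₀ : E2 × E2) :
    ∃ X, IsJac g Z X (uIcc 0 T) ∧ X 0 = X₀ := by
  by_cases hT : T = 0
  · exact ⟨fun _ => X₀, IsJac.of_subsingleton (by simp [hT]), rfl⟩
  · obtain ⟨X, hX, hX0⟩ := (hZ.comp_affine T 0 (mapsTo_Icc_mul T)).exists_isJac (X₀.1, T • X₀.2)
    refine ⟨_, (hX.comp_affine T⁻¹ 0 (mapsTo_uIcc_div hT)).congr (fun t _ => ?_)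
      (fun _ _ => rfl), ?_⟩
    · simp [mul_assoc, inv_mul_cancel₀ hT, smul_smul]
    · simp [hX0, smul_smul, inv_mul_cancel₀ hT]

theorem exists_isGeo_Icc {x : N} {v : TangentSpace (𝓡 2) x} (ha : a ≤ 0) (hb : 0 ≤ b)
    (h : a • v ∈ expDomain g x) (h' : b • v ∈ expDomain g x) :
    ∃ Z, IsGeo g Z (Icc a b) ∧ Z 0 = ((x, v) : N × E2) := by
  obtain ⟨Z, hZ, hZ0⟩ := exists_isGeo_of_smul_mem_expDomain h
  obtain ⟨Z', hZ', hZ0'⟩ := exists_isGeo_of_smul_mem_expDomain h'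
  rw [uIcc_of_ge ha] at hZ
  rw [uIcc_of_le hb] at hZ'
  obtain ⟨k, hk, hk'⟩ := exists_glue (a := a) (b := b) (hZ0.trans hZ0'.symm)
  refine ⟨k, ?_, by rw [hk ⟨ha, le_rfl⟩, hZ0]⟩
  rw [← Icc_union_Icc_eq_Icc ha hb]
  exact (hZ.congr hk).union (hZ'.congr hk') isClosed_Icc isClosed_Icc

theorem IsGeo.exists_isJac_Icc (ha : a ≤ 0) (hb : 0 ≤ b) (hZ : IsGeo g Z (Icc a b))
    (X₀ : E2 × E2) : ∃ X, IsJac g Z X (Icc a b) ∧ X 0 = X₀ := by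
  obtain ⟨X, hX, hX0⟩ := IsGeo.exists_isJac_uIcc (T := a)
    (by rw [uIcc_of_ge ha]; exact hZ.mono (Icc_subset_Icc_right hb)) X₀
  obtain ⟨X', hX', hX0'⟩ := IsGeo.exists_isJac_uIcc (T := b)
    (by rw [uIcc_of_le hb]; exact hZ.mono (Icc_subset_Icc_left ha)) X₀
  rw [uIcc_of_ge ha] at hX
  rw [uIcc_of_le hb] at hX'
  obtain ⟨k, hk, hk'⟩ := exists_glue (a := a) (b := b) (hX0.trans hX0'.symm)
  refine ⟨k, ?_, by rw [hk ⟨ha, le_rfl⟩, hX0]⟩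
  rw [← Icc_union_Icc_eq_Icc ha hb]
  exact (hX.congr (fun _ _ => rfl) hk).union (hX'.congr (fun _ _ => rfl) hk') isClosed_Icc
    isClosed_Icc

end Extension

/-! ### The initial velocities along the transversal curve -/

namespace OrientedCurve

variable {g : Metric N} (H : OrientedCurve g) {q : ℝ × ℝ} {y : ℝ}

/-- The coordinate vector `∂/∂y` of the curve. -/
def coordVec (y : ℝ) : E2 := velocity H.pt H.dom y

/-- The unit normal, as a vector of the model space. -/
def normalVec (y : ℝ) : E2 := H.ν y

/-- The initial velocity of a geodesic, as a vector of the model space. -/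
def dir (q : ℝ × ℝ) : E2 := H.direction q

theorem dir_eq (q : ℝ × ℝ) : H.dir q = (q.2 / H.speedSq q.1) • H.coordVec q.1
    + Real.sqrt (1 - q.2 ^ 2 / H.speedSq q.1) • H.normalVec q.1 := rfl

theorem speedSq_eq (y : ℝ) : H.speedSq y = gform g (H.pt y) (H.coordVec y) (H.coordVec y) := rfl

theorem speedSq_pos (hy : y ∈ H.dom) : 0 < H.speedSq y := gform_pos g _ (H.regular y hy)

theorem gform_normal_coord (hy : y ∈ H.dom) :
    gform g (H.pt y) (H.normalVec y) (H.coordVec y) = 0 := H.normal_ν y hy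

theorem gform_normal_normal (hy : y ∈ H.dom) :
    gform g (H.pt y) (H.normalVec y) (H.normalVec y) = 1 := H.unit_ν y hy

theorem one_sub_pos (hq : q ∈ H.ballBundle) : 0 < 1 - q.2 ^ 2 / H.speedSq q.1 := by
  rw [sub_pos, div_lt_one (H.speedSq_pos hq.1)]
  exact hq.2

theorem gform_dir_coord (hq : q ∈ H.ballBundle) :
    gform g (H.pt q.1) (H.dir q) (H.coordVec q.1) = q.2 := by
  have h := (H.speedSq_pos hq.1).ne'
  rw [dir_eq]
  simp only [map_add, map_smul, add_apply, smul_apply, smul_eq_mul, H.gform_normal_coord hq.1,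
    ← H.speedSq_eq]
  field_simp
  ring

theorem gform_dir_dir (hq : q ∈ H.ballBundle) :
    gform g (H.pt q.1) (H.dir q) (H.dir q) = 1 := by
  have h := (H.speedSq_pos hq.1).ne'
  have h1 := H.gform_dir_coord hq
  have h2 : gform g (H.pt q.1) (H.dir q) (H.normalVec q.1)
      = Real.sqrt (1 - q.2 ^ 2 / H.speedSq q.1) := by
    rw [dir_eq]
    simp only [map_add, map_smul, add_apply, smul_apply, smul_eq_mul,
      gform_symm g _ (H.coordVec q.1), H.gform_normal_coord hq.1, H.gform_normal_normal hq.1]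
    ring
  nth_rewrite 2 [dir_eq]
  rw [map_add, map_smul, map_smul, h1, h2, smul_eq_mul, smul_eq_mul,
    Real.mul_self_sqrt (H.one_sub_pos hq).le]
  field_simp
  ring

section Coordinates

variable {p : N}

theorem contMDiffAt_pt (hy : y ∈ H.dom) : ContMDiffAt 𝓘(ℝ, ℝ) (𝓡 2) ∞ H.pt y :=
  (H.smooth_pt y hy).contMDiffAt (H.isOpen_dom.mem_nhds hy)

theorem eventually_mem_source (hy : y ∈ H.dom) (hp : H.pt y ∈ (extChartAt (𝓡 2) p).source) :
    ∀ᶠ z in 𝓝 y, H.pt z ∈ (extChartAt (𝓡 2) p).source :=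
  (H.contMDiffAt_pt hy).continuousAt.eventually ((isOpen_extChartAt_source p).mem_nhds hp)

theorem hasDerivAt_chart_pt (hy : y ∈ H.dom) (hp : H.pt y ∈ (extChartAt (𝓡 2) p).source) :
    HasDerivAt (fun z => extChartAt (𝓡 2) p (H.pt z)) (dchart p (H.pt y) (H.coordVec y)) y := by
  have h := hasDerivWithinAt_chart_comp (s := H.dom)
    ((H.smooth_pt y hy).mdifferentiableWithinAt (by simp)) hp
  exact h.hasDerivAt (H.isOpen_dom.mem_nhds hy)

theorem contDiffAt_chart_pt (hy : y ∈ H.dom) (hp : H.pt y ∈ (extChartAt (𝓡 2) p).source) :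
    ContDiffAt ℝ ∞ (fun z => extChartAt (𝓡 2) p (H.pt z)) y := by
  rw [← contDiffWithinAt_univ]
  exact contDiffWithinAt_chart_comp le_rfl (H.contMDiffAt_pt hy).contMDiffWithinAt hp

theorem contDiffAt_chart_coordVec (hy : y ∈ H.dom)
    (hp : H.pt y ∈ (extChartAt (𝓡 2) p).source) :
    ContDiffAt ℝ ∞ (fun z => dchart p (H.pt z) (H.coordVec z)) y := by
  have h := (H.contDiffAt_chart_pt hy hp).fderiv_right (m := ∞) (by simp)
  refine (h.clm_apply (contDiffAt_const (c := (1 : ℝ)))).congr_of_eventuallyEq ?_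
  filter_upwards [H.eventually_mem_source hy hp, H.isOpen_dom.mem_nhds hy] with z h1 h2
  exact ((H.hasDerivAt_chart_pt h2 h1).deriv).symm

theorem contDiffAt_chart_normalVec (hy : y ∈ H.dom)
    (hp : H.pt y ∈ (extChartAt (𝓡 2) p).source) :
    ContDiffAt ℝ ∞ (fun z => dchart p (H.pt z) (H.normalVec z)) y := by
  have h1 : ContMDiffAt 𝓘(ℝ, ℝ) (𝓡 2).tangent ∞
      (fun y => (⟨H.pt y, H.ν y⟩ : TangentBundle (𝓡 2) N)) y :=
    (H.smooth_ν y hy).contMDiffAt (H.isOpen_dom.mem_nhds hy)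
  rw [← contMDiffWithinAt_univ] at h1
  have h2 := ((contMDiffWithinAt_tangent_iff (p := p) (by simp) hp).1 h1).2
  rw [contMDiffWithinAt_univ] at h2
  exact h2.contDiffAt

theorem contDiffAt_speedSq (hy : y ∈ H.dom) : ContDiffAt ℝ ∞ H.speedSq y := by
  have hp := mem_chart_self (H.pt y)
  have h1 := H.contDiffAt_chart_coordVec hy hp
  have h2 := ((isCoordMetric_metricInChart g (H.pt y)).contDiffAt
    ((extChartAt (𝓡 2) (H.pt y)).map_source hp)).comp y (H.contDiffAt_chart_pt hy hp)
  refine ((h2.clm_apply h1).clm_apply h1).congr_of_eventuallyEq ?_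
  filter_upwards [H.eventually_mem_source hy hp] with z hz
  exact (metricInChart_apply g hz _ _).symm

/-- The point and the initial velocity depend smoothly on the coordinates. -/
theorem contDiffAt_st_dir (hq : q ∈ H.ballBundle)
    (hp : H.pt q.1 ∈ (extChartAt (𝓡 2) p).source) :
    ContDiffAt ℝ ∞ (fun q => st p (H.pt q.1, H.dir q)) q := by
  have hS : ContDiffAt ℝ ∞ (fun q : ℝ × ℝ => H.speedSq q.1) q :=
    ContDiffAt.fst'' (H.contDiffAt_speedSq hq.1)
  have hS0 := (H.speedSq_pos hq.1).ne'
  have h1 := ContDiffAt.fst'' (x := q) (H.contDiffAt_chart_coordVec hq.1 hp)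
  have h2 := ContDiffAt.fst'' (x := q) (H.contDiffAt_chart_normalVec hq.1 hp)
  have h3 := ContDiffAt.fst'' (x := q) (H.contDiffAt_chart_pt hq.1 hp)
  refine h3.prodMk ?_
  have h4 := ((contDiffAt_snd (𝕜 := ℝ) (n := ∞) (p := q)).div hS hS0).smul h1
  have h5 := ((contDiffAt_const (c := (1 : ℝ))).sub
    (((contDiffAt_snd (𝕜 := ℝ) (n := ∞) (p := q)).pow 2).div hS hS0)).sqrt (H.one_sub_pos hq).ne'
  refine (h4.add (h5.smul h2)).congr_of_eventuallyEq (Eventually.of_forall fun r => ?_)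
  simp only [dir_eq, map_add, map_smul]
  rfl

end Coordinates

end OrientedCurve

/-! ### The variation of the geodesics that cross the curve -/

/-- The derivative of the squared length `G_u(v, v)`, in terms of the covariant derivative. -/
theorem IsCoordMetric.two_mul_apply_covPart {E : Type*} [NormedAddCommGroup E] [NormedSpace ℝ E]
    {G : E → E →L[ℝ] E →L[ℝ] ℝ} {U : Set E} (hG : IsCoordMetric G U) {z : E × E} (hz : z.1 ∈ U)
    (ζ : E × E) : 2 * G z.1 (covPart G z ζ) z.2
      = 2 * G z.1 ζ.2 z.2 + fderiv ℝ G z.1 ζ.1 z.2 z.2 := by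
  rw [covPart, map_add, add_apply, hG.apply_christoffelL hz, hG.fderiv_symm hz z.2 ζ.1]
  ring

namespace OrientedCurve

variable {g : Metric N} (H : OrientedCurve g) {q : ℝ × ℝ} {a b t : ℝ}

/-- The derivative of the point and the initial velocity with respect to `(y, η)`, in the chart
around the point. -/
def dInitial (q : ℝ × ℝ) : ℝ × ℝ →L[ℝ] E2 × E2 :=
  fderiv ℝ (fun r => st (H.pt q.1) (H.pt r.1, H.dir r)) q

theorem hasFDerivAt_initial (hq : q ∈ H.ballBundle) :
    HasFDerivAt (fun r => st (H.pt q.1) (H.pt r.1, H.dir r)) (H.dInitial q) q :=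
  ((H.contDiffAt_st_dir hq (mem_chart_self _)).differentiableAt (by simp)).hasFDerivAt

theorem dInitial_fst (hq : q ∈ H.ballBundle) (h : ℝ × ℝ) :
    (H.dInitial q h).1 = h.1 • dchart (H.pt q.1) (H.pt q.1) (H.coordVec q.1) := by
  have h1 := (hasFDerivAt_fst (𝕜 := ℝ) (p := st (H.pt q.1) (H.pt q.1, H.dir q))).comp q
    (H.hasFDerivAt_initial hq)
  have h2 := (H.hasDerivAt_chart_pt hq.1 (mem_chart_self _)).hasFDerivAt.comp q
    (hasFDerivAt_fst (𝕜 := ℝ) (p := q))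
  exact congrArg (fun A : ℝ × ℝ →L[ℝ] E2 => A h) (h1.unique h2)

/-- The variation of the initial velocities consists of vectors whose covariant derivative is normal
to the velocity, since the latter has constant length. -/
theorem gform_initial_dir (hq : H.ballBundle ∈ 𝓝 q) {h : ℝ × ℝ} {X : E2 × E2}
    (hX : jst g (H.pt q.1) (H.pt q.1, H.dir q) X = H.dInitial q h) :
    gform g (H.pt q.1) X.2 (H.dir q) = 0 := by
  have hq' := mem_of_mem_nhds hq
  have hp := mem_chart_self (H.pt q.1)
  set p := H.pt q.1 with hp_def
  have hm : (st p (H.pt q.1, H.dir q)).1 ∈ (extChartAt (𝓡 2) p).target :=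
    st_mem (Z := (H.pt q.1, H.dir q)) hp
  have hG := isCoordMetric_metricInChart g p
  have hs := H.hasFDerivAt_initial hq'
  have hu := (hasFDerivAt_fst (𝕜 := ℝ) (p := st p (H.pt q.1, H.dir q))).comp q hs
  have hx := (hasFDerivAt_snd (𝕜 := ℝ) (p := st p (H.pt q.1, H.dir q))).comp q hs
  have hGu := HasFDerivAt.comp q (hG.differentiableAt hm).hasFDerivAt hu
  have hF := (hGu.clm_apply hx).clm_apply hx
  have hone : (fun r : ℝ × ℝ => (1 : ℝ)) =ᶠ[𝓝 q] fun r =>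
      metricInChart g p (st p (H.pt r.1, H.dir r)).1 (st p (H.pt r.1, H.dir r)).2
        (st p (H.pt r.1, H.dir r)).2 := by
    filter_upwards [hq, (continuous_fst.tendsto q).eventually (H.eventually_mem_source hq'.1 hp)]
      with r h1 h2
    exact ((metricInChart_apply g h2 _ _).trans (H.gform_dir_dir h1)).symm
  have key := congrArg (fun A : ℝ × ℝ →L[ℝ] ℝ => A h)
    ((hF.congr_of_eventuallyEq hone).unique (hasFDerivAt_const (1 : ℝ) q))
  simp at key
  rw [← metricInChart_apply g hp, ← covPart_jst g p (p, H.dir q) X, hX]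
  have e : ∀ Y, metricInChart g p (extChartAt (𝓡 2) p p) Y (dchart p p (H.dir q))
      = metricInChart g p (st p (H.pt q.1, H.dir q)).1 Y (st p (H.pt q.1, H.dir q)).2 :=
    fun _ => rfl
  rw [e]
  have h2 := hG.two_mul_apply_covPart (z := st p (H.pt q.1, H.dir q)) hm (H.dInitial q h)
  rw [hG.symm _ hm (st p (H.pt q.1, H.dir q)).2 ((H.dInitial q h).2), ← add_assoc,
    ← two_mul] at key
  have h3 := h2.trans key
  simpa using! h3

/-- The coordinate `η` is dual to `y`. -/
theorem gform_initial_coord (hq : H.ballBundle ∈ 𝓝 q) {X : E2 × E2}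
    (hX : jst g (H.pt q.1) (H.pt q.1, H.dir q) X = H.dInitial q (0, 1)) :
    gform g (H.pt q.1) X.2 (H.coordVec q.1) = 1 := by
  have hq' := mem_of_mem_nhds hq
  have hp := mem_chart_self (H.pt q.1)
  set p := H.pt q.1 with hp_def
  have hm : (st p (H.pt q.1, H.dir q)).1 ∈ (extChartAt (𝓡 2) p).target :=
    st_mem (Z := (H.pt q.1, H.dir q)) hp
  have hG := isCoordMetric_metricInChart g p
  have hs := H.hasFDerivAt_initial hq'
  have hu := (hasFDerivAt_fst (𝕜 := ℝ) (p := st p (H.pt q.1, H.dir q))).comp q hs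
  have hx := (hasFDerivAt_snd (𝕜 := ℝ) (p := st p (H.pt q.1, H.dir q))).comp q hs
  have hw := ((H.contDiffAt_chart_coordVec hq'.1 hp).differentiableAt
    (by simp)).hasFDerivAt.comp q (hasFDerivAt_fst (𝕜 := ℝ) (p := q))
  have hGu := HasFDerivAt.comp q (hG.differentiableAt hm).hasFDerivAt hu
  have hF := (hGu.clm_apply hx).clm_apply hw
  have heta : (fun r : ℝ × ℝ => r.2) =ᶠ[𝓝 q] fun r =>
      metricInChart g p (st p (H.pt r.1, H.dir r)).1 (st p (H.pt r.1, H.dir r)).2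
        (dchart p (H.pt r.1) (H.coordVec r.1)) := by
    filter_upwards [hq, (continuous_fst.tendsto q).eventually (H.eventually_mem_source hq'.1 hp)]
      with r h1 h2
    exact ((metricInChart_apply g h2 _ _).trans (H.gform_dir_coord h1)).symm
  have key := congrArg (fun A : ℝ × ℝ →L[ℝ] ℝ => A (0, 1))
    ((hF.congr_of_eventuallyEq heta).unique (hasFDerivAt_snd (𝕜 := ℝ) (p := q)))
  have hfst : (H.dInitial q (0, 1)).1 = 0 := by rw [H.dInitial_fst hq']; simp
  simp [hfst] at key
  rw [← metricInChart_apply g hp, ← covPart_jst g p (p, H.dir q) X, hX, covPart, hfst, map_zero,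
    add_zero]
  exact key

/-- A point of a geodesic with its velocity. -/
def lift (q : ℝ × ℝ) (t : ℝ) : N × E2 :=
  ((H.geodesicVelocity q t).1, (H.geodesicVelocity q t).2)

theorem exists_isGeo_lift [T2Space N] (ha : a ≤ 0) (hb : 0 ≤ b)
    (h : a • H.direction q ∈ expDomain g (H.pt q.1))
    (h' : b • H.direction q ∈ expDomain g (H.pt q.1)) :
    ∃ Z, IsGeo g Z (Icc a b) ∧ Z 0 = (H.pt q.1, H.dir q) ∧
      (∀ t ∈ Icc a b, H.geodesic (q.1, q.2, t) = (Z t).1) ∧ ∀ t ∈ Ioo a b, H.lift q t = Z t := by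
  obtain ⟨Z, hZ, hZ0⟩ := exists_isGeo_Icc ha hb h h'
  have hgeo : ∀ t ∈ Icc a b, H.geodesic (q.1, q.2, t) = (Z t).1 := by
    intro t ht
    have hmaps : MapsTo (fun s => 0 + s * t) (Icc 0 1) (Icc a b) := fun s hs =>
      ((convex_Icc a b).ordConnected.uIcc_subset ⟨ha, hb⟩ ht) (mapsTo_Icc_mul t hs)
    have := (hZ.comp_affine t 0 hmaps).expMap_eq (x := H.pt q.1) (v := t • H.dir q)
      (by simp only [zero_mul, add_zero, hZ0]; rfl)
    simp only [one_mul, zero_add] at this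
    exact this
  refine ⟨Z, hZ, hZ0, hgeo, fun t ht => Prod.ext (hgeo t (Ioo_subset_Icc_self ht)) ?_⟩
  have hZ' : IsGeo g (fun τ => (H.geodesic (q.1, q.2, τ), (Z τ).2)) (Icc a b) :=
    hZ.congr fun τ hτ => Prod.ext (hgeo τ hτ) rfl
  have hlt : a < b := ht.1.trans ht.2
  have hv := hZ'.velocity_eq (Ioo_subset_Icc_self ht) (uniqueDiffOn_Icc hlt _
    (Ioo_subset_Icc_self ht))
  have hv' : velocity (fun τ => H.geodesic (q.1, q.2, τ)) univ t
      = velocity (fun τ => H.geodesic (q.1, q.2, τ)) (Icc a b) t := by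
    rw [velocity, velocity, mfderivWithin_univ, mfderivWithin_of_mem_nhds (Icc_mem_nhds ht.1 ht.2)]
  exact hv'.trans hv

end OrientedCurve

namespace OrientedCurve

variable {g : Metric N} (H : OrientedCurve g) {q : ℝ × ℝ} {a b t : ℝ} {Z : ℝ → N × E2}

/-- The derivative of `γ(y, η, t)` with respect to `(y, η)` is given by the Jacobi fields whose
initial values are the derivatives of the point and the initial velocity. -/
theorem hasMFDerivAt_geodesic [T2Space N] (hq : q ∈ H.ballBundle) (hZ : IsGeo g Z (Icc a b))
    (ha : a ≤ 0) (hb : 0 ≤ b) (hZ0 : Z 0 = (H.pt q.1, H.dir q)) (ht : t ∈ Icc a b) :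
    ∃ A : ℝ × ℝ × ℝ →L[ℝ] E2,
      HasMFDerivAt 𝓘(ℝ, ℝ × ℝ × ℝ) (𝓡 2) H.geodesic (q.1, q.2, t) A ∧
      ∀ (h : ℝ × ℝ) (X : ℝ → E2 × E2), IsJac g Z X (Icc a b) →
        jst g (H.pt q.1) (H.pt q.1, H.dir q) (X 0) = H.dInitial q h →
        A (h.1, h.2, 0) = (X t).1 := by
  have hp := mem_chart_self (H.pt q.1)
  set p := H.pt q.1 with hp_def
  have hmaps : MapsTo (fun s => 0 + s * t) (Icc 0 1) (Icc a b) := fun s hs =>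
    ((convex_Icc a b).ordConnected.uIcc_subset ⟨ha, hb⟩ ht) (mapsTo_Icc_mul t hs)
  have hZt := hZ.comp_affine t 0 hmaps
  have hZt0 : ((Z (0 + 0 * t)).1, t • (Z (0 + 0 * t)).2) = (p, t • H.dir q) := by
    simp [hZ0]
  obtain ⟨B, hB, hBJ⟩ := hZt.hasMFDerivAt_expMap hZt0 hp
  -- the coordinates of the vector whose exponential is `γ(y, η, t)`
  set S : ℝ × ℝ × ℝ → E2 × E2 := fun w =>
    st p (H.pt w.1, w.2.2 • H.dir (w.1, w.2.1)) with hS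
  have hpr : HasFDerivAt (fun w : ℝ × ℝ × ℝ => (w.1, w.2.1)) _ (q.1, q.2, t) :=
    (hasFDerivAt_fst (𝕜 := ℝ)).prodMk (hasFDerivAt_snd (𝕜 := ℝ)).fst
  have htm : HasFDerivAt (fun w : ℝ × ℝ × ℝ => w.2.2) _ (q.1, q.2, t) :=
    (hasFDerivAt_snd (𝕜 := ℝ)).snd
  have hs := HasFDerivAt.comp (g := fun r => st p (H.pt r.1, H.dir r)) (q.1, q.2, t)
    (H.hasFDerivAt_initial hq) hpr
  have hs1 := (hasFDerivAt_fst (𝕜 := ℝ) (p := st p (H.pt q.1, H.dir q))).comp (q.1, q.2, t) hs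
  have hs2 := (hasFDerivAt_snd (𝕜 := ℝ) (p := st p (H.pt q.1, H.dir q))).comp (q.1, q.2, t) hs
  have hSd := hs1.prodMk (htm.smul hs2)
  have hSe : S = fun w => ((st p (H.pt w.1, H.dir (w.1, w.2.1))).1,
      w.2.2 • (st p (H.pt w.1, H.dir (w.1, w.2.1))).2) := by
    funext w
    simp [hS, st]
  have hS0 : S (q.1, q.2, t) = st p (p, t • H.dir q) := rfl
  have hcomp := HasMFDerivAt.comp (I := 𝓘(ℝ, ℝ × ℝ × ℝ)) (f := S) (q.1, q.2, t) (hS0 ▸ hB)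
    (HasFDerivAt.hasMFDerivAt (hSe ▸ hSd))
  refine ⟨_, hcomp.congr_of_eventuallyEq ?_, fun h X hX hX0 => ?_⟩
  · have hc : Tendsto (fun w : ℝ × ℝ × ℝ => w.1) (𝓝 (q.1, q.2, t)) (𝓝 q.1) :=
      continuous_fst.tendsto _
    filter_upwards [hc.eventually (H.eventually_mem_source hq.1 hp)] with w hw
    have := stInv_st (Z := (H.pt w.1, w.2.2 • H.dir (w.1, w.2.1))) hw
    exact congrArg (fun z : N × E2 => expMap g z.1 z.2) this.symm
  · obtain ⟨Y, hY, hY0, hY1⟩ := hBJ ((H.dInitial q h).1, t • (H.dInitial q h).2)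
    have hXt := hX.comp_affine t 0 hmaps
    have h0 : Y 0 = ((X (0 + 0 * t)).1, t • (X (0 + 0 * t)).2) := by
      refine jst_injective g (p := p) (Z := (p, t • H.dir q)) hp ?_
      rw [hY0, ← hX0]
      simp [jst, smul_sub]
    have h1 := hY.eq_of_eq hZt hXt h0 (right_mem_Icc.2 zero_le_one)
    rw [h1] at hY1
    simp only [zero_add, one_mul] at hY1
    rw [← hY1]
    show B ((H.dInitial q h).1, t • (H.dInitial q h).2 + (0 : ℝ) • (st p (H.pt q.1, H.dir q)).2)
      = _
    rw [zero_smul, add_zero]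

end OrientedCurve

namespace GeodesicManifold

variable {g : Metric N} (𝓜 : GeodesicManifold g) {q : ℝ × ℝ} {a b t : ℝ}

/-- The open interval of the times at which the geodesic with coordinates `q` is considered. -/
def innerTimes (q : ℝ × ℝ) : Set ℝ := Ioo (𝓜.tmin q) (𝓜.tmax q)

/-- The velocity of the geodesic with coordinates `q`. -/
def vel (q : ℝ × ℝ) (t : ℝ) : E2 := (𝓜.H.lift q t).2

theorem isGeo_lift [T2Space N] (hq : q ∈ 𝓜.params) : IsGeo g (𝓜.H.lift q) (𝓜.innerTimes q) := by
  have ha := 𝓜.tmin_le q hq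
  have hb := 𝓜.le_tmax q hq
  obtain ⟨Z, hZ, -, -, hZl⟩ := 𝓜.H.exists_isGeo_lift ha hb
    (𝓜.defined q hq _ (left_mem_Icc.2 (ha.trans hb)))
    (𝓜.defined q hq _ (right_mem_Icc.2 (ha.trans hb)))
  exact (hZ.mono Ioo_subset_Icc_self).congr hZl

/-- The pairs `Xy` and `Xη` consist of the variation fields `∂γ/∂y` and `∂γ/∂η` of the family `𝓜₀`
along the geodesic with coordinates `q` and of their covariant derivatives. These are Jacobi fields
whose covariant derivatives are normal to the geodesic, and `(y, η)` are symplectic coordinates. -/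
structure IsVariation (q : ℝ × ℝ) (Xy Xη : ℝ → E2 × E2) : Prop where
  jac_y : IsJac g (𝓜.H.lift q) Xy (𝓜.innerTimes q)
  jac_η : IsJac g (𝓜.H.lift q) Xη (𝓜.innerTimes q)
  normal_y : ∀ t ∈ 𝓜.innerTimes q, gform g (𝓜.H.lift q t).1 (Xy t).2 (𝓜.vel q t) = 0
  normal_η : ∀ t ∈ 𝓜.innerTimes q, gform g (𝓜.H.lift q t).1 (Xη t).2 (𝓜.vel q t) = 0
  sympl_eq : ∀ t ∈ 𝓜.innerTimes q, sympl g (𝓜.H.lift q t).1 (Xy t) (Xη t) = 1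
  mfderiv_eq : ∀ t ∈ 𝓜.innerTimes q, ∀ dy dη dt : ℝ,
    (mfderiv 𝓘(ℝ, ℝ × ℝ × ℝ) (𝓡 2) 𝓜.H.geodesic (q.1, q.2, t) ((dy, dη, dt) : ℝ × ℝ × ℝ) : E2)
      = dy • (Xy t).1 + dη • (Xη t).1 + dt • 𝓜.vel q t

theorem gform_vel_vel [T2Space N] (hq : q ∈ 𝓜.params) (ht : t ∈ 𝓜.innerTimes q) :
    gform g (𝓜.H.lift q t).1 (𝓜.vel q t) (𝓜.vel q t) = 1 := by
  have ha := 𝓜.tmin_le q hq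
  have hb := 𝓜.le_tmax q hq
  obtain ⟨Z, hZ, hZ0, -, hZl⟩ := 𝓜.H.exists_isGeo_lift ha hb
    (𝓜.defined q hq _ (left_mem_Icc.2 (ha.trans hb)))
    (𝓜.defined q hq _ (right_mem_Icc.2 (ha.trans hb)))
  have h := (hZ.speed_eq (Ioo_subset_Icc_self ht)).trans (hZ.speed_eq ⟨ha, hb⟩).symm
  rw [hZ0] at h
  rw [vel, hZl t ht, h]
  exact 𝓜.H.gform_dir_dir (𝓜.params_subset hq)

theorem exists_isVariation [T2Space N] (hq : q ∈ 𝓜.params) :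
    ∃ Xy Xη : ℝ → E2 × E2, 𝓜.IsVariation q Xy Xη := by
  have ha := 𝓜.tmin_le q hq
  have hb := 𝓜.le_tmax q hq
  have hball := 𝓜.params_subset hq
  have hnhds : 𝓜.H.ballBundle ∈ 𝓝 q :=
    mem_of_superset (𝓜.isOpen_params.mem_nhds hq) 𝓜.params_subset
  obtain ⟨Z, hZ, hZ0, -, hZl⟩ := 𝓜.H.exists_isGeo_lift ha hb
    (𝓜.defined q hq _ (left_mem_Icc.2 (ha.trans hb)))
    (𝓜.defined q hq _ (right_mem_Icc.2 (ha.trans hb)))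
  have hp := mem_chart_self (𝓜.H.pt q.1)
  have hinit : ∀ h : ℝ × ℝ, ∃ X, IsJac g Z X (Icc (𝓜.tmin q) (𝓜.tmax q)) ∧
      jst g (𝓜.H.pt q.1) (𝓜.H.pt q.1, 𝓜.H.dir q) (X 0) = 𝓜.H.dInitial q h := by
    intro h
    obtain ⟨X, hX, hX0⟩ := hZ.exists_isJac_Icc ha hb (jstInv g (𝓜.H.pt q.1)
      (st (𝓜.H.pt q.1) (𝓜.H.pt q.1, 𝓜.H.dir q)) (𝓜.H.dInitial q h))
    refine ⟨X, hX, ?_⟩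
    have := jst_jstInv g (𝓜.H.dInitial q h) (st_mem (Z := (𝓜.H.pt q.1, 𝓜.H.dir q)) hp)
    rw [stInv_st (Z := (𝓜.H.pt q.1, 𝓜.H.dir q)) hp] at this
    rw [hX0, this]
  obtain ⟨Xy, hXy, hXy0⟩ := hinit (1, 0)
  obtain ⟨Xη, hXη, hXη0⟩ := hinit (0, 1)
  have hsub : 𝓜.innerTimes q ⊆ Icc (𝓜.tmin q) (𝓜.tmax q) := Ioo_subset_Icc_self
  have h0 : (0 : ℝ) ∈ Icc (𝓜.tmin q) (𝓜.tmax q) := ⟨ha, hb⟩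
  -- conserved quantities are evaluated at the time `0`
  have hcons : ∀ {f : ℝ → ℝ}, (∀ t ∈ Icc (𝓜.tmin q) (𝓜.tmax q), f t = f (𝓜.tmin q)) →
      ∀ t ∈ Icc (𝓜.tmin q) (𝓜.tmax q), f t = f 0 := fun hf t ht => (hf t ht).trans (hf 0 h0).symm
  have hKy := hcons (f := fun t => gform g (Z t).1 (Xy t).2 (Z t).2)
    fun t ht => hXy.deriv_velocity_eq hZ ht
  have hKη := hcons (f := fun t => gform g (Z t).1 (Xη t).2 (Z t).2)
    fun t ht => hXη.deriv_velocity_eq hZ ht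
  have hω := hcons (f := fun t => sympl g (Z t).1 (Xy t) (Xη t))
    fun t ht => hXy.sympl_eq hZ hXη ht
  have hJ : ∀ {h : ℝ × ℝ} {X : E2 × E2}, jst g (𝓜.H.pt q.1) (𝓜.H.pt q.1, 𝓜.H.dir q) X
      = 𝓜.H.dInitial q h → X.1 = h.1 • 𝓜.H.coordVec q.1 := by
    intro h X hX
    refine dchart_injective hp ?_
    rw [map_smul, ← 𝓜.H.dInitial_fst hball, ← hX]
    rfl
  have hJy : (Xy 0).1 = 𝓜.H.coordVec q.1 := by rw [hJ hXy0, one_smul]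
  have hJη : (Xη 0).1 = 0 := by rw [hJ hXη0, zero_smul]
  have hvel : ∀ t ∈ 𝓜.innerTimes q, 𝓜.vel q t = (Z t).2 := fun t ht =>
    congrArg Prod.snd (hZl t ht)
  refine ⟨Xy, Xη, (hXy.mono hsub).congr hZl (fun _ _ => rfl),
    (hXη.mono hsub).congr hZl (fun _ _ => rfl), fun t ht => ?_, fun t ht => ?_, fun t ht => ?_,
    fun t ht dy dη dt => ?_⟩
  · rw [hvel t ht, hZl t ht]
    refine (hKy t (hsub ht)).trans ?_
    simp only [hZ0]
    exact 𝓜.H.gform_initial_dir hnhds hXy0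
  · rw [hvel t ht, hZl t ht]
    refine (hKη t (hsub ht)).trans ?_
    simp only [hZ0]
    exact 𝓜.H.gform_initial_dir hnhds hXη0
  · rw [hZl t ht]
    refine (hω t (hsub ht)).trans ?_
    simp only [hZ0, sympl, hJy, hJη, map_zero, sub_zero]
    rw [gform_symm]
    exact 𝓜.H.gform_initial_coord hnhds hXη0
  · rw [hvel t ht]
    obtain ⟨A, hA, hAJ⟩ := 𝓜.H.hasMFDerivAt_geodesic hball hZ ha hb hZ0 (hsub ht)
    rw [hA.mfderiv]
    have e : ((dy, dη, dt) : ℝ × ℝ × ℝ)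
        = dy • ((1 : ℝ), (0 : ℝ), (0 : ℝ)) + dη • ((0 : ℝ), (1 : ℝ), (0 : ℝ))
          + dt • ((0 : ℝ), (0 : ℝ), (1 : ℝ)) := by simp
    have hAt : A (0, 0, 1) = (Z t).2 := by
      have hline : HasFDerivAt (fun τ : ℝ => (q.1, q.2, τ))
          ((ContinuousLinearMap.inr ℝ ℝ (ℝ × ℝ)).comp (ContinuousLinearMap.inr ℝ ℝ ℝ)) t :=
        (hasFDerivAt_prodMk_right q.1 (q.2, t)).comp t (hasFDerivAt_prodMk_right q.2 t)
      have hc := HasMFDerivAt.comp (I := 𝓘(ℝ, ℝ)) t hA hline.hasMFDerivAt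
      have hv : velocity (fun τ => 𝓜.H.geodesic (q.1, q.2, τ)) univ t = (Z t).2 :=
        hvel t ht
      rw [← hv, velocity, mfderivWithin_univ]
      have := hc.mfderiv
      exact (congrArg (fun B : ℝ →L[ℝ] E2 => B 1) this).symm
    show A (dy, dη, dt) = _
    rw [e, map_add, map_add, map_smul, map_smul, map_smul, hAJ (1, 0) Xy hXy hXy0,
      hAJ (0, 1) Xη hXη hXη0, hAt]

end GeodesicManifold

/-! ### Linear algebra in the tangent plane -/

section Plane

variable {g : Metric N} {x : N} {f : E2 →L[ℝ] ℝ} {V : E2}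

theorem exists_smul_of_apply_eq_zero (hf : f ≠ 0) {v w : E2} (hv : v ≠ 0) (hfv : f v = 0)
    (hfw : f w = 0) : ∃ a : ℝ, w = a • v := by
  have hf' : (f : E2 →ₗ[ℝ] ℝ) ≠ 0 := fun h => hf (ContinuousLinearMap.coe_injective h)
  have h1 := Module.Dual.finrank_ker_add_one_of_ne_zero (f := (f : Module.Dual ℝ E2)) hf'
  have h2 : Module.finrank ℝ (LinearMap.ker (f : E2 →ₗ[ℝ] ℝ)) = 1 := by
    have : Module.finrank ℝ E2 = 2 := by simp
    rw [this] at h1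
    exact Nat.succ_injective h1
  obtain ⟨c, hc⟩ := exists_smul_eq_of_finrank_eq_one h2
    (x := (⟨v, hfv⟩ : LinearMap.ker (f : E2 →ₗ[ℝ] ℝ))) (fun h => hv (congrArg Subtype.val h))
    ⟨w, hfw⟩
  exact ⟨c, (congrArg Subtype.val hc).symm⟩

theorem exists_ne_zero_apply_eq_zero (f : E2 →L[ℝ] ℝ) : ∃ n : E2, n ≠ 0 ∧ f n = 0 := by
  have h : ¬ Function.Injective (f : E2 →ₗ[ℝ] ℝ) := fun h => by
    have := LinearMap.finrank_le_finrank_of_injective h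
    simp at this
  rw [injective_iff_map_eq_zero] at h
  push Not at h
  obtain ⟨n, h1, h2⟩ := h
  exact ⟨n, h2, h1⟩

theorem gform_ne_zero (g : Metric N) (x : N) (hV : V ≠ 0) : gform g x V ≠ 0 := fun h => by
  have := gform_pos g x hV
  simp [h] at this

theorem exists_gform_eq (g : Metric N) (x : N) (ξ : E2 →L[ℝ] ℝ) : ∃ a, gform g x a = ξ := by
  have hinj : Function.Injective (gform g x : E2 →ₗ[ℝ] (E2 →L[ℝ] ℝ)) := by
    rw [injective_iff_map_eq_zero]
    intro v hv
    by_contra h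
    exact gform_ne_zero g x h hv
  have hdim : Module.finrank ℝ E2 = Module.finrank ℝ (E2 →L[ℝ] ℝ) :=
    (InnerProductSpace.toDual ℝ E2).toLinearEquiv.finrank_eq
  have : FiniteDimensional ℝ (E2 →L[ℝ] ℝ) :=
    Module.Finite.equiv (InnerProductSpace.toDual ℝ E2).toLinearEquiv
  exact (LinearMap.injective_iff_surjective_of_finrank_eq_finrank hdim).1 hinj ξ

/-- A normal pair of vectors that is symplectically orthogonal to two pairs that are not
symplectically orthogonal to each other vanishes. -/
theorem eq_zero_of_sympl_eq_zero (hV : V ≠ 0) {X Y A : E2 × E2} (hX : gform g x X.2 V = 0)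
    (hY : gform g x Y.2 V = 0) (hA₁ : gform g x A.1 V = 0) (hA₂ : gform g x A.2 V = 0)
    (hXY : sympl g x X Y ≠ 0) (hAX : sympl g x A X = 0) (hAY : sympl g x A Y = 0) : A = 0 := by
  have hne := gform_ne_zero g x hV
  obtain ⟨n, hn, hVn⟩ := exists_ne_zero_apply_eq_zero (gform g x V)
  have hspan : ∀ w, gform g x w V = 0 → ∃ c : ℝ, w = c • n := fun w hw =>
    exists_smul_of_apply_eq_zero hne hn hVn (by rwa [gform_symm])
  obtain ⟨k, hk⟩ := hspan _ hX
  obtain ⟨l, hl⟩ := hspan _ hY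
  obtain ⟨α, hα⟩ := hspan _ hA₁
  obtain ⟨β, hβ⟩ := hspan _ hA₂
  have hnn := (gform_pos g x hn).ne'
  simp only [sympl, hk, hl, hα, hβ, map_smul, smul_apply, smul_eq_mul] at hXY hAX hAY
  rw [gform_symm g x X.1 n] at hXY
  set j := gform g x n X.1
  set m := gform g x n Y.1
  set ν := gform g x n n
  have h1 : α * ν * (l * j - k * m) = 0 := by linear_combination j * hAY - m * hAX
  have hα0 : α = 0 := by simpa [hXY, hnn] using h1
  have h2 : β * (l * j - k * m) = 0 := by
    rw [hα0] at hAX hAY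
    linear_combination (-l) * hAX + k * hAY
  have hβ0 : β = 0 := by simpa [hXY] using h2
  exact Prod.ext (by rw [hα, hα0, zero_smul]; rfl) (by rw [hβ, hβ0, zero_smul]; rfl)

/-- Vectors that are not symplectically orthogonal, together with `V`, span the plane. -/
theorem eq_zero_of_apply_eq_zero (hV : V ≠ 0) {X Y : E2 × E2} (hX : gform g x X.2 V = 0)
    (hY : gform g x Y.2 V = 0) (hXY : sympl g x X Y ≠ 0) (hfV : f V = 0) (hfX : f X.1 = 0)
    (hfY : f Y.1 = 0) : f = 0 := by
  by_contra hf
  obtain ⟨a, ha⟩ := exists_smul_of_apply_eq_zero hf hV hfV hfX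
  obtain ⟨b, hb⟩ := exists_smul_of_apply_eq_zero hf hV hfV hfY
  apply hXY
  rw [sympl, ha, hb, map_smul, map_smul, smul_apply, gform_symm g x V, hX, hY]
  simp

end Plane

/-! ### Jacobi fields that vanish at both ends -/

section Conjugate

variable {g : Metric N} {c : ℝ → N} {Z : ℝ → N × E2} {X X' : ℝ → E2 × E2}

theorem IsJac.snd_eq_zero {V : ℝ → E2} (hZ : IsGeo g (fun t => (c t, V t)) (Icc 0 1))
    (hX : IsJac g (fun t => (c t, V t)) X (Icc 0 1)) (h : ∀ s ∈ Icc (0 : ℝ) 1, (X s).1 = 0) :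
    (X 0).2 = 0 := by
  have h0 : (0 : ℝ) ∈ Icc (0 : ℝ) 1 := left_mem_Icc.2 zero_le_one
  have hs := uniqueDiffOn_Icc (zero_lt_one (α := ℝ)) 0 h0
  have hp := mem_chart_self (c 0)
  have hd := (hasFDerivAt_fst (𝕜 := ℝ) (p := st (c 0) (c 0, V 0))).comp_hasDerivWithinAt 0
    (hZ.deriv 0 h0 (c 0) hp)
  have hx : HasDerivWithinAt (fun τ => dchart (c 0) (c τ) (X τ).1) 0 (Icc 0 1) 0 :=
    (hasDerivWithinAt_const 0 (Icc (0 : ℝ) 1) (0 : E2)).congr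
      (fun τ hτ => by rw [h τ hτ, map_zero]) (by rw [h 0 h0, map_zero])
  have key := dchart_covDeriv (g := g) (X := fun τ => (X τ).1) (hZ.cont 0 h0) hp hs hd hx
  rw [hX.covDeriv_eq hZ h0 hs] at key
  refine dchart_injective hp (key.trans ?_)
  simp [h 0 h0]

/-- Along a geodesic in a surface the Jacobi fields that vanish at both ends are multiples of each
other, as their covariant derivatives are normal to the geodesic. -/
theorem IsJac.exists_smul_eq (hZ : IsGeo g Z (Icc 0 1)) (hX : IsJac g Z X (Icc 0 1))
    (hX' : IsJac g Z X' (Icc 0 1)) (hV : (Z 0).2 ≠ 0) (hK : (X 0).2 ≠ 0) (h0 : (X 0).1 = 0)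
    (h1 : (X 1).1 = 0) (h0' : (X' 0).1 = 0) (h1' : (X' 1).1 = 0) :
    ∃ a : ℝ, ∀ s ∈ Icc (0 : ℝ) 1, X' s = a • X s := by
  have hnormal : ∀ {X : ℝ → E2 × E2}, IsJac g Z X (Icc 0 1) → (X 0).1 = 0 → (X 1).1 = 0 →
      gform g (Z 0).1 (Z 0).2 (X 0).2 = 0 := by
    intro X hX h0 h1
    have := hX.velocity_eq hZ (right_mem_Icc.2 zero_le_one)
    rw [h0, h1] at this
    simp at this
    rw [gform_symm, ← this]
  obtain ⟨a, ha⟩ := exists_smul_of_apply_eq_zero (gform_ne_zero g _ hV) hK (hnormal hX h0 h1)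
    (hnormal hX' h0' h1')
  refine ⟨a, fun s hs => hX'.eq_of_eq hZ (hX.smul a) (Prod.ext ?_ ha) hs⟩
  rw [h0']
  simp [h0]

/-- The end points of a geodesic are conjugate if a nontrivial Jacobi field vanishes at both. -/
theorem IsJac.conjugateAlong [T2Space N] {V : ℝ → E2}
    (hZ : IsGeo g (fun t => (c t, V t)) (Icc 0 1))
    (hX : IsJac g (fun t => (c t, V t)) X (Icc 0 1)) (hK : (X 0).2 ≠ 0) (h0 : (X 0).1 = 0)
    (h1 : (X 1).1 = 0) : ConjugateAlong g c := by
  have hv : velocity c (Icc 0 1) 0 = V 0 := hZ.velocity_eq (left_mem_Icc.2 zero_le_one)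
    (uniqueDiffOn_Icc (zero_lt_one (α := ℝ)) 0 (left_mem_Icc.2 zero_le_one))
  obtain ⟨Y, hY, hY0, hY1⟩ := hZ.mfderiv_expMap (x := c 0) (v := V 0) rfl (X 0).2
  have hYX := hY.eq_of_eq hZ hX (hY0.trans (Prod.ext h0.symm rfl)) (right_mem_Icc.2 zero_le_one)
  rw [hYX, h1] at hY1
  intro hbij
  apply hK
  rw [hv] at hbij
  exact hbij.1 (hY1.trans (map_zero (mfderiv 𝓘(ℝ, E2) (𝓡 2) (fun v : E2 => expMap g (c 0) v)
    (V 0))).symm)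

end Conjugate

/-! ### The canonical relation -/

/-- The covector of an element of the cotangent bundle, as a linear form on the model space. -/
def covec (w : Cotangent N) : E2 →L[ℝ] ℝ := w.2

theorem cotangent_ext {w w' : Cotangent N} (h : w.1 = w'.1) (h' : covec w = covec w') : w = w' := by
  obtain ⟨x, ξ⟩ := w
  obtain ⟨x', ξ'⟩ := w'
  obtain rfl : x = x' := h
  obtain rfl : ξ = ξ' := h'
  rfl

theorem tangent_ext {w w' : TangentBundle (𝓡 2) N} (h : w.1 = w'.1)
    (h' : (w.2 : E2) = (w'.2 : E2)) : w = w' := by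
  obtain ⟨x, v⟩ := w
  obtain ⟨x', v'⟩ := w'
  obtain rfl : x = x' := h
  obtain rfl : v = v' := h'
  rfl

namespace GeodesicManifold

variable {g : Metric N} (𝓜 : GeodesicManifold g) {q : ℝ × ℝ} {t t₁ t₂ : ℝ} {w w' : Cotangent N}

/-- The covector `w` is conormal, at the time `t`, to the geodesic with coordinates `q`. -/
structure IsConormalAt (w : Cotangent N) (q : ℝ × ℝ) (t : ℝ) : Prop where
  mem_params : q ∈ 𝓜.params
  mem_times : t ∈ 𝓜.innerTimes q
  point_eq : w.1 = (𝓜.H.lift q t).1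
  apply_vel : covec w (𝓜.vel q t) = 0

theorem mem_innerTimes (hq : q ∈ 𝓜.params) (ht : t ∈ 𝓜.times q)
    (hM : 𝓜.H.geodesic (q.1, q.2, t) ∈ interior 𝓜.M) : t ∈ 𝓜.innerTimes q := by
  refine ⟨lt_of_le_of_ne ht.1 ?_, lt_of_le_of_ne ht.2 ?_⟩
  · rintro rfl
    exact 𝓜.start_notMem q hq (interior_subset hM)
  · rintro rfl
    exact 𝓜.end_notMem q hq (interior_subset hM)

theorem exists_isConormalAt (h : w ∈ 𝓜.conormals) : ∃ q t, 𝓜.IsConormalAt w q t := by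
  obtain ⟨-, hM, q, hq, t, ht, ξ, rfl, hξ⟩ := h
  exact ⟨q, t, hq, 𝓜.mem_innerTimes hq ht hM, rfl, hξ⟩

/-- The geodesic to which a covector is conormal, and the time, are unique: the unit vectors in the
kernel of a nonzero covector are opposite to each other. -/
theorem IsConormalAt.eq [T2Space N] {𝓜 : GeodesicManifold g} {q' : ℝ × ℝ} {t' : ℝ}
    (hw : covec w ≠ 0) (h : 𝓜.IsConormalAt w q t) (h' : 𝓜.IsConormalAt w q' t') :
    q = q' ∧ t = t' := by
  have h1 := 𝓜.gform_vel_vel h.mem_params h.mem_times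
  have h2 := 𝓜.gform_vel_vel h'.mem_params h'.mem_times
  rw [← h.point_eq] at h1
  rw [← h'.point_eq] at h2
  have hpt : (𝓜.H.geodesicVelocity q t).1 = (𝓜.H.geodesicVelocity q' t').1 :=
    h.point_eq.symm.trans h'.point_eq
  have hv : 𝓜.vel q' t' ≠ 0 := fun h0 => by simp [h0] at h2
  obtain ⟨a, ha⟩ := exists_smul_of_apply_eq_zero hw hv h'.apply_vel h.apply_vel
  rw [ha] at h1
  simp [h2] at h1
  rcases mul_self_eq_one_iff.1 h1 with rfl | rfl
  · refine 𝓜.simple q h.mem_params t (Ioo_subset_Icc_self h.mem_times) q' h'.mem_params t'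
      (Ioo_subset_Icc_self h'.mem_times) (tangent_ext hpt ?_)
    exact ha.trans (one_smul ℝ (𝓜.vel q' t'))
  · refine (𝓜.odd q h.mem_params t (Ioo_subset_Icc_self h.mem_times) q' h'.mem_params t'
      (Ioo_subset_Icc_self h'.mem_times) (tangent_ext hpt ?_)).elim
    exact ha.trans (neg_one_smul ℝ (𝓜.vel q' t'))

theorem mem_canonicalRelation_iff {Xy Xη : ℝ → E2 × E2} (hX : 𝓜.IsVariation q Xy Xη)
    {r : ℝ × ℝ} : ((q, r), w) ∈ 𝓜.canonicalRelation ↔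
      covec w ≠ 0 ∧ w.1 ∈ interior 𝓜.M ∧ ∃ t, 𝓜.IsConormalAt w q t ∧
        covec w (Xy t).1 = r.1 ∧ covec w (Xη t).1 = r.2 := by
  constructor
  · rintro ⟨hw, hM, hq, t, ht, ξ, hwξ, hξ⟩
    have hpt : w.1 = 𝓜.H.geodesic (q.1, q.2, t) := congrArg (fun w : Cotangent N => w.1) hwξ
    have hcov : covec w = ξ := congrArg covec hwξ
    have ht' := 𝓜.mem_innerTimes hq ht (hpt ▸ hM)
    have key : ∀ dy dη dt : ℝ, covec w (dy • (Xy t).1 + dη • (Xη t).1 + dt • 𝓜.vel q t)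
        = r.1 * dy + r.2 * dη := fun dy dη dt => by
      rw [← hX.mfderiv_eq t ht', hcov]
      exact hξ dy dη dt
    refine ⟨hw, hM, t, ⟨hq, ht', hpt, ?_⟩, ?_, ?_⟩
    · simpa using! key 0 0 1
    · simpa using! key 1 0 0
    · simpa using! key 0 1 0
  · rintro ⟨hw, hM, t, ht, h1, h2⟩
    have hlin : ∀ dy dη dt : ℝ, covec w (dy • (Xy t).1 + dη • (Xη t).1 + dt • 𝓜.vel q t)
        = r.1 * dy + r.2 * dη := fun dy dη dt => by
      rw [map_add, map_add, map_smul, map_smul, map_smul, h1, h2, ht.apply_vel]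
      simp [mul_comm]
    obtain ⟨x, ξ⟩ := w
    obtain rfl : x = 𝓜.H.geodesic (q.1, q.2, t) := ht.point_eq
    exact ⟨hw, hM, ht.mem_params, t, Ioo_subset_Icc_self ht.mem_times, ξ, rfl, fun dy dη dt =>
      (congrArg (ξ : E2 →L[ℝ] ℝ) (hX.mfderiv_eq t ht.mem_times dy dη dt)).trans (hlin dy dη dt)⟩

theorem canonicalRelation_left_unique [T2Space N] {Γ Γ' : (ℝ × ℝ) × (ℝ × ℝ)}
    (h : (Γ, w) ∈ 𝓜.canonicalRelation) (h' : (Γ', w) ∈ 𝓜.canonicalRelation) : Γ = Γ' := by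
  obtain ⟨q, r⟩ := Γ
  obtain ⟨q', r'⟩ := Γ'
  obtain ⟨Xy, Xη, hX⟩ := 𝓜.exists_isVariation (q := q) h.2.2.1
  obtain ⟨Xy', Xη', hX'⟩ := 𝓜.exists_isVariation (q := q') h'.2.2.1
  obtain ⟨hw, -, t, ht, -⟩ := (𝓜.mem_canonicalRelation_iff hX).1 h
  obtain ⟨-, -, t', ht', -⟩ := (𝓜.mem_canonicalRelation_iff hX').1 h'
  obtain ⟨rfl, rfl⟩ := ht.eq hw ht'
  obtain ⟨-, -, s, hs, h1, h2⟩ := (𝓜.mem_canonicalRelation_iff hX).1 h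
  obtain ⟨-, -, s', hs', h1', h2'⟩ := (𝓜.mem_canonicalRelation_iff hX).1 h'
  obtain ⟨-, rfl⟩ := hs.eq hw hs'
  exact Prod.ext rfl (Prod.ext (h1.symm.trans h1') (h2.symm.trans h2'))

theorem canonicalMap_mem [T2Space N] (h : w ∈ 𝓜.conormals) :
    (𝓜.canonicalMap w, w) ∈ 𝓜.canonicalRelation := by
  obtain ⟨q, t, ht⟩ := 𝓜.exists_isConormalAt h
  obtain ⟨Xy, Xη, hX⟩ := 𝓜.exists_isVariation ht.mem_params
  exact Classical.epsilon_spec (p := fun Γ => (Γ, w) ∈ 𝓜.canonicalRelation)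
    ⟨(q, (covec w (Xy t).1, covec w (Xη t).1)),
      (𝓜.mem_canonicalRelation_iff hX).2 ⟨h.1, h.2.1, t, ht, rfl, rfl⟩⟩

theorem canonicalMap_eq_iff [T2Space N] (h : w ∈ 𝓜.conormals) (h' : w' ∈ 𝓜.conormals) :
    𝓜.canonicalMap w = 𝓜.canonicalMap w' ↔
      ∃ Γ, (Γ, w) ∈ 𝓜.canonicalRelation ∧ (Γ, w') ∈ 𝓜.canonicalRelation := by
  constructor
  · intro he
    exact ⟨_, 𝓜.canonicalMap_mem h, he ▸ 𝓜.canonicalMap_mem h'⟩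
  · rintro ⟨Γ, h1, h2⟩
    rw [𝓜.canonicalRelation_left_unique (𝓜.canonicalMap_mem h) h1,
      𝓜.canonicalRelation_left_unique (𝓜.canonicalMap_mem h') h2]

/-! ### Segments of the geodesics -/

/-- The points of the segment from the time `t₁` to the time `t₂`, parametrized by `[0, 1]`. -/
def segment (q : ℝ × ℝ) (t₁ t₂ s : ℝ) : N := (𝓜.H.lift q (t₁ + s * (t₂ - t₁))).1

/-- The velocity of the segment. -/
def segmentVel (q : ℝ × ℝ) (t₁ t₂ s : ℝ) : E2 := (t₂ - t₁) • 𝓜.vel q (t₁ + s * (t₂ - t₁))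

/-- A vector field along the geodesic and its covariant derivative, on the segment. -/
def onSegment (X : ℝ → E2 × E2) (t₁ t₂ s : ℝ) : E2 × E2 :=
  ((X (t₁ + s * (t₂ - t₁))).1, (t₂ - t₁) • (X (t₁ + s * (t₂ - t₁))).2)

theorem mapsTo_segment (h₁ : t₁ ∈ 𝓜.innerTimes q) (h₂ : t₂ ∈ 𝓜.innerTimes q) :
    MapsTo (fun s => t₁ + s * (t₂ - t₁)) (Icc 0 1) (𝓜.innerTimes q) := fun s hs => by
  have := (convex_Ioo (𝓜.tmin q) (𝓜.tmax q)) h₁ h₂ (a := 1 - s) (b := s) (by linarith [hs.2]) hs.1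
    (by ring)
  have e : (1 - s) • t₁ + s • t₂ = t₁ + s * (t₂ - t₁) := by
    simp only [smul_eq_mul]
    ring
  rwa [e] at this

theorem isGeo_segment [T2Space N] (hq : q ∈ 𝓜.params) (h₁ : t₁ ∈ 𝓜.innerTimes q)
    (h₂ : t₂ ∈ 𝓜.innerTimes q) :
    IsGeo g (fun s => (𝓜.segment q t₁ t₂ s, 𝓜.segmentVel q t₁ t₂ s)) (Icc 0 1) :=
  (𝓜.isGeo_lift hq).comp_affine (t₂ - t₁) t₁ (𝓜.mapsTo_segment h₁ h₂)

theorem isJac_onSegment {X : ℝ → E2 × E2} (hX : IsJac g (𝓜.H.lift q) X (𝓜.innerTimes q))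
    (h₁ : t₁ ∈ 𝓜.innerTimes q) (h₂ : t₂ ∈ 𝓜.innerTimes q) :
    IsJac g (fun s => (𝓜.segment q t₁ t₂ s, 𝓜.segmentVel q t₁ t₂ s)) (onSegment X t₁ t₂)
      (Icc 0 1) :=
  hX.comp_affine (t₂ - t₁) t₁ (𝓜.mapsTo_segment h₁ h₂)

theorem segment_zero (q : ℝ × ℝ) (t₁ t₂ : ℝ) : 𝓜.segment q t₁ t₂ 0 = (𝓜.H.lift q t₁).1 := by
  simp [segment]

theorem segment_one (q : ℝ × ℝ) (t₁ t₂ : ℝ) : 𝓜.segment q t₁ t₂ 1 = (𝓜.H.lift q t₂).1 := by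
  simp [segment]

theorem segmentVel_zero (q : ℝ × ℝ) (t₁ t₂ : ℝ) :
    𝓜.segmentVel q t₁ t₂ 0 = (t₂ - t₁) • 𝓜.vel q t₁ := by
  simp [segmentVel]

theorem segmentVel_one (q : ℝ × ℝ) (t₁ t₂ : ℝ) :
    𝓜.segmentVel q t₁ t₂ 1 = (t₂ - t₁) • 𝓜.vel q t₂ := by
  simp [segmentVel]

theorem onSegment_zero (X : ℝ → E2 × E2) (t₁ t₂ : ℝ) :
    onSegment X t₁ t₂ 0 = ((X t₁).1, (t₂ - t₁) • (X t₁).2) := by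
  simp [onSegment]

theorem onSegment_one (X : ℝ → E2 × E2) (t₁ t₂ : ℝ) :
    onSegment X t₁ t₂ 1 = ((X t₂).1, (t₂ - t₁) • (X t₂).2) := by
  simp [onSegment]

/-- Covectors at two points of a geodesic that have the same image under the canonical map are the
values of the derivative of a Jacobi field that vanishes at both points. -/
theorem exists_isJac_of_covectors [T2Space N] {Xy Xη : ℝ → E2 × E2} (hX : 𝓜.IsVariation q Xy Xη)
    (hq : q ∈ 𝓜.params) (h₁ : t₁ ∈ 𝓜.innerTimes q) (h₂ : t₂ ∈ 𝓜.innerTimes q) (hne : t₁ ≠ t₂)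
    {ξ₁ ξ₂ : E2 →L[ℝ] ℝ} (hξ₁ : ξ₁ (𝓜.vel q t₁) = 0) (hξ₂ : ξ₂ (𝓜.vel q t₂) = 0)
    (hy : ξ₁ (Xy t₁).1 = ξ₂ (Xy t₂).1) (hη : ξ₁ (Xη t₁).1 = ξ₂ (Xη t₂).1) :
    ∃ X, IsJac g (fun s => (𝓜.segment q t₁ t₂ s, 𝓜.segmentVel q t₁ t₂ s)) X (Icc 0 1) ∧
      (X 0).1 = 0 ∧ (X 1).1 = 0 ∧ gform g (𝓜.segment q t₁ t₂ 0) (X 0).2 = ξ₁ ∧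
      gform g (𝓜.segment q t₁ t₂ 1) (X 1).2 = ξ₂ := by
  have hZ := 𝓜.isGeo_segment hq h₁ h₂
  obtain ⟨a₁, ha₁⟩ := exists_gform_eq g (𝓜.segment q t₁ t₂ 0) ξ₁
  obtain ⟨a₂, ha₂⟩ := exists_gform_eq g (𝓜.segment q t₁ t₂ 1) ξ₂
  obtain ⟨X, hJ, hX0⟩ := hZ.exists_isJac (0, a₁)
  have h1 : (1 : ℝ) ∈ Icc (0 : ℝ) 1 := right_mem_Icc.2 zero_le_one
  have hδ : t₂ - t₁ ≠ 0 := sub_ne_zero.2 hne.symm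
  have hV : 𝓜.vel q t₂ ≠ 0 := fun h => by
    have := 𝓜.gform_vel_vel hq h₂
    simp [h] at this
  -- the deviation of the Jacobi field at the second point from the field that is claimed
  have hprod : ∀ {Y : ℝ → E2 × E2}, IsJac g (𝓜.H.lift q) Y (𝓜.innerTimes q) →
      ξ₁ (Y t₁).1 = ξ₂ (Y t₂).1 → sympl g (𝓜.H.lift q t₂).1
        ((t₂ - t₁) • (X 1).1, (X 1).2 - a₂) (Y t₂) = 0 := by
    intro Y hY he
    have := hJ.sympl_eq hZ (𝓜.isJac_onSegment hY h₁ h₂) h1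
    simp only [sympl, onSegment_zero, onSegment_one, hX0, map_zero, zero_apply, ha₁, map_smul,
      smul_eq_mul, he, ← ha₂, 𝓜.segment_one] at this
    simp only [sympl, map_smul, map_sub, smul_apply, sub_apply, smul_eq_mul]
    linarith
  have hn1 : gform g (𝓜.H.lift q t₂).1 (X 1).1 (𝓜.vel q t₂) = 0 := by
    have := hJ.velocity_eq hZ h1
    simp only [hX0, map_zero, zero_apply, ha₁, 𝓜.segmentVel_zero, 𝓜.segmentVel_one, map_smul,
      smul_eq_mul, hξ₁, mul_zero, add_zero, 𝓜.segment_one] at this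
    exact (mul_eq_zero.1 this).resolve_left hδ
  have hn2 : gform g (𝓜.H.lift q t₂).1 (X 1).2 (𝓜.vel q t₂) = 0 := by
    have := hJ.deriv_velocity_eq hZ h1
    simp only [hX0, ha₁, 𝓜.segmentVel_zero, 𝓜.segmentVel_one, map_smul,
      smul_eq_mul, hξ₁, mul_zero, 𝓜.segment_one] at this
    exact (mul_eq_zero.1 this).resolve_left hδ
  have hzero := eq_zero_of_sympl_eq_zero (g := g) hV (hX.normal_y t₂ h₂) (hX.normal_η t₂ h₂)
    (A := ((t₂ - t₁) • (X 1).1, (X 1).2 - a₂))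
    (by simp only [map_smul, smul_apply, hn1, smul_zero])
    (by
      rw [𝓜.segment_one] at ha₂
      simp only [map_sub, sub_apply, hn2, ha₂, hξ₂, sub_zero])
    (by rw [hX.sympl_eq t₂ h₂]; exact one_ne_zero) (hprod hX.jac_y hy) (hprod hX.jac_η hη)
  have hX1 : (X 1).1 = 0 := (smul_eq_zero.1 (congrArg Prod.fst hzero)).resolve_left hδ
  have hX2 : (X 1).2 = a₂ := sub_eq_zero.1 (congrArg Prod.snd hzero)
  exact ⟨X, hJ, by rw [hX0], hX1, by rw [hX0, ha₁], by rw [hX2, ha₂]⟩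

end GeodesicManifold

namespace GeodesicManifold

variable {g : Metric N} (𝓜 : GeodesicManifold g) {q : ℝ × ℝ} {t₁ t₂ : ℝ} {w₁ w₂ : Cotangent N}

/-- The derivatives at the end points of a Jacobi field that vanishes there are normal to the
geodesic, and have the same product with all other Jacobi fields. -/
theorem covectors_of_isJac [T2Space N] (hq : q ∈ 𝓜.params) (h₁ : t₁ ∈ 𝓜.innerTimes q)
    (h₂ : t₂ ∈ 𝓜.innerTimes q) (hne : t₁ ≠ t₂) {X : ℝ → E2 × E2}
    (hX : IsJac g (fun s => (𝓜.segment q t₁ t₂ s, 𝓜.segmentVel q t₁ t₂ s)) X (Icc 0 1))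
    (hX0 : (X 0).1 = 0) (hX1 : (X 1).1 = 0) :
    gform g (𝓜.segment q t₁ t₂ 0) (X 0).2 (𝓜.vel q t₁) = 0 ∧
    gform g (𝓜.segment q t₁ t₂ 1) (X 1).2 (𝓜.vel q t₂) = 0 ∧
    ∀ Y : ℝ → E2 × E2, IsJac g (𝓜.H.lift q) Y (𝓜.innerTimes q) →
      gform g (𝓜.segment q t₁ t₂ 0) (X 0).2 (Y t₁).1
        = gform g (𝓜.segment q t₁ t₂ 1) (X 1).2 (Y t₂).1 := by
  have hZ := 𝓜.isGeo_segment hq h₁ h₂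
  have h1 : (1 : ℝ) ∈ Icc (0 : ℝ) 1 := right_mem_Icc.2 zero_le_one
  have hδ : t₂ - t₁ ≠ 0 := sub_ne_zero.2 hne.symm
  have hn1 : gform g (𝓜.segment q t₁ t₂ 0) (X 0).2 (𝓜.vel q t₁) = 0 := by
    have := hX.velocity_eq hZ h1
    simp only [hX0, hX1, map_zero, zero_apply, 𝓜.segmentVel_zero, map_smul, smul_eq_mul, mul_zero,
      zero_add, sub_zero, one_mul] at this
    exact (mul_eq_zero.1 this.symm).resolve_left hδ
  refine ⟨hn1, ?_, fun Y hY => ?_⟩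
  · have := hX.deriv_velocity_eq hZ h1
    simp only [𝓜.segmentVel_zero, 𝓜.segmentVel_one, map_smul, smul_eq_mul, hn1, mul_zero] at this
    exact (mul_eq_zero.1 this).resolve_left hδ
  · have := hX.sympl_eq hZ (𝓜.isJac_onSegment hY h₁ h₂) h1
    simp only [sympl, onSegment_zero, onSegment_one, hX0, hX1, map_zero, zero_apply] at this
    linarith

/-- Different covectors with the same image under the canonical map come from a Jacobi field that
vanishes at their base points. -/
theorem exists_segment_of_related [T2Space N] {Γ : (ℝ × ℝ) × (ℝ × ℝ)} (hne : w₁ ≠ w₂)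
    (h₁ : (Γ, w₁) ∈ 𝓜.canonicalRelation) (h₂ : (Γ, w₂) ∈ 𝓜.canonicalRelation) :
    ∃ (c V : ℝ → _) (X : ℝ → E2 × E2), 𝓜.IsSegment c ∧ c 0 = w₁.1 ∧ c 1 = w₂.1 ∧ V 0 ≠ 0 ∧
      IsGeo g (fun s => (c s, V s)) (Icc 0 1) ∧ IsJac g (fun s => (c s, V s)) X (Icc 0 1) ∧
      (X 0).1 = 0 ∧ (X 1).1 = 0 ∧ gform g (c 0) (X 0).2 = covec w₁ ∧
      gform g (c 1) (X 1).2 = covec w₂ := by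
  obtain ⟨q, r⟩ := Γ
  have hq : q ∈ 𝓜.params := h₁.2.2.1
  obtain ⟨Xy, Xη, hX⟩ := 𝓜.exists_isVariation hq
  obtain ⟨hw₁, -, t₁, ht₁, hy₁, hη₁⟩ := (𝓜.mem_canonicalRelation_iff hX).1 h₁
  obtain ⟨hw₂, -, t₂, ht₂, hy₂, hη₂⟩ := (𝓜.mem_canonicalRelation_iff hX).1 h₂
  have hV : ∀ {t}, t ∈ 𝓜.innerTimes q → 𝓜.vel q t ≠ 0 := fun ht h => by
    have := 𝓜.gform_vel_vel hq ht
    simp [h] at this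
  have ht : t₁ ≠ t₂ := by
    rintro rfl
    refine hne (cotangent_ext (ht₁.point_eq.trans ht₂.point_eq.symm) (sub_eq_zero.1 ?_))
    refine eq_zero_of_apply_eq_zero (g := g) (hV ht₁.mem_times) (hX.normal_y t₁ ht₁.mem_times)
      (hX.normal_η t₁ ht₁.mem_times) (by rw [hX.sympl_eq t₁ ht₁.mem_times]; exact one_ne_zero)
      ?_ ?_ ?_
    · rw [sub_apply, ht₁.apply_vel, ht₂.apply_vel, sub_zero]
    · rw [sub_apply, hy₁, hy₂, sub_self]
    · rw [sub_apply, hη₁, hη₂, sub_self]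
  have hZ := 𝓜.isGeo_segment hq ht₁.mem_times ht₂.mem_times
  obtain ⟨X, hJ, h⟩ := 𝓜.exists_isJac_of_covectors hX hq ht₁.mem_times ht₂.mem_times ht
    ht₁.apply_vel ht₂.apply_vel (hy₁.trans hy₂.symm) (hη₁.trans hη₂.symm)
  refine ⟨𝓜.segment q t₁ t₂, 𝓜.segmentVel q t₁ t₂, X,
    ⟨hZ.isGeodesicOn (uniqueDiffOn_Icc zero_lt_one), q, hq, t₁, Ioo_subset_Icc_self ht₁.mem_times,
      t₂, Ioo_subset_Icc_self ht₂.mem_times, ht, fun s _ => rfl⟩,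
    (𝓜.segment_zero q t₁ t₂).trans ht₁.point_eq.symm,
    (𝓜.segment_one q t₁ t₂).trans ht₂.point_eq.symm, ?_, hZ, hJ, h⟩
  rw [𝓜.segmentVel_zero]
  exact smul_ne_zero (sub_ne_zero.2 ht.symm) (hV ht₁.mem_times)

/-- The derivatives at the end points of a Jacobi field that vanishes there, along a segment of a
geodesic, have the same image under the canonical map. -/
theorem related_of_isJacobiFieldOn [T2Space N] {c : ℝ → N} (hc : 𝓜.IsSegment c)
    {J : ∀ s, TangentSpace (𝓡 2) (c s)} (hJ : IsJacobiFieldOn g c (Icc 0 1) J) (hJ0 : J 0 = 0)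
    (hJ1 : J 1 = 0) {l : ℝ} (hw₁ : covec w₁ ≠ 0) (hw₂ : covec w₂ ≠ 0)
    (hM₁ : w₁.1 ∈ interior 𝓜.M) (hM₂ : w₂.1 ∈ interior 𝓜.M)
    (h₁ : w₁ = ⟨c 0, l • g.inner (c 0) (covDeriv g c (Icc 0 1) J 0)⟩)
    (h₂ : w₂ = ⟨c 1, l • g.inner (c 1) (covDeriv g c (Icc 0 1) J 1)⟩) :
    ∃ Γ, (Γ, w₁) ∈ 𝓜.canonicalRelation ∧ (Γ, w₂) ∈ 𝓜.canonicalRelation := by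
  obtain ⟨-, q, hq, t₁, ht₁, t₂, ht₂, hne, hcs⟩ := hc
  have hcs' : ∀ s ∈ Icc (0 : ℝ) 1, c s = 𝓜.segment q t₁ t₂ s := hcs
  have e0 : w₁.1 = c 0 := congrArg (fun w : Cotangent N => w.1) h₁
  have e1 : w₂.1 = c 1 := congrArg (fun w : Cotangent N => w.1) h₂
  have f0 : covec w₁ = l • gform g (c 0) (covDeriv g c (Icc 0 1) J 0) := congrArg covec h₁
  have f1 : covec w₂ = l • gform g (c 1) (covDeriv g c (Icc 0 1) J 1) := congrArg covec h₂
  have m0 : (0 : ℝ) ∈ Icc (0 : ℝ) 1 := left_mem_Icc.2 zero_le_one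
  have m1 : (1 : ℝ) ∈ Icc (0 : ℝ) 1 := right_mem_Icc.2 zero_le_one
  rw [hcs' 0 m0] at e0 f0
  rw [hcs' 1 m1] at e1 f1
  have e0' := e0.trans (𝓜.segment_zero q t₁ t₂)
  have e1' := e1.trans (𝓜.segment_one q t₁ t₂)
  replace ht₁ : t₁ ∈ 𝓜.innerTimes q := 𝓜.mem_innerTimes hq ht₁ (by rw [e0'] at hM₁; exact hM₁)
  replace ht₂ : t₂ ∈ 𝓜.innerTimes q := 𝓜.mem_innerTimes hq ht₂ (by rw [e1'] at hM₂; exact hM₂)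
  have hZ : IsGeo g (fun s => (c s, 𝓜.segmentVel q t₁ t₂ s)) (Icc 0 1) :=
    (𝓜.isGeo_segment hq ht₁ ht₂).congr fun s hs => Prod.ext (hcs' s hs) rfl
  have hX := (hJ.isJac (uniqueDiffOn_Icc zero_lt_one) hZ).congr
    (Z' := fun s => (𝓜.segment q t₁ t₂ s, 𝓜.segmentVel q t₁ t₂ s))
    (fun s hs => Prod.ext (hcs' s hs).symm rfl) (fun _ _ => rfl)
  obtain ⟨n1, n2, hY⟩ := 𝓜.covectors_of_isJac hq ht₁ ht₂ hne hX hJ0 hJ1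
  have hval : ∀ Y : ℝ → E2 × E2, IsJac g (𝓜.H.lift q) Y (𝓜.innerTimes q) →
      covec w₂ (Y t₂).1 = covec w₁ (Y t₁).1 := fun Y h => by
    rw [f0, f1]
    exact congrArg (l • ·) (hY Y h).symm
  obtain ⟨Xy, Xη, hvar⟩ := 𝓜.exists_isVariation hq
  refine ⟨(q, covec w₁ (Xy t₁).1, covec w₁ (Xη t₁).1),
    (𝓜.mem_canonicalRelation_iff hvar).2 ⟨hw₁, hM₁, t₁, ⟨hq, ht₁, e0', ?_⟩, rfl, rfl⟩,
    (𝓜.mem_canonicalRelation_iff hvar).2 ⟨hw₂, hM₂, t₂, ⟨hq, ht₂, e1', ?_⟩, ?_, ?_⟩⟩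
  · rw [f0, smul_apply, n1, smul_zero]
  · rw [f1, smul_apply, n2, smul_zero]
  · exact hval Xy hvar.jac_y
  · exact hval Xη hvar.jac_η

end GeodesicManifold

end XRay

end

theorem mainTheorem6 {N : Type*} [TopologicalSpace N] [T2Space N] [ChartedSpace XRay.E2 N]
    [IsManifold (𝓡 2) ∞ N] (g : XRay.Metric N) (𝓜 : XRay.GeodesicManifold g)
    (p₁ p₂ : N)
    (ξ₁ : TangentSpace (𝓡 2) p₁ →L[ℝ] ℝ) (ξ₂ : TangentSpace (𝓡 2) p₂ →L[ℝ] ℝ)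
    (h₁ : (⟨p₁, ξ₁⟩ : XRay.Cotangent N) ∈ 𝓜.conormals)
    (h₂ : (⟨p₂, ξ₂⟩ : XRay.Cotangent N) ∈ 𝓜.conormals)
    (hne : (⟨p₁, ξ₁⟩ : XRay.Cotangent N) ≠ ⟨p₂, ξ₂⟩) :
    𝓜.canonicalMap ⟨p₁, ξ₁⟩ = 𝓜.canonicalMap ⟨p₂, ξ₂⟩ ↔
      ∃ c : ℝ → N, 𝓜.IsSegment c ∧ c 0 = p₁ ∧ c 1 = p₂ ∧
        XRay.ConjugateAlong g c ∧
        ∃ J : ∀ s, TangentSpace (𝓡 2) (c s),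
          (XRay.IsJacobiFieldOn g c (Icc 0 1) J ∧ (∃ s ∈ Icc (0 : ℝ) 1, J s ≠ 0) ∧
            J 0 = 0 ∧ J 1 = 0) ∧
          (∀ J' : ∀ s, TangentSpace (𝓡 2) (c s),
            XRay.IsJacobiFieldOn g c (Icc 0 1) J' → J' 0 = 0 → J' 1 = 0 →
              ∃ a : ℝ, ∀ s ∈ Icc (0 : ℝ) 1, J' s = a • J s) ∧
          ∃ l : ℝ, l ≠ 0 ∧
            (⟨p₁, ξ₁⟩ : XRay.Cotangent N) =
              ⟨c 0, l • g.inner (c 0) (XRay.covDeriv g c (Icc 0 1) J 0)⟩ ∧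
            (⟨p₂, ξ₂⟩ : XRay.Cotangent N) =
              ⟨c 1, l • g.inner (c 1) (XRay.covDeriv g c (Icc 0 1) J 1)⟩ := by
  rw [𝓜.canonicalMap_eq_iff h₁ h₂]
  constructor
  · rintro ⟨Γ, hΓ₁, hΓ₂⟩
    obtain ⟨c, V, X, hc, hc0, hc1, hV, hZ, hX, hX0, hX1, hξ₁, hξ₂⟩ :=
      𝓜.exists_segment_of_related hne hΓ₁ hΓ₂
    have hs : UniqueDiffOn ℝ (Icc (0 : ℝ) 1) := uniqueDiffOn_Icc zero_lt_one
    have m0 : (0 : ℝ) ∈ Icc (0 : ℝ) 1 := left_mem_Icc.2 zero_le_one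
    have m1 : (1 : ℝ) ∈ Icc (0 : ℝ) 1 := right_mem_Icc.2 zero_le_one
    have hK : (X 0).2 ≠ 0 := fun h => by
      rw [h, map_zero] at hξ₁
      exact h₁.1 hξ₁.symm
    refine ⟨c, hc, hc0, hc1, hX.conjugateAlong hZ hK hX0 hX1, fun s => (X s).1,
      ⟨hX.isJacobiFieldOn hs hZ, ?_, hX0, hX1⟩, fun J' hJ' hJ0 hJ1 => ?_, 1, one_ne_zero, ?_, ?_⟩
    · by_contra! h
      exact hK (hX.snd_eq_zero hZ h)
    · obtain ⟨a, ha⟩ := hX.exists_smul_eq hZ (hJ'.isJac hs hZ) hV hK hX0 hX1 hJ0 hJ1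
      exact ⟨a, fun s hs => congrArg Prod.fst (ha s hs)⟩
    · refine XRay.cotangent_ext hc0.symm (hξ₁.symm.trans ?_)
      rw [hX.covDeriv_eq hZ m0 (hs 0 m0), one_smul]
      rfl
    · refine XRay.cotangent_ext hc1.symm (hξ₂.symm.trans ?_)
      rw [hX.covDeriv_eq hZ m1 (hs 1 m1), one_smul]
      rfl
  · rintro ⟨c, hc, -, -, -, J, ⟨hJ, -, hJ0, hJ1⟩, -, l, -, e₁, e₂⟩
    exact 𝓜.related_of_isJacobiFieldOn hc hJ hJ0 hJ1 h₁.1 h₂.1 h₁.2.1 h₂.2.1 e₁ e₂
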